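/- Let $k\ge 1$ be a fixed integer. A point $(i,\sigma(i))$ of a permutation $\sigma$ is called external if it is a left-to-right or right-to-left maximum or minimum (a record), and internal otherwise; let $ASq(n,k)$ be the set of permutations of size $n+k$ with exactly $n$ external points and exactly $k$ internal points. A permuton is a Borel probability measure on $[0,1]^2$ with uniform marginals, i.e. $\mu([0,1]\times[a,b])=\mu([a,b]\times[0,1])=b-a$ for all $0\le a\le b\le 1$; the set of permutons carries the topology of weak convergence and its Borel $\sigma$-algebra. To a permutation $\sigma$ of size $m\ge 1$ associate the permuton $$\mu_\sigma=m\sum_{i=1}^m \mathrm{Leb}\Big(\,\cdot\,\cap\big[\tfrac{i-1}{m},\tfrac{i}{m}\big]\times\big[\tfrac{\sigma(i)-1}{m},\tfrac{\sigma(i)}{m}\big]\Big).$$ For $z\in[0,1]$ let $L_1,L_2,L_3,L_4$ be the segments joining $(0,z)$ to $(z,0)$, $(0,z)$ to $(1-z,1)$, $(z,0)$ to $(1,1-z)$, and $(1-z,1)$ to $(1,1-z)$, and let $\mu^z$ be the permuton $\mu^z(S)=\sum_{j=1}^4\frac12\,\mathrm{Leb}\big(\pi_x(S\cap L_j)\big)$,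 where $\pi_x$ is the projection to the $x$-axis. Let $\boldsymbol z^{(k)}$ be a random variable in $(0,1)$ with density $f(t)=(2k+1)\binom{2k}{k}(t(1-t))^k$. Then $\boldsymbol z^{(k)}$ is Beta distributed with parameters $(k+1,k+1)$. Moreover, if $\boldsymbol\sigma_n$ is a uniform random element of $ASq(n,k)$ (for every $n$ for which this set is non-empty), then, as $n\to\infty$, the random permutons $\mu_{\boldsymbol\sigma_n}$ converge in distribution to the random permuton $\mu^{\boldsymbol z^{(k)}}$. -/

import Mathlib

open MeasureTheory Set

namespace AlmostSquare

/-! ### Records and almost square permutations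

A permutation of size `n` is an element of `Equiv.Perm (Fin n)`; its points are `(i, σ i)`. -/

/-- The point `(i, σ i)` is external: it is a left-to-right maximum, a left-to-right minimum,
a right-to-left maximum or a right-to-left minimum. -/
def IsExternal {n : ℕ} (σ : Equiv.Perm (Fin n)) (i : Fin n) : Prop :=
  (∀ j, j < i → σ j < σ i) ∨ (∀ j, j < i → σ i < σ j) ∨
    (∀ j, i < j → σ j < σ i) ∨ (∀ j, i < j → σ i < σ j)

/-- The permutations of size `n + k` with exactly `n` external and `k` internal points. -/
def ASq (n k : ℕ) : Set (Equiv.Perm (Fin (n + k))) :=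
  {σ | {i | IsExternal σ i}.ncard = n ∧ {i | ¬ IsExternal σ i}.ncard = k}

/-- The discrete σ-algebra on the finite set of permutations of size `n`. -/
instance instMeasurableSpacePerm (n : ℕ) : MeasurableSpace (Equiv.Perm (Fin n)) := ⊤

/-! ### Permutons -/

/-- A measure on the unit square with uniform marginals. -/
def HasUniformMarginals (μ : Measure (unitInterval × unitInterval)) : Prop :=
  ∀ a b : unitInterval, a ≤ b →
    μ (univ ×ˢ Icc a b) = ENNReal.ofReal (b - a) ∧
    μ (Icc a b ×ˢ univ) = ENNReal.ofReal (b - a)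

/-- A permuton is a Borel probability measure on the unit square with uniform marginals. -/
def Permuton : Type :=
  {μ : ProbabilityMeasure (unitInterval × unitInterval) //
    HasUniformMarginals (μ : Measure (unitInterval × unitInterval))}

/-- The topology of weak convergence on the set of permutons. -/
instance instTopologicalSpacePermuton : TopologicalSpace Permuton :=
  inferInstanceAs (TopologicalSpace
    {μ : ProbabilityMeasure (unitInterval × unitInterval) //
      HasUniformMarginals (μ : Measure (unitInterval × unitInterval))})

/-- The set of permutons carries the Borel σ-algebra of the weak topology. -/
instance instMeasurableSpacePermuton : MeasurableSpace Permuton := borel Permuton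

instance instBorelSpacePermuton : BorelSpace Permuton := ⟨rfl⟩

theorem HasUniformMarginals.isProbabilityMeasure
    {μ : Measure (unitInterval × unitInterval)} (h : HasUniformMarginals μ) :
    IsProbabilityMeasure μ := by
  constructor
  have h1 := (h 0 1 zero_le_one).1
  have h2 : (univ : Set unitInterval) ×ˢ Icc (0 : unitInterval) 1 = univ := by
    ext p
    simp [unitInterval.le_one']
  rw [h2] at h1
  simpa using h1

/-- A measure with uniform marginals, as a permuton. -/
noncomputable def Permuton.ofMeasure (μ : Measure (unitInterval × unitInterval))
    (h : HasUniformMarginals μ) : Permuton :=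
  ⟨⟨μ, h.isProbabilityMeasure⟩, h⟩

/-! ### The permuton of a permutation -/

/-- The interval `[i/n, (i+1)/n]` inside `[0,1]` (positions are counted from `0`). -/
def gridInterval (n : ℕ) (i : Fin n) : Set unitInterval :=
  {x | (i : ℝ) / n ≤ x ∧ (x : ℝ) ≤ ((i : ℝ) + 1) / n}

/-- `n` times the sum over `i` of the area measures of the squares
`[i/n, (i+1)/n] × [σ(i)/n, (σ(i)+1)/n]`. -/
noncomputable def permMeasure {n : ℕ} (σ : Equiv.Perm (Fin n)) :
    Measure (unitInterval × unitInterval) :=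
  (n : ENNReal) • ∑ i, volume.restrict (gridInterval n i ×ˢ gridInterval n (σ i))

theorem volume_subtype_setOf (s : Set ℝ) :
    volume {x : unitInterval | (x : ℝ) ∈ s} = volume (s ∩ Icc 0 1) := by
  have h := comap_subtype_coe_apply (μ := (volume : Measure ℝ))
    (measurableSet_Icc (a := (0 : ℝ)) (b := 1)) {x : unitInterval | (x : ℝ) ∈ s}
  have h2 : (Subtype.val '' {x : unitInterval | (x : ℝ) ∈ s}) = s ∩ Icc 0 1 := by
    ext x
    constructor
    · rintro ⟨y, hy, rfl⟩
      exact ⟨hy, y.2⟩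
    · rintro ⟨h1, h2⟩
      exact ⟨⟨x, h2⟩, h1, rfl⟩
  rw [← h2, ← h]
  rfl

theorem volume_Icc_unitInterval (a b : unitInterval) :
    volume (Icc a b) = ENNReal.ofReal (b - a) := by
  have h : (Icc a b : Set unitInterval) = {x : unitInterval | (x : ℝ) ∈ Icc (a : ℝ) b} := by
    ext x
    simp
  rw [h, volume_subtype_setOf _,
    inter_eq_left.2 (Icc_subset_Icc a.2.1 b.2.2), Real.volume_Icc]

theorem measurableSet_gridInterval (n : ℕ) (i : Fin n) :
    MeasurableSet (gridInterval n i) :=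
  (measurableSet_Icc (a := (i : ℝ) / n) (b := ((i : ℝ) + 1) / n)).preimage
    measurable_subtype_coe

theorem volume_gridInterval {n : ℕ} (i : Fin n) :
    volume (gridInterval n i) = ENNReal.ofReal (1 / n) := by
  have hn : (0 : ℝ) < n := by exact_mod_cast i.pos
  have hi : (i : ℝ) + 1 ≤ n := by exact_mod_cast i.2
  have h := volume_subtype_setOf (Icc ((i : ℝ) / n) (((i : ℝ) + 1) / n))
  have h2 : Icc ((i : ℝ) / n) (((i : ℝ) + 1) / n) ⊆ Icc 0 1 :=
    Icc_subset_Icc (by positivity) (by rw [div_le_one hn]; exact hi)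
  rw [inter_eq_left.2 h2, Real.volume_Icc] at h
  have h3 : ((i : ℝ) + 1) / n - (i : ℝ) / n = 1 / n := by ring
  rw [h3] at h
  exact h

theorem sum_restrict_gridInterval {n : ℕ} (hn : 0 < n) :
    ∑ i, (volume : Measure unitInterval).restrict (gridInterval n i) = volume := by
  have hn' : (0 : ℝ) < n := by exact_mod_cast hn
  have hcover : ⋃ i, gridInterval n i = univ := by
    refine eq_univ_of_forall fun x => ?_
    rcases eq_or_lt_of_le x.2.2 with h1 | h1
    · refine mem_iUnion.2 ⟨⟨n - 1, by omega⟩, ?_⟩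
      have h2 : ((n - 1 : ℕ) : ℝ) = n - 1 := by
        rw [Nat.cast_sub (by omega)]
        simp
      constructor
      · rw [div_le_iff₀ hn', h1, h2]
        linarith
      · rw [le_div_iff₀ hn', h1, h2]
        linarith
    · have h0 : 0 ≤ (x : ℝ) * n := mul_nonneg x.2.1 hn'.le
      refine mem_iUnion.2 ⟨⟨⌊(x : ℝ) * n⌋₊, ?_⟩, ?_⟩
      · rw [Nat.floor_lt h0]
        nlinarith
      · constructor
        · rw [div_le_iff₀ hn']
          exact Nat.floor_le h0
        · rw [le_div_iff₀ hn']
          exact (Nat.lt_floor_add_one _).le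
  have hdisj : Pairwise
      (Function.onFun (AEDisjoint (volume : Measure unitInterval)) (gridInterval n)) := by
    have key : ∀ i j : Fin n, i < j →
        AEDisjoint (volume : Measure unitInterval) (gridInterval n i) (gridInterval n j) := by
      intro i j hij
      refine measure_mono_null (t := {x : unitInterval | (x : ℝ) ∈ ({(j : ℝ) / n} : Set ℝ)})
        ?_ ?_
      · rintro x ⟨⟨_, h2⟩, ⟨h3, _⟩⟩
        refine le_antisymm (h2.trans ?_) h3
        have : (i : ℝ) + 1 ≤ j := by exact_mod_cast hij
        gcongr
      · rw [volume_subtype_setOf _]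
        exact measure_mono_null inter_subset_left (by simp)
    intro i j hij
    rcases lt_or_gt_of_ne hij with h | h
    · exact key i j h
    · exact (key j i h).symm
  have h := Measure.restrict_iUnion_ae hdisj
    (fun i => (measurableSet_gridInterval n i).nullMeasurableSet)
  rw [hcover, Measure.restrict_univ, Measure.sum_fintype] at h
  exact h.symm

theorem permMeasure_prod {n : ℕ} (σ : Equiv.Perm (Fin n)) (s t : Set unitInterval) :
    permMeasure σ (s ×ˢ t) = (n : ENNReal) * ∑ i,
      volume.restrict (gridInterval n i) s * volume.restrict (gridInterval n (σ i)) t := by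
  simp only [permMeasure, Measure.smul_apply, Measure.coe_finsetSum, Finset.sum_apply,
    smul_eq_mul, Measure.volume_eq_prod, ← Measure.prod_restrict, Measure.prod_prod]

theorem hasUniformMarginals_permMeasure {n : ℕ} (hn : 0 < n) (σ : Equiv.Perm (Fin n)) :
    HasUniformMarginals (permMeasure σ) := by
  have hn' : (0 : ℝ) < n := by exact_mod_cast hn
  have hone : (n : ENNReal) * ENNReal.ofReal (1 / n) = 1 := by
    rw [← ENNReal.ofReal_natCast, ← ENNReal.ofReal_mul hn'.le, mul_one_div_cancel hn'.ne',
      ENNReal.ofReal_one]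
  have hsum : ∀ s : Set unitInterval,
      ∑ i, volume.restrict (gridInterval n i) s = volume s := by
    intro s
    conv_rhs => rw [← sum_restrict_gridInterval hn]
    simp
  intro a b _
  constructor
  · rw [permMeasure_prod σ]
    simp only [Measure.restrict_apply_univ, volume_gridInterval, ← Finset.mul_sum]
    rw [← mul_assoc, hone, one_mul,
      Equiv.sum_comp σ fun i => volume.restrict (gridInterval n i) (Icc a b), hsum,
      volume_Icc_unitInterval]
  · rw [permMeasure_prod σ]
    simp only [Measure.restrict_apply_univ, volume_gridInterval, ← Finset.sum_mul]
    rw [mul_comm (∑ i, _), ← mul_assoc, hone, one_mul, hsum, volume_Icc_unitInterval]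

/-- The permuton `μ_σ` of a permutation `σ` of size `n ≥ 1`. -/
noncomputable def permPermuton {n : ℕ} (hn : 0 < n) (σ : Equiv.Perm (Fin n)) : Permuton :=
  Permuton.ofMeasure (permMeasure σ) (hasUniformMarginals_permMeasure hn σ)

/-! ### The rectangle permuton -/

/-- For a segment `L = {(x, f x) | a ≤ x ≤ b}` inside the unit square, the measure
`S ↦ (1/2) * Leb {x ∈ [a,b] | (x, f x) ∈ S}`, that is, half of the Lebesgue measure of the
projection of `S ∩ L` to the `x`-axis. The truncation `Set.projIcc` only serves to land in the
unit square. -/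
noncomputable def segmentMeasure (f : ℝ → ℝ) (a b : ℝ) :
    Measure (unitInterval × unitInterval) :=
  (2⁻¹ : ENNReal) •
    ((volume : Measure unitInterval).restrict {x | a ≤ (x : ℝ) ∧ (x : ℝ) ≤ b}).map
      fun x : unitInterval => (x, projIcc (0 : ℝ) 1 zero_le_one (f x))

/-- The measure `μ^z` on the boundary of the rectangle with corners
`(z,0)`, `(0,z)`, `(1-z,1)` and `(1,1-z)`: the sum over its four sides of half of the Lebesgue
measure of the projection to the `x`-axis. -/
noncomputable def rectMeasure (z : unitInterval) : Measure (unitInterval × unitInterval) :=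
  segmentMeasure (fun x => z - x) 0 z + segmentMeasure (fun x => z + x) 0 (1 - z) +
    segmentMeasure (fun x => x - z) z 1 + segmentMeasure (fun x => 2 - z - x) (1 - z) 1

theorem segmentMeasure_prod_Icc (f : ℝ → ℝ) (hf : Continuous f) (a b : ℝ)
    (hfab : ∀ x ∈ Icc a b, f x ∈ Icc (0 : ℝ) 1) (ha : 0 ≤ a) (hb : b ≤ 1)
    (c d c' d' : unitInterval) :
    segmentMeasure f a b (Icc c d ×ˢ Icc c' d') =
      2⁻¹ * volume (Icc a b ∩ Icc (c : ℝ) d ∩ f ⁻¹' Icc (c' : ℝ) d') := by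
  have hmeas : Measurable fun x : unitInterval =>
      (x, projIcc (0 : ℝ) 1 zero_le_one (f x)) :=
    (continuous_id.prodMk
      (continuous_projIcc.comp (hf.comp continuous_subtype_val))).measurable
  rw [segmentMeasure, Measure.smul_apply, smul_eq_mul,
    Measure.map_apply hmeas (measurableSet_Icc.prod measurableSet_Icc),
    Measure.restrict_apply (hmeas (measurableSet_Icc.prod measurableSet_Icc))]
  congr 1
  rw [← inter_eq_left.2 (show Icc a b ∩ Icc (c : ℝ) d ∩ f ⁻¹' Icc (c' : ℝ) d' ⊆ Icc 0 1 from
      fun x hx => ⟨ha.trans hx.1.1.1, hx.1.1.2.trans hb⟩),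
    ← volume_subtype_setOf _]
  congr 1
  ext x
  constructor
  · rintro ⟨⟨h1, h2⟩, h3⟩
    have hx : f x ∈ Icc (0 : ℝ) 1 := hfab x h3
    simp only [projIcc_of_mem zero_le_one hx] at h2
    exact ⟨⟨h3, h1⟩, h2⟩
  · rintro ⟨⟨h3, h1⟩, h2⟩
    refine ⟨⟨h1, ?_⟩, h3⟩
    have hx : f x ∈ Icc (0 : ℝ) 1 := hfab x h3
    simp only [projIcc_of_mem zero_le_one hx]
    exact h2

theorem segmentMeasure_add_prod (m : ℝ) (a b : ℝ)
    (hfab : ∀ x ∈ Icc a b, m + x ∈ Icc (0 : ℝ) 1) (ha : 0 ≤ a) (hb : b ≤ 1)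
    (c d c' d' : unitInterval) :
    segmentMeasure (fun x => m + x) a b (Icc c d ×ˢ Icc c' d') =
      2⁻¹ * ENNReal.ofReal (min (min b d) (d' - m) - max (max a c) (c' - m)) := by
  rw [segmentMeasure_prod_Icc _ (by fun_prop) a b hfab ha hb, preimage_const_add_Icc,
    Icc_inter_Icc, Icc_inter_Icc, Real.volume_Icc]

theorem segmentMeasure_sub_prod (m : ℝ) (a b : ℝ)
    (hfab : ∀ x ∈ Icc a b, m - x ∈ Icc (0 : ℝ) 1) (ha : 0 ≤ a) (hb : b ≤ 1)
    (c d c' d' : unitInterval) :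
    segmentMeasure (fun x => m - x) a b (Icc c d ×ˢ Icc c' d') =
      2⁻¹ * ENNReal.ofReal (min (min b d) (m - c') - max (max a c) (m - d')) := by
  rw [segmentMeasure_prod_Icc _ (by fun_prop) a b hfab ha hb, preimage_const_sub_Icc,
    Icc_inter_Icc, Icc_inter_Icc, Real.volume_Icc]

theorem rectMeasure_prod (z c d c' d' : unitInterval) :
    rectMeasure z (Icc c d ×ˢ Icc c' d') = ENNReal.ofReal (2⁻¹ *
      (max (min (min (z : ℝ) d) (z - c') - max (max 0 (c : ℝ)) (z - d')) 0 +
        max (min (min (1 - z : ℝ) d) (d' - z) - max (max 0 (c : ℝ)) (c' - z)) 0 +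
        max (min (min 1 (d : ℝ)) (d' - -z) - max (max (z : ℝ) c) (c' - -z)) 0 +
        max (min (min 1 (d : ℝ)) (2 - z - c') - max (max (1 - z : ℝ) c) (2 - z - d')) 0)) := by
  have hz := z.2
  have h3 : (fun x : ℝ => x - (z : ℝ)) = fun x => -(z : ℝ) + x := by
    funext x
    ring
  have hof : ∀ x : ℝ, ENNReal.ofReal x = ENNReal.ofReal (max x 0) := by
    intro x
    rcases le_total x 0 with h | h
    · rw [max_eq_right h, ENNReal.ofReal_of_nonpos h, ENNReal.ofReal_zero]
    · rw [max_eq_left h]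
  rw [rectMeasure, h3]
  simp only [Measure.add_apply]
  rw [segmentMeasure_sub_prod _ _ _ (fun x hx => ⟨by linarith [hx.2], by linarith [hx.1, hz.2]⟩)
      le_rfl hz.2,
    segmentMeasure_add_prod _ _ _ (fun x hx => ⟨by linarith [hx.1, hz.1], by linarith [hx.2]⟩)
      le_rfl (by linarith [hz.1]),
    segmentMeasure_add_prod _ _ _ (fun x hx => ⟨by linarith [hx.1], by linarith [hx.2, hz.1]⟩)
      hz.1 le_rfl,
    segmentMeasure_sub_prod _ _ _
      (fun x hx => ⟨by linarith [hx.2, hz.2], by linarith [hx.1]⟩)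
      (by linarith [hz.2]) le_rfl]
  rw [← mul_add, ← mul_add, ← mul_add, ENNReal.ofReal_mul (by norm_num),
    ENNReal.ofReal_add (by positivity) (by positivity),
    ENNReal.ofReal_add (by positivity) (by positivity),
    ENNReal.ofReal_add (by positivity) (by positivity), ← hof, ← hof, ← hof, ← hof,
    ENNReal.ofReal_inv_of_pos (by norm_num)]
  simp

theorem rect_marginal_snd (z a b : ℝ) (hz : 0 ≤ z ∧ z ≤ 1) (ha : 0 ≤ a) (hab : a ≤ b)
    (hb : b ≤ 1) :
    2⁻¹ * (max (min (min z 1) (z - a) - max (max 0 0) (z - b)) 0 +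
      max (min (min (1 - z) 1) (b - z) - max (max 0 0) (a - z)) 0 +
      max (min (min 1 1) (b - -z) - max (max z 0) (a - -z)) 0 +
      max (min (min 1 1) (2 - z - a) - max (max (1 - z) 0) (2 - z - b)) 0) = b - a := by
  obtain ⟨hz0, hz1⟩ := hz
  rw [min_eq_left hz1, max_self, min_self, max_eq_left hz0,
    min_eq_left (by linarith : 1 - z ≤ 1), max_eq_left (by linarith : (0 : ℝ) ≤ 1 - z)]
  grind

theorem rect_marginal_fst (z a b : ℝ) (hz : 0 ≤ z ∧ z ≤ 1) (ha : 0 ≤ a) (hab : a ≤ b)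
    (hb : b ≤ 1) :
    2⁻¹ * (max (min (min z b) (z - 0) - max (max 0 a) (z - 1)) 0 +
      max (min (min (1 - z) b) (1 - z) - max (max 0 a) (0 - z)) 0 +
      max (min (min 1 b) (1 - -z) - max (max z a) (0 - -z)) 0 +
      max (min (min 1 b) (2 - z - 0) - max (max (1 - z) a) (2 - z - 1)) 0) = b - a := by
  obtain ⟨hz0, hz1⟩ := hz
  rw [max_eq_right ha, min_eq_right hb]
  grind

theorem hasUniformMarginals_rectMeasure (z : unitInterval) :
    HasUniformMarginals (rectMeasure z) := by
  have huniv : (univ : Set unitInterval) = Icc 0 1 := by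
    ext p
    simp [unitInterval.le_one']
  intro a b hab
  rw [huniv, rectMeasure_prod, rectMeasure_prod]
  constructor
  · congr 1
    exact rect_marginal_snd z a b z.2 a.2.1 hab b.2.2
  · congr 1
    exact rect_marginal_fst z a b z.2 a.2.1 hab b.2.2

/-- The rectangle permuton `μ^z`. -/
noncomputable def rectPermuton (z : unitInterval) : Permuton :=
  Permuton.ofMeasure (rectMeasure z) (hasUniformMarginals_rectMeasure z)

/-- The measure on `ℝ` with density `(2k+1) * binom(2k,k) * (t(1-t))^k` on `(0,1)`. -/
noncomputable def zLaw (k : ℕ) : Measure ℝ :=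
  (volume.restrict (Ioo (0 : ℝ) 1)).withDensity fun t =>
    ENNReal.ofReal ((2 * k + 1) * (Nat.choose (2 * k) k) * (t * (1 - t)) ^ k)

end AlmostSquare

/-! An almost square permutation is encoded by a word: one bit per column (lower or upper), one bit
per row (left or right), the column `z` of the lowest point, and an ordered list of the `k` internal
points. The proof compares a uniform almost square permutation with a uniform word.

Combinatorics. Starting at the lowest point and walking clockwise, the external points meet the
lower columns left of `z` backwards, the upper columns forwards and the remaining lower columns
backwards, while the rows go up through the left ones and down through the right ones. So the
permutation is increasing for two linear orders, `colKey` and `rowKey`, which depend on the labels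
only (`canonical_keyMono`), and a word is compatible with at most one almost square permutation
(`Compat.unique`). Conversely, a permutation has the same number of compatible words as any other,
once words with an extreme lowest column are given weight 2 (`card_compat`). Hence averages over
permutations are, up to a factor independent of the test function, averages over words
(`sum_wordSum`).

Geometry. If every prefix of the labels is half filled up to an error `E`, equating ranks in the two
orders puts the external points within `10 * E` of a rectangle with slopes 1 and -1
(`Regular.shape`), and the internal points cannot lie far outside it (`Regular.near_rect`). In the
other direction, if the listed points are in general position and well inside the rectangle, the
word does come from a permutation (`exists_compat`): the permutation built from the two orders has
exactly the prescribed records.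

Limit. Words of all sizes are read off from one sample: two infinite sequences of fair coins, a
uniform corner `u` and `k` uniform points of the unit square. By the strong law of large numbers `E`
is `o(N)` almost surely. Therefore, almost surely, a compatible permutation eventually exists if all
`k` points lie in the open rectangle with corner `u`, and eventually does not otherwise
(`Typical.eventually_exists_compat`, `Typical.eventually_not_compat`); in the first case its
permuton tends to that of the rectangle. The rectangle has area `2 * u * (1 - u)`, so dominated
convergence gives a limit proportional to the integral of `(u * (1 - u)) ^ k * F (μ^u)`. Taking `F =
1` supplies the normalisation and the Beta density (`tendsto_average`). -/

namespace AlmostSquare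

open scoped Classical

/-! ### Records, labels and the boundary order. -/

section Records

variable {N : ℕ}

/-- The point in column `i` is a left-to-right minimum. -/
def LRMin (σ : Equiv.Perm (Fin N)) (i : Fin N) : Prop := ∀ j, j < i → σ i < σ j

/-- The point in column `i` is a left-to-right maximum. -/
def LRMax (σ : Equiv.Perm (Fin N)) (i : Fin N) : Prop := ∀ j, j < i → σ j < σ i

/-- The point in column `i` is a right-to-left minimum. -/
def RLMin (σ : Equiv.Perm (Fin N)) (i : Fin N) : Prop := ∀ j, i < j → σ i < σ j

/-- The point in column `i` is a right-to-left maximum. -/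
def RLMax (σ : Equiv.Perm (Fin N)) (i : Fin N) : Prop := ∀ j, i < j → σ j < σ i

theorem isExternal_iff (σ : Equiv.Perm (Fin N)) (i : Fin N) :
    IsExternal σ i ↔ LRMax σ i ∨ LRMin σ i ∨ RLMax σ i ∨ RLMin σ i := Iff.rfl

/-- The point in column `i` is a minimum record. -/
def Lower (σ : Equiv.Perm (Fin N)) (i : Fin N) : Prop := LRMin σ i ∨ RLMin σ i

/-- The row of the point in column `i` carries the label "left". -/
def LeftLabel (σ : Equiv.Perm (Fin N)) (i : Fin N) : Prop :=
  LRMin σ i ∨ (σ i : ℕ) + 1 = N ∨ (LRMax σ i ∧ ¬ RLMin σ i)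

/-- The columns of the external points. -/
noncomputable def extCols (σ : Equiv.Perm (Fin N)) : Finset (Fin N) :=
  Finset.univ.filter (IsExternal σ)

/-- The columns of the minimum records. -/
noncomputable def lowerCols (σ : Equiv.Perm (Fin N)) : Finset (Fin N) :=
  Finset.univ.filter (Lower σ)

/-- The rows that carry the label "left". -/
noncomputable def leftRows (σ : Equiv.Perm (Fin N)) : Finset (Fin N) :=
  Finset.univ.filter fun j => LeftLabel σ (σ.symm j)

@[simp] theorem mem_extCols {σ : Equiv.Perm (Fin N)} {i : Fin N} :
    i ∈ extCols σ ↔ IsExternal σ i := by simp [extCols]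

@[simp] theorem mem_lowerCols {σ : Equiv.Perm (Fin N)} {i : Fin N} :
    i ∈ lowerCols σ ↔ Lower σ i := by simp [lowerCols]

@[simp] theorem mem_leftRows {σ : Equiv.Perm (Fin N)} {i : Fin N} :
    σ i ∈ leftRows σ ↔ LeftLabel σ i := by simp [leftRows]

theorem Lower.isExternal {σ : Equiv.Perm (Fin N)} {i : Fin N} (h : Lower σ i) :
    IsExternal σ i := by
  rw [isExternal_iff]
  rcases h with h | h <;> tauto

theorem perm_eq_iff_val (σ : Equiv.Perm (Fin N)) (i j : Fin N) :
    (σ i : ℕ) = σ j ↔ (i : ℕ) = j := by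
  rw [← Fin.ext_iff, ← Fin.ext_iff, σ.injective.eq_iff]

theorem lrMax_of_top {σ : Equiv.Perm (Fin N)} {i : Fin N} (h : (σ i : ℕ) + 1 = N) :
    LRMax σ i := by
  intro j hj
  have h1 := perm_eq_iff_val σ i j
  have h2 := (σ j).2
  rw [Fin.lt_def] at *
  omega

theorem LeftLabel.isExternal {σ : Equiv.Perm (Fin N)} {i : Fin N} (h : LeftLabel σ i) :
    IsExternal σ i := by
  rw [isExternal_iff]
  rcases h with h | h | h
  · tauto
  · exact Or.inl (lrMax_of_top h)
  · tauto

theorem lower_of_first {σ : Equiv.Perm (Fin N)} {i : Fin N} (h : (i : ℕ) = 0) : Lower σ i := by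
  refine Or.inl fun j hj => ?_
  rw [Fin.lt_def] at hj
  omega

theorem lower_of_last {σ : Equiv.Perm (Fin N)} {i : Fin N} (h : (i : ℕ) + 1 = N) :
    Lower σ i := by
  refine Or.inr fun j hj => ?_
  rw [Fin.lt_def] at hj
  omega

theorem lrMin_of_bottom {σ : Equiv.Perm (Fin N)} {i : Fin N} (h : (σ i : ℕ) = 0) :
    LRMin σ i := by
  intro j hj
  have h1 := perm_eq_iff_val σ i j
  rw [Fin.lt_def] at *
  omega

/-- Rank of a column along the boundary of the rectangle, for the set `D` of lower columns and
the column `z` of the lowest point. -/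
noncomputable def colKey (D : Finset (Fin N)) (z i : Fin N) : ℤ :=
  if i ∈ D then (if i ≤ z then -(i : ℤ) - 1 else 3 * N - i) else i

/-- Rank of a row along the boundary of the rectangle, for the set `L` of left rows. -/
noncomputable def rowKey (L : Finset (Fin N)) (j : Fin N) : ℤ :=
  if j ∈ L then (j : ℤ) else 3 * N - j

theorem colKey_injective (D : Finset (Fin N)) (z : Fin N) :
    Function.Injective (colKey D z) := by
  intro i j h
  have hi := i.2
  have hj := j.2
  unfold colKey at h
  apply Fin.ext
  split_ifs at h <;> omega

theorem rowKey_injective (L : Finset (Fin N)) : Function.Injective (rowKey L) := by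
  intro i j h
  have hi := i.2
  have hj := j.2
  unfold rowKey at h
  apply Fin.ext
  split_ifs at h <;> omega

/-- On the columns in `C` the permutation is increasing for the boundary order. -/
def KeyMono (σ : Equiv.Perm (Fin N)) (C D : Finset (Fin N)) (z : Fin N) (L : Finset (Fin N)) :
    Prop :=
  ∀ i ∈ C, ∀ j ∈ C, colKey D z i < colKey D z j → rowKey L (σ i) < rowKey L (σ j)

/-- The lowest point separates the two kinds of minimum record: up to column `z` they are
left-to-right, beyond it right-to-left. The first four alternatives are the four sides. The fifth is
degenerate: the top row is labelled left by convention, and a right-to-left minimum in the top row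
is the upper right corner. -/
theorem external_cases (σ : Equiv.Perm (Fin N)) (z : Fin N) (hz : (σ z : ℕ) = 0) (i : Fin N)
    (hi : IsExternal σ i) :
    (i ∈ lowerCols σ ∧ i ≤ z ∧ σ i ∈ leftRows σ ∧ LRMin σ i) ∨
    (i ∉ lowerCols σ ∧ σ i ∈ leftRows σ ∧ LRMax σ i) ∨
    (i ∉ lowerCols σ ∧ σ i ∉ leftRows σ ∧ RLMax σ i ∧ (σ i : ℕ) + 1 ≠ N) ∨
    (i ∈ lowerCols σ ∧ z < i ∧ σ i ∉ leftRows σ ∧ RLMin σ i) ∨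
    (i ∈ lowerCols σ ∧ z < i ∧ σ i ∈ leftRows σ ∧ RLMin σ i ∧ (σ i : ℕ) + 1 = N) := by
  simp only [mem_lowerCols, mem_leftRows]
  have ha : Lower σ i → i ≤ z → LRMin σ i := by
    rintro (h | h) h2
    · exact h
    · rcases eq_or_lt_of_le h2 with rfl | h3
      · exact lrMin_of_bottom hz
      · have := h z h3
        rw [Fin.lt_def] at this
        omega
  have hd : z < i → ¬ LRMin σ i := by
    intro h h2
    have := h2 z h
    rw [Fin.lt_def] at this
    omega
  rw [isExternal_iff] at hi
  have ht := lrMax_of_top (σ := σ) (i := i)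
  unfold LeftLabel Lower at *
  rw [← not_le] at hd ⊢
  rw [ne_eq]
  clear hz
  -- The order-theoretic input is contained in `ha`, `hd` and `ht`; what remains is propositional.
  generalize LRMin σ i = A, LRMax σ i = B, RLMin σ i = C, RLMax σ i = D, (i ≤ z) = G,
    ((σ i : ℕ) + 1 = N) = T at *
  by_cases A <;> by_cases B <;> by_cases C <;> by_cases G <;> simp_all <;> tauto

/-- Along one side this is the record property. Different sides are separated by the points in the
first column (`o`), in the last column (`l`) and in the top row (`t`): for instance left-to-right
minima lie weakly below the first point and left-to-right maxima weakly above it. -/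
theorem canonical_keyMono (σ : Equiv.Perm (Fin N)) (z : Fin N) (hz : (σ z : ℕ) = 0) :
    KeyMono σ (extCols σ) (lowerCols σ) z (leftRows σ) := by
  intro i hi j hj hij
  rw [mem_extCols] at hi hj
  have hN : 0 < N := i.pos
  set o : Fin N := ⟨0, hN⟩ with ho
  set l : Fin N := ⟨N - 1, by omega⟩ with hl
  set t : Fin N := σ.symm l with ht
  have hot : (o : ℕ) = 0 := rfl
  have hlt : (l : ℕ) = N - 1 := rfl
  have htt : (σ t : ℕ) = N - 1 := by simp [ht, hl]
  have hne : i ≠ j := by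
    rintro rfl
    exact lt_irrefl _ hij
  have hne' : (i : ℕ) ≠ j := fun h => hne (Fin.ext h)
  have hσ : (σ i : ℕ) ≠ σ j := fun h => hne' ((perm_eq_iff_val σ i j).1 h)
  have e1 : ∀ i, LRMin σ i → (σ i : ℕ) ≤ σ o := by
    intro i h
    rcases eq_or_lt_of_le (show o ≤ i from Nat.zero_le _) with h1 | h1
    · rw [h1]
    · exact (h o h1).le
  have e2 : ∀ i, LRMax σ i → (σ o : ℕ) ≤ σ i ∧ (i : ℕ) ≤ t := by
    intro i h
    constructor
    · rcases eq_or_lt_of_le (show o ≤ i from Nat.zero_le _) with h1 | h1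
      · rw [h1]
      · exact (h o h1).le
    · by_contra h2
      have h3 := h t (not_le.1 h2)
      have := (σ i).2
      rw [Fin.lt_def] at h3
      omega
  have e3 : ∀ i, RLMax σ i → (σ l : ℕ) ≤ σ i ∧ (t : ℕ) ≤ i := by
    intro i h
    constructor
    · rcases eq_or_lt_of_le (show i ≤ l from by rw [Fin.le_def]; have := i.2; omega) with h1 | h1
      · rw [h1]
      · exact (h l h1).le
    · by_contra h2
      have h3 := h t (not_le.1 h2)
      have := (σ i).2
      rw [Fin.lt_def] at h3
      omega
  have e4 : ∀ i, RLMin σ i → (σ i : ℕ) ≤ σ l := by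
    intro i h
    rcases eq_or_lt_of_le (show i ≤ l from by rw [Fin.le_def]; have := i.2; omega) with h1 | h1
    · rw [h1]
    · exact (h l h1).le
  have p1 : ∀ i j : Fin N, LRMin σ i → (j : ℕ) < i → (σ i : ℕ) < σ j := fun i j h h1 => h j h1
  have p2 : ∀ i j : Fin N, LRMax σ i → (j : ℕ) < i → (σ j : ℕ) < σ i := fun i j h h1 => h j h1
  have p3 : ∀ i j : Fin N, RLMin σ i → (i : ℕ) < j → (σ i : ℕ) < σ j := fun i j h h1 => h j h1
  have p4 : ∀ i j : Fin N, RLMax σ i → (i : ℕ) < j → (σ j : ℕ) < σ i := fun i j h h1 => h j h1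
  have bi := i.2
  have bj := j.2
  have bi' := (σ i).2
  have bj' := (σ j).2
  have btop : ∀ i, RLMin σ i → (σ i : ℕ) + 1 = N → i = l := by
    intro i h h1
    by_contra h2
    have h3 := h l (by
      rw [Fin.lt_def]
      have := i.2
      have : (i : ℕ) ≠ l := fun h => h2 (Fin.ext h)
      omega)
    have := (σ l).2
    rw [Fin.lt_def] at h3
    omega
  rcases external_cases σ z hz i hi with ⟨a1, a2, a3, a4⟩ | ⟨a1, a3, a4⟩ | ⟨a1, a3, a4, a5⟩ |
    ⟨a1, a2, a3, a4⟩ | ⟨a1, a2, a3, a4, a5⟩ <;>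
  rcases external_cases σ z hz j hj with ⟨b1, b2, b3, b4⟩ | ⟨b1, b3, b4⟩ | ⟨b1, b3, b4, b5⟩ |
    ⟨b1, b2, b3, b4⟩ | ⟨b1, b2, b3, b4, b5⟩ <;>
  simp only [colKey, rowKey, a1, a3, b1, b3, if_true, if_false] at hij ⊢ <;>
  (try simp only [not_le.2 a2, if_false] at hij) <;>
  (try simp only [not_le.2 b2, if_false] at hij)
  · have := p1 _ j a4; omega
  · have := e1 _ a4; have := e2 _ b4; omega
  · omega
  · omega
  · omega
  · omega
  · have := p2 _ i b4; omega
  · omega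
  · omega
  · omega
  · omega
  · have := (e3 _ a4).2; have := (e2 _ b4).2; omega
  · have := p4 _ j a4; omega
  · have := (e3 _ a4).1; have := e4 _ b4; omega
  · have h1 := btop _ b4 b5
    have := p4 _ j a4
    rw [h1] at this bj' b5 
    omega
  · omega
  · omega
  · omega
  · have := p3 _ i b4; omega
  · have h1 := btop _ b4 b5
    rw [h1] at hij
    omega
  · omega
  · omega
  · omega
  · omega
  · omega

end Records

/-! ### Ranks in the boundary order and the shape of the external points. -/

section Shape

variable {N : ℕ}

/-- A strictly increasing bijection preserves ranks; injectivity of the keys makes the monotonicity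
an equivalence. -/
theorem card_colKey_lt {σ : Equiv.Perm (Fin N)} {C D : Finset (Fin N)} {z : Fin N}
    {L R : Finset (Fin N)} (h : KeyMono σ C D z L) (hR : ∀ i, σ i ∈ R ↔ i ∈ C) {i : Fin N}
    (hi : i ∈ C) :
    (C.filter fun j => colKey D z j < colKey D z i).card =
      (R.filter fun j => rowKey L j < rowKey L (σ i)).card := by
  refine Finset.card_bij (fun j _ => σ j) ?_ (fun a _ b _ hab => σ.injective hab) ?_
  · intro j hj
    rw [Finset.mem_filter] at hj ⊢
    exact ⟨(hR j).2 hj.1, h j hj.1 i hi hj.2⟩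
  · intro j hj
    rw [Finset.mem_filter] at hj
    refine ⟨σ.symm j, ?_, by simp⟩
    have hj1 : σ.symm j ∈ C := by rw [← hR]; simpa using hj.1
    rw [Finset.mem_filter]
    refine ⟨hj1, ?_⟩
    by_contra h2
    rcases lt_or_eq_of_le (not_lt.1 h2) with h3 | h3
    · have := h i hi _ hj1 h3
      rw [Equiv.apply_symm_apply] at this
      exact lt_asymm this hj.2
    · have h4 := colKey_injective D z h3
      rw [h4, Equiv.apply_symm_apply] at hj
      exact lt_irrefl _ hj.2

/-- The row of a labelled column is determined by its rank, and the rank depends only on the label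
sets and `z`. -/
theorem KeyMono.eq {σ τ : Equiv.Perm (Fin N)} {C D : Finset (Fin N)} {z : Fin N}
    {L R : Finset (Fin N)} (hσ : KeyMono σ C D z L) (hτ : KeyMono τ C D z L)
    (hRσ : ∀ i, σ i ∈ R ↔ i ∈ C) (hRτ : ∀ i, τ i ∈ R ↔ i ∈ C) {i : Fin N} (hi : i ∈ C) :
    σ i = τ i := by
  have h1 := (card_colKey_lt hσ hRσ hi).symm.trans (card_colKey_lt hτ hRτ hi)
  have key : ∀ a b : Fin N, a ∈ R → rowKey L a < rowKey L b →
      (R.filter fun j => rowKey L j < rowKey L a).card <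
        (R.filter fun j => rowKey L j < rowKey L b).card := by
    intro a b ha hab
    refine Finset.card_lt_card (Finset.ssubset_iff_of_subset ?_ |>.2 ⟨a, ?_, ?_⟩)
    · intro j hj
      rw [Finset.mem_filter] at hj ⊢
      exact ⟨hj.1, hj.2.trans hab⟩
    · simp [ha, hab]
    · simp
  apply rowKey_injective L
  by_contra h2
  rcases lt_or_gt_of_ne h2 with h3 | h3
  · exact (key _ _ ((hRσ i).2 hi) h3).ne h1
  · exact (key _ _ ((hRτ i).2 hi) h3).ne h1.symm

/-- Number of elements of `S` before `t`. -/
noncomputable def cnt (S : Finset (Fin N)) (t : ℕ) : ℕ := (S.filter fun i : Fin N => (i : ℕ) < t).card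

/-- Every initial segment is half filled by `S`, up to `E / 2`. -/
def Balanced (S : Finset (Fin N)) (E : ℤ) : Prop :=
  ∀ t : ℕ, t ≤ N → |2 * (cnt S t : ℤ) - t| ≤ E

theorem Balanced.mono {S : Finset (Fin N)} {E F : ℤ} (h : Balanced S E) (hEF : E ≤ F) :
    Balanced S F := fun t ht => (h t ht).trans hEF

theorem card_filter_eq_sum {α : Type*} [Fintype α] [DecidableEq α] (S : Finset α)
    (p : α → Prop) [DecidablePred p] :
    (S.filter p).card = ∑ i, if i ∈ S ∧ p i then 1 else 0 := by
  rw [← Finset.card_filter, ← Finset.filter_filter]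
  simp

/-- On the lower left side the predecessors of `i` are the columns of `D` in `(i, z]`. This and the
next four lemmas express ranks by prefix counts, comparing indicator functions index by index. -/
theorem card_colKey_lt_low {C D : Finset (Fin N)} (hDC : D ⊆ C) {z i : Fin N} (hi : i ∈ D)
    (hiz : i ≤ z) :
    (C.filter fun j => colKey D z j < colKey D z i).card + cnt D (i + 1) = cnt D (z + 1) := by
  simp only [cnt, card_filter_eq_sum, ← Finset.sum_add_distrib]
  refine Finset.sum_congr rfl fun j _ => ?_
  have hj := @hDC j
  have bj := j.2
  simp only [colKey, hi, hiz, if_true]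
  rw [Fin.le_def] at *
  by_cases h1 : j ∈ D
  · simp only [h1, hj h1, true_and, if_true]
    split_ifs <;> omega
  · simp only [h1, false_and, if_false]
    split_ifs <;> omega

theorem card_colKey_lt_up {C D : Finset (Fin N)} (hDC : D ⊆ C) {z i : Fin N} (hi : i ∉ D) :
    (C.filter fun j => colKey D z j < colKey D z i).card = cnt D (z + 1) + cnt (C \ D) i := by
  simp only [cnt, card_filter_eq_sum, ← Finset.sum_add_distrib]
  refine Finset.sum_congr rfl fun j _ => ?_
  have hj := @hDC j
  have bj := j.2
  have bi := i.2
  simp only [colKey, hi, if_false, Finset.mem_sdiff, Fin.le_def]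
  by_cases h1 : j ∈ D
  · simp only [h1, hj h1, true_and, if_true, not_true, and_false, false_and, if_false]
    split_ifs <;> omega
  · simp only [h1, false_and, if_false, not_false_iff, and_true]
    by_cases h2 : j ∈ C
    · simp only [h2, true_and]
      split_ifs <;> omega
    · simp [h2]

/-- The predecessors are the whole lower left side, all upper columns, and the lower columns beyond
`i`. -/
theorem card_colKey_lt_high {C D : Finset (Fin N)} (hDC : D ⊆ C) {z i : Fin N} (hi : i ∈ D)
    (hiz : z < i) :
    (C.filter fun j => colKey D z j < colKey D z i).card + cnt D (i + 1) =
      cnt D (z + 1) + cnt (C \ D) N + cnt D N := by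
  simp only [cnt, card_filter_eq_sum, ← Finset.sum_add_distrib]
  refine Finset.sum_congr rfl fun j _ => ?_
  have hj := @hDC j
  have bj := j.2
  have bi := i.2
  simp only [colKey, hi, hiz.not_ge, if_false, if_true, Finset.mem_sdiff, Fin.le_def, j.2,
    and_true]
  rw [Fin.lt_def] at hiz
  by_cases h1 : j ∈ D
  · simp only [h1, hj h1, true_and, if_true, not_true, and_false, if_false]
    split_ifs <;> omega
  · simp only [h1, false_and, if_false, not_false_iff, and_true]
    by_cases h2 : j ∈ C
    · simp only [h2, true_and, if_true]
      split_ifs <;> omega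
    · simp [h2]

theorem card_rowKey_lt_left {R L : Finset (Fin N)} (hLR : L ⊆ R) {i : Fin N} (hi : i ∈ L) :
    (R.filter fun j => rowKey L j < rowKey L i).card = cnt L i := by
  simp only [cnt, card_filter_eq_sum]
  refine Finset.sum_congr rfl fun j _ => ?_
  have hj := @hLR j
  have bj := j.2
  have bi := i.2
  simp only [rowKey, hi, if_true]
  by_cases h1 : j ∈ L
  · simp only [h1, hj h1, true_and, if_true]
    split_ifs <;> omega
  · simp only [h1, false_and, if_false]
    split_ifs <;> omega

theorem card_rowKey_lt_right {R L : Finset (Fin N)} (hLR : L ⊆ R) {i : Fin N} (hi : i ∉ L) :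
    (R.filter fun j => rowKey L j < rowKey L i).card + cnt (R \ L) (i + 1) =
      cnt L N + cnt (R \ L) N := by
  simp only [cnt, card_filter_eq_sum, ← Finset.sum_add_distrib]
  refine Finset.sum_congr rfl fun j _ => ?_
  have hj := @hLR j
  have bj := j.2
  have bi := i.2
  simp only [rowKey, hi, if_false, Finset.mem_sdiff, bj, and_true]
  by_cases h1 : j ∈ L
  · simp only [h1, hj h1, true_and, if_true, not_true, and_false, false_and, if_false]
    split_ifs <;> omega
  · simp only [h1, if_false, not_false_iff, and_true]
    by_cases h2 : j ∈ R
    · simp only [h2, true_and, if_true]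
      split_ifs <;> omega
    · simp [h2]

/-- All four label classes are balanced and the lowest point is far from the corners. -/
structure Regular (C D R L : Finset (Fin N)) (z : Fin N) (E : ℤ) : Prop where
  subC : D ⊆ C
  subR : L ⊆ R
  balD : Balanced D E
  balU : Balanced (C \ D) E
  balL : Balanced L E
  balR : Balanced (R \ L) E
  one_le : 1 ≤ E
  lo : 100 * E < z
  hi : (z : ℤ) + 100 * E < N

/-- The external points are close to the four sides of the rectangle. -/
theorem Regular.shape {σ : Equiv.Perm (Fin N)} {C D : Finset (Fin N)} {z : Fin N}
    {L R : Finset (Fin N)} {E : ℤ} (hreg : Regular C D R L z E) (h : KeyMono σ C D z L)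
    (hR : ∀ i, σ i ∈ R ↔ i ∈ C) {i : Fin N} (hi : i ∈ C) :
    (i ∈ D ∧ i ≤ z ∧ σ i ∈ L ∧ |(σ i : ℤ) - (z - i)| ≤ 10 * E) ∨
    (i ∉ D ∧ σ i ∈ L ∧ |(σ i : ℤ) - (z + i)| ≤ 10 * E) ∨
    (i ∉ D ∧ σ i ∉ L ∧ |(σ i : ℤ) - (2 * N - z - i)| ≤ 10 * E) ∨
    (i ∈ D ∧ z < i ∧ σ i ∉ L ∧ |(σ i : ℤ) - (i - z)| ≤ 10 * E) := by
  obtain ⟨hDC, hLR, bD, bU, bL, bR, hE, hlo, hhi⟩ := hreg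
  have hcard := card_colKey_lt h hR hi
  have bi := i.2
  have bz := z.2
  have bs := (σ i).2
  have d1 := abs_le.1 (bD (i + 1) (by omega))
  have d2 := abs_le.1 (bD (z + 1) (by omega))
  have d3 := abs_le.1 (bD N le_rfl)
  have u1 := abs_le.1 (bU i (by omega))
  have u2 := abs_le.1 (bU N le_rfl)
  have l1 := abs_le.1 (bL (σ i) (by omega))
  have l2 := abs_le.1 (bL N le_rfl)
  have r1 := abs_le.1 (bR (σ i + 1) (by omega))
  have r2 := abs_le.1 (bR N le_rfl)
  push_cast at *
  simp only [abs_le]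
  -- Prefix counts being half the prefix lengths up to `O(E)`, equality of ranks turns into the
  -- linear equation of one side in each consistent case. The two inconsistent cases would push a
  -- coordinate out of range, by the margin `100 * E`.
  by_cases hL : σ i ∈ L
  · have e1 := card_rowKey_lt_left hLR hL
    by_cases hD : i ∈ D
    · rcases le_or_gt i z with hz | hz
      · have e2 := card_colKey_lt_low hDC hD hz
        refine Or.inl ⟨hD, hz, hL, ?_⟩
        omega
      · have e2 := card_colKey_lt_high hDC hD hz
        rw [Fin.lt_def] at hz
        omega
    · have e2 := card_colKey_lt_up hDC (z := z) hD
      refine Or.inr (Or.inl ⟨hD, hL, ?_⟩)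
      omega
  · have e1 := card_rowKey_lt_right hLR hL
    by_cases hD : i ∈ D
    · rcases le_or_gt i z with hz | hz
      · have e2 := card_colKey_lt_low hDC hD hz
        rw [Fin.le_def] at hz
        omega
      · have e2 := card_colKey_lt_high hDC hD hz
        refine Or.inr (Or.inr (Or.inr ⟨hD, hz, hL, ?_⟩))
        omega
    · have e2 := card_colKey_lt_up hDC (z := z) hD
      refine Or.inr (Or.inr (Or.inl ⟨hD, hL, ?_⟩))
      omega

end Shape

/-! ### Permutations near the rectangle: internal points and records. -/

section Existence

variable {N : ℕ}

/-- If `S` missed the interval, its prefix count would stay constant over a length greater than `2 *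
E`. -/
theorem Balanced.exists_mem {S : Finset (Fin N)} {E : ℤ} (h : Balanced S E) {a b : ℕ}
    (hb : b ≤ N) (hab : (a : ℤ) + 2 * E < b) (hE : 0 ≤ E) :
    ∃ j ∈ S, a ≤ (j : ℕ) ∧ (j : ℕ) < b := by
  by_contra! h2
  have h3 : cnt S b ≤ cnt S a := by
    refine Finset.card_le_card fun j hj => ?_
    rw [Finset.mem_filter] at hj ⊢
    refine ⟨hj.1, ?_⟩
    by_contra h4
    exact absurd hj.2 (not_lt.2 (h2 j hj.1 (not_lt.1 h4)))
  have h4 := abs_le.1 (h b hb)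
  have h5 := abs_le.1 (h a (by omega))
  omega

/-- The minimiser of `σ` over the columns up to `i` is such a record. The next three lemmas are its
mirror images. -/
theorem exists_lrMin_of_not {σ : Equiv.Perm (Fin N)} {i : Fin N} (h : ¬ LRMin σ i) :
    ∃ j, LRMin σ j ∧ j < i ∧ σ j < σ i := by
  simp only [LRMin, not_forall, not_lt] at h
  obtain ⟨j, hj, hij⟩ := h
  obtain ⟨m, hm, hmin⟩ := Finset.exists_min_image (Finset.Iic i) σ ⟨i, by simp⟩
  rw [Finset.mem_Iic] at hm
  have h1 := hmin j (by simpa using hj.le)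
  have h2 : σ j < σ i := lt_of_le_of_ne hij (σ.injective.ne hj.ne)
  have h3 : m ≠ i := by
    rintro rfl
    exact absurd h1 (not_le.2 h2)
  refine ⟨m, fun l hl => ?_, lt_of_le_of_ne hm h3, h1.trans_lt h2⟩
  exact lt_of_le_of_ne (hmin l (by simpa using (hl.le.trans hm))) (σ.injective.ne hl.ne')

theorem exists_lrMax_of_not {σ : Equiv.Perm (Fin N)} {i : Fin N} (h : ¬ LRMax σ i) :
    ∃ j, LRMax σ j ∧ j < i ∧ σ i < σ j := by
  simp only [LRMax, not_forall, not_lt] at h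
  obtain ⟨j, hj, hij⟩ := h
  obtain ⟨m, hm, hmax⟩ := Finset.exists_max_image (Finset.Iic i) σ ⟨i, by simp⟩
  rw [Finset.mem_Iic] at hm
  have h1 := hmax j (by simpa using hj.le)
  have h2 : σ i < σ j := lt_of_le_of_ne hij (σ.injective.ne hj.ne')
  have h3 : m ≠ i := by
    rintro rfl
    exact absurd h1 (not_le.2 h2)
  refine ⟨m, fun l hl => ?_, lt_of_le_of_ne hm h3, h2.trans_le h1⟩
  exact lt_of_le_of_ne (hmax l (by simpa using (hl.le.trans hm))) (σ.injective.ne hl.ne)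

theorem exists_rlMin_of_not {σ : Equiv.Perm (Fin N)} {i : Fin N} (h : ¬ RLMin σ i) :
    ∃ j, RLMin σ j ∧ i < j ∧ σ j < σ i := by
  simp only [RLMin, not_forall, not_lt] at h
  obtain ⟨j, hj, hij⟩ := h
  obtain ⟨m, hm, hmin⟩ := Finset.exists_min_image (Finset.Ici i) σ ⟨i, by simp⟩
  rw [Finset.mem_Ici] at hm
  have h1 := hmin j (by simpa using hj.le)
  have h2 : σ j < σ i := lt_of_le_of_ne hij (σ.injective.ne hj.ne')
  have h3 : m ≠ i := by
    rintro rfl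
    exact absurd h1 (not_le.2 h2)
  refine ⟨m, fun l hl => ?_, lt_of_le_of_ne hm h3.symm, h1.trans_lt h2⟩
  exact lt_of_le_of_ne (hmin l (by simpa using (hm.trans hl.le))) (σ.injective.ne hl.ne)

theorem exists_rlMax_of_not {σ : Equiv.Perm (Fin N)} {i : Fin N} (h : ¬ RLMax σ i) :
    ∃ j, RLMax σ j ∧ i < j ∧ σ i < σ j := by
  simp only [RLMax, not_forall, not_lt] at h
  obtain ⟨j, hj, hij⟩ := h
  obtain ⟨m, hm, hmax⟩ := Finset.exists_max_image (Finset.Ici i) σ ⟨i, by simp⟩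
  rw [Finset.mem_Ici] at hm
  have h1 := hmax j (by simpa using hj.le)
  have h2 : σ i < σ j := lt_of_le_of_ne hij (σ.injective.ne hj.ne)
  have h3 : m ≠ i := by
    rintro rfl
    exact absurd h1 (not_le.2 h2)
  refine ⟨m, fun l hl => ?_, lt_of_le_of_ne hm h3.symm, h2.trans_le h1⟩
  exact lt_of_le_of_ne (hmax l (by simpa using (hm.trans hl.le))) (σ.injective.ne hl.ne')

theorem Regular.near_rect_of_mem {σ : Equiv.Perm (Fin N)} {C D : Finset (Fin N)} {z : Fin N}
    {L R : Finset (Fin N)} {E : ℤ} (hreg : Regular C D R L z E) (h : KeyMono σ C D z L)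
    (hR : ∀ i, σ i ∈ R ↔ i ∈ C) {i : Fin N} (hi : i ∈ C) :
    (z : ℤ) - 30 * E ≤ i + σ i ∧ (i : ℤ) + σ i ≤ 2 * N - z + 30 * E ∧
      -(z : ℤ) - 30 * E ≤ σ i - i ∧ (σ i : ℤ) - i ≤ z + 30 * E := by
  have hs := hreg.shape h hR hi
  have h1 := hreg.lo
  have h2 := hreg.hi
  have h3 := hreg.one_le
  have bi := i.2
  have bs := (σ i).2
  simp only [abs_le, Fin.le_def, Fin.lt_def] at hs
  omega

/-- Every point of a permutation with balanced labels is close to the rectangle. -/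
theorem Regular.near_rect {σ : Equiv.Perm (Fin N)} {z : Fin N} (hz : (σ z : ℕ) = 0)
    {R : Finset (Fin N)} (hR : ∀ i, σ i ∈ R ↔ i ∈ extCols σ) {E : ℤ}
    (hreg : Regular (extCols σ) (lowerCols σ) R (leftRows σ) z E) (i : Fin N) :
    (z : ℤ) - 30 * E ≤ i + σ i ∧ (i : ℤ) + σ i ≤ 2 * N - z + 30 * E ∧
      -(z : ℤ) - 30 * E ≤ σ i - i ∧ (σ i : ℤ) - i ≤ z + 30 * E := by
  have key := fun j (hj : j ∈ extCols σ) =>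
    hreg.near_rect_of_mem (canonical_keyMono σ z hz) hR hj
  by_cases hi : i ∈ extCols σ
  · exact key i hi
  · rw [mem_extCols, isExternal_iff] at hi
    push Not at hi
    obtain ⟨h1, h2, h3, h4⟩ := hi
    -- An internal point has a record in each of the four quadrants around it, and each of these
    -- records transfers one of the four inequalities.
    obtain ⟨a, a1, a2, a3⟩ := exists_lrMax_of_not h1
    obtain ⟨b, b1, b2, b3⟩ := exists_lrMin_of_not h2
    obtain ⟨c, c1, c2, c3⟩ := exists_rlMax_of_not h3
    obtain ⟨d, d1, d2, d3⟩ := exists_rlMin_of_not h4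
    have ka := key a (by rw [mem_extCols, isExternal_iff]; tauto)
    have kb := key b (by rw [mem_extCols, isExternal_iff]; tauto)
    have kc := key c (by rw [mem_extCols, isExternal_iff]; tauto)
    have kd := key d (by rw [mem_extCols, isExternal_iff]; tauto)
    rw [Fin.lt_def] at *
    omega

/-- The label sets satisfy the boundary conventions, the permutation follows the boundary order
on the labelled points, and all other points are well inside the rectangle. -/
structure Admissible (σ : Equiv.Perm (Fin N)) (C D R L : Finset (Fin N)) (z : Fin N) (E : ℤ) :
    Prop where
  reg : Regular C D R L z E
  mono : KeyMono σ C D z L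
  mem_iff : ∀ i, σ i ∈ R ↔ i ∈ C
  z_mem : z ∈ D
  first_mem : ∀ i : Fin N, (i : ℕ) = 0 → i ∈ D
  last_mem : ∀ i : Fin N, (i : ℕ) + 1 = N → i ∈ D
  bot_mem : ∀ i : Fin N, (i : ℕ) = 0 → i ∈ L
  top_mem : ∀ i : Fin N, (i : ℕ) + 1 = N → i ∈ L
  inside : ∀ i, i ∉ C → (z : ℤ) + 60 * E < i + σ i ∧ (i : ℤ) + σ i < 2 * N - z - 60 * E ∧
      -(z : ℤ) + 60 * E < σ i - i ∧ (σ i : ℤ) - i < z - 60 * E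

namespace Admissible

variable {σ : Equiv.Perm (Fin N)} {C D R L : Finset (Fin N)} {z : Fin N} {E : ℤ}

theorem shape (h : Admissible σ C D R L z E) {i : Fin N} (hi : i ∈ C) :
    (i ∈ D ∧ i ≤ z ∧ σ i ∈ L ∧ |(σ i : ℤ) - (z - i)| ≤ 10 * E) ∨
    (i ∉ D ∧ σ i ∈ L ∧ |(σ i : ℤ) - (z + i)| ≤ 10 * E) ∨
    (i ∉ D ∧ σ i ∉ L ∧ |(σ i : ℤ) - (2 * N - z - i)| ≤ 10 * E) ∨
    (i ∈ D ∧ z < i ∧ σ i ∉ L ∧ |(σ i : ℤ) - (i - z)| ≤ 10 * E) :=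
  h.reg.shape h.mono h.mem_iff hi

/-- Column `z` has the least column key and the bottom row, being labelled left, the least row key.
-/
theorem z_row (h : Admissible σ C D R L z E) : (σ z : ℕ) = 0 := by
  by_contra hne
  have hpos : 0 < N := z.pos
  have hzC := h.reg.subC h.z_mem
  set y := σ.symm ⟨0, hpos⟩ with hy
  have hσy : (σ y : ℕ) = 0 := by simp [hy]
  have hyL : σ y ∈ L := h.bot_mem _ hσy
  have hyC : y ∈ C := (h.mem_iff y).1 (h.reg.subR hyL)
  have hyz : (y : ℕ) ≠ z := by
    intro h2
    rw [Fin.ext h2] at hσy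
    exact hne hσy
  have h1 := h.mono z hzC y hyC
  have bz := z.2
  have by' := y.2
  have bs := (σ z).2
  simp only [colKey, rowKey, h.z_mem, hyL, hσy, le_refl, if_true, Fin.le_def] at h1
  split_ifs at h1 <;> omega

/-- The shape estimate is too coarse on a single side and near a corner shared by two sides; there
the key order decides. Elsewhere the estimate decides, and columns off `C` are handled by the margin
`60 * E`. The other three sides follow the same pattern. -/
theorem lrMin_of_low (h : Admissible σ C D R L z E) {i : Fin N} (hi : i ∈ D) (hiz : i ≤ z) :
    LRMin σ i := by
  intro j hj
  have h1 := h.reg.lo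
  have h2 := h.reg.hi
  have h3 := h.reg.one_le
  have bi := i.2
  have bj := j.2
  have bsi := (σ i).2
  have bsj := (σ j).2
  have hiC := h.reg.subC hi
  have hne := perm_eq_iff_val σ i j
  have si := h.shape hiC
  have hσi : σ i ∈ L := by
    rcases si with s | s | s | s
    · exact s.2.2.1
    · exact s.2.1
    · exact absurd hi s.1
    · exact absurd hiz (not_le.2 s.2.1)
  by_cases hjC : j ∈ C
  · have sj := h.shape hjC
    have m1 := h.mono i hiC j hjC
    have m2 := h.mono j hjC i hiC
    simp only [colKey, rowKey, hi, hσi, hiz, if_true] at m1 m2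
    simp only [hi, hσi, abs_le, Fin.le_def, Fin.lt_def, true_and, not_true, false_and, false_or]
      at si sj m1 m2 hj hiz ⊢
    rcases sj with ⟨s1, s2, s3, s4⟩ | ⟨s1, s3, s4⟩ | ⟨s1, s3, s4⟩ | ⟨s1, s2, s3, s4⟩ <;>
    simp only [s1, s3, if_true, if_false] at m1 m2 <;>
    (try simp only [s2, if_true] at m1 m2) <;> omega
  · have := h.inside j hjC
    simp only [hi, abs_le, Fin.le_def, Fin.lt_def, true_and, not_true, false_and, false_or] at *
    omega

theorem lrMax_of_left (h : Admissible σ C D R L z E) {i : Fin N} (hi : i ∉ D) (hσi : σ i ∈ L) :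
    LRMax σ i := by
  intro j hj
  have h1 := h.reg.lo
  have h2 := h.reg.hi
  have h3 := h.reg.one_le
  have bi := i.2
  have bj := j.2
  have bsi := (σ i).2
  have bsj := (σ j).2
  have hiC := (h.mem_iff i).1 (h.reg.subR hσi)
  have hne := perm_eq_iff_val σ i j
  have si := h.shape hiC
  by_cases hjC : j ∈ C
  · have sj := h.shape hjC
    have m1 := h.mono i hiC j hjC
    have m2 := h.mono j hjC i hiC
    simp only [colKey, rowKey, hi, hσi, if_true, if_false] at m1 m2
    simp only [hi, hσi, abs_le, Fin.le_def, Fin.lt_def, true_and, not_true, false_and, false_or,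
      or_false, not_false_iff] at si sj m1 m2 hj ⊢
    rcases sj with ⟨s1, s2, s3, s4⟩ | ⟨s1, s3, s4⟩ | ⟨s1, s3, s4⟩ | ⟨s1, s2, s3, s4⟩ <;>
    simp only [s1, s3, if_true, if_false] at m1 m2 <;>
    (try simp only [s2, if_true] at m1 m2) <;> omega
  · have := h.inside j hjC
    simp only [hi, hσi, abs_le, Fin.le_def, Fin.lt_def, true_and, not_true, false_and, false_or,
      or_false, not_false_iff] at *
    omega

theorem rlMax_of_right (h : Admissible σ C D R L z E) {i : Fin N} (hiC : i ∈ C) (hi : i ∉ D)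
    (hσi : σ i ∉ L) : RLMax σ i := by
  intro j hj
  have h1 := h.reg.lo
  have h2 := h.reg.hi
  have h3 := h.reg.one_le
  have bi := i.2
  have bj := j.2
  have bsi := (σ i).2
  have bsj := (σ j).2
  have hne := perm_eq_iff_val σ i j
  have si := h.shape hiC
  by_cases hjC : j ∈ C
  · have sj := h.shape hjC
    have m1 := h.mono i hiC j hjC
    have m2 := h.mono j hjC i hiC
    simp only [colKey, rowKey, hi, hσi, if_false] at m1 m2
    simp only [hi, hσi, abs_le, Fin.le_def, Fin.lt_def, true_and, false_and, and_false, false_or,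
      or_false, not_false_iff] at si sj m1 m2 hj ⊢
    rcases sj with ⟨s1, s2, s3, s4⟩ | ⟨s1, s3, s4⟩ | ⟨s1, s3, s4⟩ | ⟨s1, s2, s3, s4⟩ <;>
    simp only [s1, s3, if_true, if_false] at m1 m2 <;>
    (try simp only [not_le.2 s2, if_false] at m1 m2) <;> omega
  · have := h.inside j hjC
    simp only [hi, hσi, abs_le, Fin.le_def, Fin.lt_def, true_and, false_and, and_false, false_or,
      or_false, not_false_iff] at *
    omega

theorem rlMin_of_high (h : Admissible σ C D R L z E) {i : Fin N} (hi : i ∈ D) (hiz : z < i) :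
    RLMin σ i ∧ σ i ∉ L := by
  have h1 := h.reg.lo
  have h2 := h.reg.hi
  have h3 := h.reg.one_le
  have hiC := h.reg.subC hi
  have si := h.shape hiC
  have hσi : σ i ∉ L := by
    rcases si with s | s | s | s
    · exact absurd s.2.1 (not_le.2 hiz)
    · exact absurd hi s.1
    · exact s.2.1
    · exact s.2.2.1
  refine ⟨?_, hσi⟩
  intro j hj
  have bi := i.2
  have bj := j.2
  have bsi := (σ i).2
  have bsj := (σ j).2
  have hne := perm_eq_iff_val σ i j
  by_cases hjC : j ∈ C
  · have sj := h.shape hjC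
    have m1 := h.mono i hiC j hjC
    have m2 := h.mono j hjC i hiC
    simp only [colKey, rowKey, hi, hσi, not_le.2 hiz, if_true, if_false] at m1 m2
    simp only [hi, hσi, abs_le, Fin.le_def, Fin.lt_def, true_and, false_and, and_false, false_or,
      not_true, not_false_iff] at si sj m1 m2 hj hiz ⊢
    rcases sj with ⟨s1, s2, s3, s4⟩ | ⟨s1, s3, s4⟩ | ⟨s1, s3, s4⟩ | ⟨s1, s2, s3, s4⟩ <;>
    simp only [s1, s3, if_true, if_false] at m1 m2 <;>
    (try simp only [not_le.2 s2, if_false] at m1 m2) <;> omega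
  · have := h.inside j hjC
    simp only [hi, hσi, abs_le, Fin.le_def, Fin.lt_def, true_and, false_and, and_false, false_or,
      not_true, not_false_iff] at *
    omega

theorem low_shape (h : Admissible σ C D R L z E) {i : Fin N} (hi : i ∈ D) (hiz : i ≤ z) :
    |(σ i : ℤ) - (z - i)| ≤ 10 * E ∧ σ i ∈ L := by
  rcases h.shape (h.reg.subC hi) with s | s | s | s
  · exact ⟨s.2.2.2, s.2.2.1⟩
  · exact absurd hi s.1
  · exact absurd hi s.1
  · exact absurd hiz (not_le.2 s.2.1)

theorem high_shape (h : Admissible σ C D R L z E) {i : Fin N} (hi : i ∈ D) (hiz : z < i) :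
    |(σ i : ℤ) - (i - z)| ≤ 10 * E := by
  rcases h.shape (h.reg.subC hi) with s | s | s | s
  · exact absurd hiz (not_lt.2 s.2.1)
  · exact absurd hi s.1
  · exact absurd hi s.1
  · exact s.2.2.2

/-- The highest point lies on the upper left side. -/
theorem top_col (h : Admissible σ C D R L z E) {t : Fin N} (ht : (σ t : ℕ) + 1 = N) :
    t ∈ C ∧ t ∉ D ∧ σ t ∈ L ∧ |(σ t : ℤ) - (z + t)| ≤ 10 * E := by
  have hL := h.top_mem _ ht
  have hC := (h.mem_iff t).1 (h.reg.subR hL)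
  have h1 := h.reg.lo
  have h2 := h.reg.hi
  have h3 := h.reg.one_le
  rcases h.shape hC with s | s | s | s
  · have := abs_le.1 s.2.2.2
    omega
  · exact ⟨hC, s.1, hL, s.2.2⟩
  · exact absurd hL s.2.1
  · exact absurd hL s.2.2.1

/-- If the lowest point lies to the left of `i`, it is a witness. Otherwise a lower column at
distance at most `3 * E` to the left is one: its point lies near the lower left side, hence below
the given point. -/
theorem exists_below_left (h : Admissible σ C D R L z E) {i : Fin N}
    (hi : (z : ℤ) + 50 * E < i + σ i) : ¬ LRMin σ i := by
  suffices ∃ j, j < i ∧ σ j < σ i by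
    rintro h2
    obtain ⟨j, j1, j2⟩ := this
    exact lt_asymm (h2 j j1) j2
  have h1 := h.reg.lo
  have h2 := h.reg.hi
  have h3 := h.reg.one_le
  have bi := i.2
  have hz := h.z_row
  have hiz := perm_eq_iff_val σ i z
  simp only [Fin.lt_def]
  rcases lt_or_ge z i with h4 | h4
  · exact ⟨z, h4, by rw [Fin.lt_def] at h4; omega⟩
  rw [Fin.le_def] at h4
  have key : ∃ j ∈ D, (j : ℕ) < i ∧ (i : ℤ) ≤ j + 3 * E := by
    rcases lt_or_ge (3 * E) i with h5 | h5
    · obtain ⟨j, j1, j2, j3⟩ := h.reg.balD.exists_mem (a := (i - 3 * E).toNat) (b := i)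
        (by omega) (by omega) (by omega)
      exact ⟨j, j1, j3, by omega⟩
    · have h6 := h.first_mem ⟨0, by omega⟩ rfl
      -- Close to the left edge balance gives nothing, but the first column is lower by convention.
      -- It differs from `i`, since its own point lies within `10 * E` of the side.
      refine ⟨⟨0, by omega⟩, h6, ?_, by simpa using h5⟩
      by_contra h7
      have h8 : i = ⟨0, by omega⟩ := by
        apply Fin.ext
        simp only at *
        omega
      rw [← h8] at h6
      have := abs_le.1 (h.low_shape h6 h4).1
      omega
  obtain ⟨j, j1, j2, j3⟩ := key
  have := abs_le.1 (h.low_shape j1 (by rw [Fin.le_def]; omega)).1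
  exact ⟨j, j2, by omega⟩

theorem exists_below_right (h : Admissible σ C D R L z E) {i : Fin N}
    (hi : -(z : ℤ) + 50 * E < σ i - i) : ¬ RLMin σ i := by
  suffices ∃ j, i < j ∧ σ j < σ i by
    rintro h2
    obtain ⟨j, j1, j2⟩ := this
    exact lt_asymm (h2 j j1) j2
  have h1 := h.reg.lo
  have h2 := h.reg.hi
  have h3 := h.reg.one_le
  have bi := i.2
  have hz := h.z_row
  have hiz := perm_eq_iff_val σ i z
  simp only [Fin.lt_def]
  rcases lt_or_ge i z with h4 | h4
  · exact ⟨z, h4, by rw [Fin.lt_def] at h4; omega⟩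
  rw [Fin.le_def] at h4
  have h5 : (z : ℕ) < i := by
    by_contra h6
    have := hiz.2 (by omega)
    omega
  have key : ∃ j ∈ D, (i : ℕ) < j ∧ (j : ℤ) ≤ i + 3 * E + 1 := by
    rcases lt_or_ge (i + 3 * E + 1) N with h5 | h5
    · obtain ⟨j, j1, j2, j3⟩ := h.reg.balD.exists_mem (a := i + 1) (b := (i + 3 * E + 1).toNat)
        (by omega) (by omega) (by omega)
      exact ⟨j, j1, by omega, by omega⟩
    · have h6 := h.last_mem ⟨N - 1, by omega⟩ (by simp only; omega)
      refine ⟨⟨N - 1, by omega⟩, h6, ?_, by simp only; omega⟩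
      by_contra h7
      have h8 : i = ⟨N - 1, by omega⟩ := by
        apply Fin.ext
        simp only at *
        omega
      rw [← h8] at h6
      have := abs_le.1 (h.high_shape h6 (by rw [Fin.lt_def]; omega))
      omega
  obtain ⟨j, j1, j2, j3⟩ := key
  have := abs_le.1 (h.high_shape j1 (by rw [Fin.lt_def]; omega))
  exact ⟨j, j2, by omega⟩

/-- The highest point plays the role of the lowest one. An upper column left of it belongs to the
upper left side, because the key order puts its row among the left ones. Close to the left edge the
first column is again a witness, its row being near `z`. -/
theorem exists_above_left (h : Admissible σ C D R L z E) {i : Fin N}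
    (hi : (σ i : ℤ) - i < z - 50 * E) : ¬ LRMax σ i := by
  suffices ∃ j, j < i ∧ σ i < σ j by
    rintro h2
    obtain ⟨j, j1, j2⟩ := this
    exact lt_asymm (h2 j j1) j2
  have h1 := h.reg.lo
  have h2 := h.reg.hi
  have h3 := h.reg.one_le
  have bi := i.2
  have bs := (σ i).2
  obtain ⟨t, ht⟩ : ∃ t, (σ t : ℕ) + 1 = N := by
    refine ⟨σ.symm ⟨N - 1, by omega⟩, ?_⟩
    simp only [Equiv.apply_symm_apply]
    omega
  have hit := perm_eq_iff_val σ i t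
  obtain ⟨tC, tD, tL, ts⟩ := h.top_col ht
  rw [abs_le] at ts
  simp only [Fin.lt_def]
  rcases lt_trichotomy (t : ℕ) i with h4 | h4 | h4
  · exact ⟨t, h4, by omega⟩
  · omega
  have key : (∃ j ∈ C \ D, (j : ℕ) < i ∧ (i : ℤ) ≤ j + 3 * E) ∨ (i : ℤ) ≤ 3 * E := by
    rcases lt_or_ge (3 * E) i with h5 | h5
    · obtain ⟨j, j1, j2, j3⟩ := h.reg.balU.exists_mem (a := (i - 3 * E).toNat) (b := i)
        (by omega) (by omega) (by omega)
      exact Or.inl ⟨j, j1, j3, by omega⟩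
    · exact Or.inr h5
  rcases key with ⟨j, j1, j2, j3⟩ | h5
  · rw [Finset.mem_sdiff] at j1
    refine ⟨j, j2, ?_⟩
    have m := h.mono j j1.1 t tC
    have bj := (σ j).2
    have bt := (σ t).2
    simp only [colKey, rowKey, j1.2, tD, tL, if_true, if_false] at m
    rcases h.shape j1.1 with s | s | s | s
    · exact absurd s.1 j1.2
    · have := abs_le.1 s.2.2
      omega
    · simp only [s.2.1, if_false] at m
      omega
    · exact absurd s.1 j1.2
  · have h6 := h.first_mem ⟨0, by omega⟩ rfl
    have := abs_le.1 (h.low_shape h6 (Nat.zero_le _)).1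
    refine ⟨⟨0, by omega⟩, ?_, ?_⟩
    · by_contra h7
      have h8 : i = ⟨0, by omega⟩ := by
        apply Fin.ext
        simp only at *
        omega
      rw [← h8] at this
      omega
    · simp only at this
      omega

theorem exists_above_right (h : Admissible σ C D R L z E) {i : Fin N}
    (hi : (i : ℤ) + σ i < 2 * N - z - 50 * E) : ¬ RLMax σ i := by
  suffices ∃ j, i < j ∧ σ i < σ j by
    rintro h2
    obtain ⟨j, j1, j2⟩ := this
    exact lt_asymm (h2 j j1) j2
  have h1 := h.reg.lo
  have h2 := h.reg.hi
  have h3 := h.reg.one_le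
  have bi := i.2
  have bs := (σ i).2
  obtain ⟨t, ht⟩ : ∃ t, (σ t : ℕ) + 1 = N := by
    refine ⟨σ.symm ⟨N - 1, by omega⟩, ?_⟩
    simp only [Equiv.apply_symm_apply]
    omega
  have hit := perm_eq_iff_val σ i t
  obtain ⟨tC, tD, tL, ts⟩ := h.top_col ht
  rw [abs_le] at ts
  simp only [Fin.lt_def]
  rcases lt_trichotomy (i : ℕ) t with h4 | h4 | h4
  · exact ⟨t, h4, by omega⟩
  · omega
  have key : (∃ j ∈ C \ D, (i : ℕ) < j ∧ (j : ℤ) ≤ i + 3 * E + 1) ∨ (N : ℤ) ≤ i + 3 * E + 1 := by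
    rcases lt_or_ge (i + 3 * E + 1) N with h5 | h5
    · obtain ⟨j, j1, j2, j3⟩ := h.reg.balU.exists_mem (a := i + 1) (b := (i + 3 * E + 1).toNat)
        (by omega) (by omega) (by omega)
      exact Or.inl ⟨j, j1, by omega, by omega⟩
    · exact Or.inr h5
  rcases key with ⟨j, j1, j2, j3⟩ | h5
  · rw [Finset.mem_sdiff] at j1
    refine ⟨j, j2, ?_⟩
    have m := h.mono t tC j j1.1
    have bj := (σ j).2
    simp only [colKey, rowKey, j1.2, tD, tL, if_true, if_false] at m
    rcases h.shape j1.1 with s | s | s | s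
    · exact absurd s.1 j1.2
    · simp only [s.2.1, if_true] at m
      omega
    · have := abs_le.1 s.2.2
      omega
    · exact absurd s.1 j1.2
  · have h6 := h.last_mem ⟨N - 1, by omega⟩ (by simp only; omega)
    have := abs_le.1 (h.high_shape h6 (by rw [Fin.lt_def]; simp only; omega))
    refine ⟨⟨N - 1, by omega⟩, ?_, ?_⟩
    · by_contra h7
      have h8 : i = ⟨N - 1, by omega⟩ := by
        apply Fin.ext
        simp only at *
        omega
      rw [← h8] at this
      omega
    · simp only at this
      omega

end Admissible

end Existence

/-! ### The labels are recovered from the permutation and determine it. -/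

section Labels

variable {N : ℕ}

namespace Admissible

variable {σ : Equiv.Perm (Fin N)} {C D R L : Finset (Fin N)} {z : Fin N} {E : ℤ}

/-- The margin `60 * E` of the unlabelled points exceeds the `50 * E` needed to find a point in each
quadrant. -/
theorem inside_not_external (h : Admissible σ C D R L z E) {i : Fin N} (hi : i ∉ C) :
    ¬ IsExternal σ i := by
  have h3 := h.reg.one_le
  have h4 := h.inside i hi
  rw [isExternal_iff]
  rintro (h5 | h5 | h5 | h5)
  · exact h.exists_above_left (by omega) h5
  · exact h.exists_below_left (by omega) h5
  · exact h.exists_above_right (by omega) h5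
  · exact h.exists_below_right (by omega) h5

/-- Distance excludes a left-to-right minimum. Near the two corners of the side distances are
useless: there the key order places the highest point to the left and the point of the last column
below. -/
theorem right_not_low (h : Admissible σ C D R L z E) {i : Fin N} (hiC : i ∈ C) (hi : i ∉ D)
    (hσi : σ i ∉ L) : ¬ LRMin σ i ∧ ¬ LRMax σ i ∧ ¬ RLMin σ i := by
  have h1 := h.reg.lo
  have h2 := h.reg.hi
  have h3 := h.reg.one_le
  have bi := i.2
  have bs := (σ i).2
  have hs : |(σ i : ℤ) - (2 * N - z - i)| ≤ 10 * E := by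
    rcases h.shape hiC with s | s | s | s
    · exact absurd s.1 hi
    · exact absurd s.2.1 hσi
    · exact s.2.2
    · exact absurd s.1 hi
  have hs' := abs_le.1 hs
  refine ⟨h.exists_below_left (by omega), fun h4 => ?_, fun h4 => ?_⟩
  · obtain ⟨t, ht⟩ : ∃ t, (σ t : ℕ) + 1 = N := by
      refine ⟨σ.symm ⟨N - 1, by omega⟩, ?_⟩
      simp only [Equiv.apply_symm_apply]
      omega
    obtain ⟨tC, tD, tL, -⟩ := h.top_col ht
    have m := h.mono i hiC t tC
    simp only [colKey, rowKey, hi, hσi, tD, tL, if_true, if_false] at m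
    have hti : t ≠ i := by
      rintro rfl
      exact hσi tL
    have hti' : (t : ℕ) ≠ i := fun h => hti (Fin.ext h)
    have := h4 t (by rw [Fin.lt_def]; omega)
    rw [Fin.lt_def] at this
    omega
  · set l : Fin N := ⟨N - 1, by omega⟩ with hl
    have hlD : l ∈ D := h.last_mem l (by simp only [hl]; omega)
    have hlC := h.reg.subC hlD
    have hzl : z < l := by
      rw [Fin.lt_def]
      simp only [hl]
      omega
    have hlL := (h.rlMin_of_high hlD hzl).2
    have m := h.mono i hiC l hlC
    simp only [colKey, rowKey, hi, hlD, hσi, hlL, not_le.2 hzl, if_true, if_false] at m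
    have hli : l ≠ i := by
      rintro h5
      exact hi (h5 ▸ hlD)
    have hli' : (l : ℕ) ≠ i := fun h => hli (Fin.ext h)
    have hlv : (l : ℕ) = N - 1 := rfl
    have := h4 l (by rw [Fin.lt_def]; omega)
    rw [Fin.lt_def] at this
    omega

/-- By the key order the point of the first column lies below, so there is no left-to-right minimum
even near the left corner; the other exclusion is by distance. -/
theorem left_not_lower (h : Admissible σ C D R L z E) {i : Fin N} (hi : i ∉ D)
    (hσi : σ i ∈ L) : ¬ LRMin σ i ∧ ¬ RLMin σ i := by
  have h1 := h.reg.lo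
  have h2 := h.reg.hi
  have h3 := h.reg.one_le
  have bi := i.2
  have bs := (σ i).2
  have hiC := (h.mem_iff i).1 (h.reg.subR hσi)
  have hs : |(σ i : ℤ) - (z + i)| ≤ 10 * E := by
    rcases h.shape hiC with s | s | s | s
    · exact absurd s.1 hi
    · exact s.2.2
    · exact absurd hσi s.2.1
    · exact absurd s.1 hi
  have hs' := abs_le.1 hs
  refine ⟨fun h4 => ?_, h.exists_below_right (by omega)⟩
  set o : Fin N := ⟨0, by omega⟩ with ho
  have hoD : o ∈ D := h.first_mem o rfl
  have hoz : o ≤ z := Nat.zero_le _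
  have hoL := (h.low_shape hoD hoz).2
  have m := h.mono o (h.reg.subC hoD) i hiC
  simp only [colKey, rowKey, hi, hoD, hσi, hoL, hoz, if_true, if_false] at m
  have hoi : o ≠ i := by
    rintro h5
    exact hi (h5 ▸ hoD)
  have hoi' : (o : ℕ) ≠ i := fun h => hoi (Fin.ext h)
  have hov : (o : ℕ) = 0 := rfl
  have := h4 o (by rw [Fin.lt_def]; omega)
  rw [Fin.lt_def] at this
  omega

theorem extCols_eq (h : Admissible σ C D R L z E) : extCols σ = C := by
  ext i
  rw [mem_extCols]
  constructor
  · intro h1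
    by_contra h2
    exact h.inside_not_external h2 h1
  · intro hi
    rw [isExternal_iff]
    by_cases hD : i ∈ D
    · rcases le_or_gt i z with h1 | h1
      · exact Or.inr (Or.inl (h.lrMin_of_low hD h1))
      · exact Or.inr (Or.inr (Or.inr (h.rlMin_of_high hD h1).1))
    · by_cases hL : σ i ∈ L
      · exact Or.inl (h.lrMax_of_left hD hL)
      · exact Or.inr (Or.inr (Or.inl (h.rlMax_of_right hi hD hL)))

theorem lowerCols_eq (h : Admissible σ C D R L z E) : lowerCols σ = D := by
  ext i
  rw [mem_lowerCols]
  constructor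
  · intro h1
    have hC : i ∈ C := by
      rw [← h.extCols_eq, mem_extCols]
      exact h1.isExternal
    by_contra hD
    by_cases hL : σ i ∈ L
    · have := h.left_not_lower hD hL
      rcases h1 with h1 | h1 <;> tauto
    · have := h.right_not_low hC hD hL
      rcases h1 with h1 | h1 <;> tauto
  · intro hD
    rcases le_or_gt i z with h1 | h1
    · exact Or.inl (h.lrMin_of_low hD h1)
    · exact Or.inr (h.rlMin_of_high hD h1).1

theorem leftRows_eq (h : Admissible σ C D R L z E) : leftRows σ = L := by
  ext j
  obtain ⟨i, rfl⟩ := σ.surjective j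
  rw [mem_leftRows]
  have hz := h.z_row
  constructor
  · intro h1
    have hC : i ∈ C := by
      rw [← h.extCols_eq, mem_extCols]
      exact h1.isExternal
    by_contra hL
    have htop : (σ i : ℕ) + 1 ≠ N := fun h2 => hL (h.top_mem _ h2)
    by_cases hD : i ∈ D
    · rcases le_or_gt i z with h2 | h2
      · exact hL (h.low_shape hD h2).2
      · have h3 := (h.rlMin_of_high hD h2).1
        have h4 : ¬ LRMin σ i := fun h4 => by
          have := h4 z h2
          rw [Fin.lt_def] at this
          omega
        unfold LeftLabel at h1
        tauto
    · have := h.right_not_low hC hD hL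
      unfold LeftLabel at h1
      tauto
  · intro hL
    have hC : i ∈ C := (h.mem_iff i).1 (h.reg.subR hL)
    by_cases hD : i ∈ D
    · rcases le_or_gt i z with h2 | h2
      · exact Or.inl (h.lrMin_of_low hD h2)
      · exact absurd hL (h.rlMin_of_high hD h2).2
    · exact Or.inr (Or.inr ⟨h.lrMax_of_left hD hL, (h.left_not_lower hD hL).2⟩)

end Admissible

/-- There is a permutation that follows the boundary order on `C` and a prescribed matching off
`C`. -/
theorem exists_keyMono {C D R L : Finset (Fin N)} {z : Fin N} (hcard : C.card = R.card)
    (τ : Fin N → Fin N) (hτ : ∀ i, i ∉ C → τ i ∉ R)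
    (hinj : ∀ i, i ∉ C → ∀ j, j ∉ C → τ i = τ j → i = j) :
    ∃ σ : Equiv.Perm (Fin N), KeyMono σ C D z L ∧ (∀ i, σ i ∈ R ↔ i ∈ C) ∧
      ∀ i, i ∉ C → σ i = τ i := by
  set A := C.image (colKey D z) with hA
  set B := R.image (rowKey L) with hB
  have hAc : A.card = C.card := Finset.card_image_of_injective _ (colKey_injective D z)
  have hBc : B.card = C.card :=
    (Finset.card_image_of_injective _ (rowKey_injective L)).trans hcard.symm
  -- The order isomorphism between the two sets of keys is the only possible choice on `C`.
  set e := (A.orderIsoOfFin hAc).symm.trans (B.orderIsoOfFin hBc) with he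
  have hmem : ∀ i, i ∈ C → colKey D z i ∈ A := fun i hi => Finset.mem_image_of_mem _ hi
  have hex : ∀ i, ∃ j, (∀ hi : i ∈ C, j ∈ R ∧ rowKey L j = e ⟨colKey D z i, hmem i hi⟩) ∧
      (i ∉ C → j = τ i) := by
    intro i
    by_cases hi : i ∈ C
    · obtain ⟨j, hj1, hj2⟩ := Finset.mem_image.1 (e ⟨colKey D z i, hmem i hi⟩).2
      exact ⟨j, fun _ => ⟨hj1, hj2⟩, fun h => absurd hi h⟩
    · exact ⟨τ i, fun h => absurd h hi, fun _ => rfl⟩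
  choose f hf1 hf2 using hex
  have hfR : ∀ i, f i ∈ R ↔ i ∈ C := by
    intro i
    constructor
    · intro h1
      by_contra h2
      rw [hf2 i h2] at h1
      exact hτ i h2 h1
    · exact fun h => (hf1 i h).1
  have hfinj : Function.Injective f := by
    intro i j hij
    by_cases hi : i ∈ C
    · have hj : j ∈ C := by rwa [← hfR, ← hij, hfR]
      have h1 := (hf1 i hi).2
      have h2 := (hf1 j hj).2
      rw [hij, h2] at h1
      have h3 := e.injective (Subtype.ext h1)
      exact (colKey_injective D z (congrArg Subtype.val h3)).symm
    · have hj : j ∉ C := by rwa [← hfR, ← hij, hfR]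
      exact hinj i hi j hj (by rw [← hf2 i hi, ← hf2 j hj, hij])
  refine ⟨Equiv.ofBijective f (Finite.injective_iff_bijective.1 hfinj), ?_, hfR, hf2⟩
  intro i hi j hj hij
  simp only [Equiv.ofBijective_apply]
  rw [(hf1 i hi).2, (hf1 j hj).2]
  exact e.strictMono (show (⟨_, hmem i hi⟩ : A) < ⟨_, hmem j hj⟩ from hij)

/-- The set of external rows. -/
noncomputable def extRows (σ : Equiv.Perm (Fin N)) : Finset (Fin N) :=
  Finset.univ.filter fun j => IsExternal σ (σ.symm j)

@[simp] theorem mem_extRows {σ : Equiv.Perm (Fin N)} {i : Fin N} :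
    σ i ∈ extRows σ ↔ IsExternal σ i := by simp [extRows]

/-- A permutation is determined by its labels, the column of its lowest point and its internal
points. -/
theorem eq_of_labels {σ τ : Equiv.Perm (Fin N)} {z : Fin N} (hσ : (σ z : ℕ) = 0)
    (hτ : (τ z : ℕ) = 0) (hC : extCols σ = extCols τ) (hD : lowerCols σ = lowerCols τ)
    (hR : extRows σ = extRows τ) (hL : leftRows σ = leftRows τ)
    (hint : ∀ i, ¬ IsExternal σ i → σ i = τ i) : σ = τ := by
  ext1 i
  by_cases hi : IsExternal σ i
  · have h1 := canonical_keyMono σ z hσ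
    have h2 := canonical_keyMono τ z hτ
    rw [← hC, ← hD, ← hL] at h2
    refine h1.eq (R := extRows σ) h2 (fun i => by simp) (fun i => ?_) (by simpa using hi)
    rw [hC, hR]
    simp
  · exact hint i hi

end Labels

/-! ### Words, their number per permutation, and their realisation. -/

section Words

variable {N k : ℕ}

/-- A word records column labels, row labels, the column of the lowest point and a list of `k`
points. -/
abbrev Word (N k : ℕ) : Type :=
  (Fin N → Bool) × (Fin N → Bool) × Fin N × (Fin k → Fin N × Fin N)

/-- The index `i` is neither the first nor the last one. -/
def Inner (i : Fin N) : Prop := (i : ℕ) ≠ 0 ∧ (i : ℕ) + 1 ≠ N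

/-- The columns of the internal points. -/
noncomputable def intCols (σ : Equiv.Perm (Fin N)) : Finset (Fin N) :=
  Finset.univ.filter fun i => ¬ IsExternal σ i

@[simp] theorem mem_intCols {σ : Equiv.Perm (Fin N)} {i : Fin N} :
    i ∈ intCols σ ↔ ¬ IsExternal σ i := by simp [intCols]

/-- The word `w` lists the internal points of `σ` and gives the labels of its external points,
without constraint in the columns and rows whose label is automatic. -/
structure Compat (w : Word N k) (σ : Equiv.Perm (Fin N)) : Prop where
  col : ∀ i, IsExternal σ i ∧ Inner i ∧ i ≠ w.2.2.1 → (w.1 i = true ↔ Lower σ i)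
  row : ∀ j, IsExternal σ (σ.symm j) ∧ Inner j →
    (w.2.1 j = true ↔ LeftLabel σ (σ.symm j))
  z_row : (σ w.2.2.1 : ℕ) = 0
  inj : Function.Injective fun t => (w.2.2.2 t).1
  int : ∀ t, ¬ IsExternal σ (w.2.2.2 t).1 ∧ σ (w.2.2.2 t).1 = (w.2.2.2 t).2

theorem lower_of_not_inner {σ : Equiv.Perm (Fin N)} {i : Fin N} (h : ¬ Inner i) :
    Lower σ i := by
  unfold Inner at h
  by_cases h1 : (i : ℕ) = 0
  · exact lower_of_first h1
  · exact lower_of_last (by tauto)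

theorem leftLabel_of_not_inner {σ : Equiv.Perm (Fin N)} {i : Fin N} (h : ¬ Inner (σ i)) :
    LeftLabel σ i := by
  unfold Inner at h
  by_cases h1 : (σ i : ℕ) = 0
  · exact Or.inl (lrMin_of_bottom h1)
  · exact Or.inr (Or.inl (by tauto))

/-- The bit at `i` is forced where `p i` holds and free elsewhere. -/
theorem card_labels {ι : Type*} [Fintype ι] [DecidableEq ι] (p q : ι → Prop)
    [DecidablePred fun x : ι → Bool => ∀ i, p i → (x i = true ↔ q i)]
    [DecidablePred fun i => ¬ p i] :
    (Finset.univ.filter fun x : ι → Bool => ∀ i, p i → (x i = true ↔ q i)).card =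
      2 ^ (Finset.univ.filter fun i => ¬ p i).card := by
  have h : (Finset.univ.filter fun x : ι → Bool => ∀ i, p i → (x i = true ↔ q i)) =
      Fintype.piFinset fun i => if p i then {decide (q i)} else (Finset.univ : Finset Bool) := by
    ext x
    simp only [Finset.mem_filter, Finset.mem_univ, true_and, Fintype.mem_piFinset]
    refine forall_congr' fun i => ?_
    by_cases hp : p i
    · by_cases hq : q i <;> simp [hp, hq]
    · simp [hp]
  rw [h, Fintype.card_piFinset]
  have h2 : ∀ i, (if p i then {decide (q i)} else (Finset.univ : Finset Bool)).card =
      if ¬ p i then 2 else 1 := by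
    intro i
    by_cases hp : p i <;> simp [hp]
  simp_rw [h2]
  rw [Finset.prod_ite, Finset.prod_const, Finset.prod_const_one, mul_one]

/-- The lists are the embeddings of `Fin k` into the `k` internal columns, the rows being imposed by
`σ`. -/
theorem card_enumerations (σ : Equiv.Perm (Fin N)) (h : (intCols σ).card = k) :
    (Finset.univ.filter fun P : Fin k → Fin N × Fin N =>
      (Function.Injective fun t => (P t).1) ∧
        ∀ t, ¬ IsExternal σ (P t).1 ∧ σ (P t).1 = (P t).2).card = k.factorial := by
  set g : (Fin k ↪ {i // i ∈ intCols σ}) → Fin k → Fin N × Fin N :=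
    fun f t => (f t, σ (f t)) with hg
  have hginj : Function.Injective g := by
    intro f f' hff
    ext t : 1
    have := congrFun hff t
    exact Subtype.ext (congrArg Prod.fst this)
  have himg : (Finset.univ.filter fun P : Fin k → Fin N × Fin N =>
      (Function.Injective fun t => (P t).1) ∧
        ∀ t, ¬ IsExternal σ (P t).1 ∧ σ (P t).1 = (P t).2) = Finset.univ.image g := by
    ext P
    simp only [Finset.mem_filter, Finset.mem_univ, true_and, Finset.mem_image]
    constructor
    · rintro ⟨h1, h2⟩
      refine ⟨⟨fun t => ⟨(P t).1, mem_intCols.2 (h2 t).1⟩, fun a b hab =>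
        h1 (congrArg Subtype.val hab)⟩, ?_⟩
      funext t
      exact Prod.ext rfl (h2 t).2
    · rintro ⟨f, rfl⟩
      refine ⟨fun a b hab => f.injective (Subtype.ext hab), fun t => ⟨?_, rfl⟩⟩
      exact mem_intCols.1 (f t).2
  rw [himg, Finset.card_image_of_injective _ hginj, Finset.card_univ, Fintype.card_embedding_eq,
    Fintype.card_coe, h, Fintype.card_fin, Nat.descFactorial_self]

theorem card_not_inner (hN : 2 ≤ N) :
    (Finset.univ.filter fun i : Fin N => ¬ Inner i).card = 2 := by
  have h : (Finset.univ.filter fun i : Fin N => ¬ Inner i) =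
      {⟨0, by omega⟩, ⟨N - 1, by omega⟩} := by
    ext i
    have := i.2
    rw [Finset.mem_filter]
    simp only [Inner, Finset.mem_univ, true_and, Finset.mem_insert, Finset.mem_singleton,
      Fin.ext_iff]
    omega
  rw [h, Finset.card_pair]
  intro h1
  have := congrArg Fin.val h1
  simp only at this
  omega

theorem exists_bottom (hN : 2 ≤ N) (σ : Equiv.Perm (Fin N)) : ∃ z : Fin N, (σ z : ℕ) = 0 :=
  ⟨σ.symm ⟨0, by omega⟩, by simp⟩

/-- The compatible words of a permutation, weighted by `2` if the lowest point is in a corner, have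
a total weight that does not depend on the permutation. -/
theorem card_compat (hN : 2 ≤ N) (σ : Equiv.Perm (Fin N)) (h : (intCols σ).card = k) (z : Fin N)
    (hz : (σ z : ℕ) = 0) :
    (Finset.univ.filter fun w : Word N k => Compat w σ).card * (if Inner z then 1 else 2) =
      2 ^ (k + 3) * (2 ^ (k + 2) * k.factorial) := by
  have hset : (Finset.univ.filter fun w : Word N k => Compat w σ) =
      (Finset.univ.filter fun x : Fin N → Bool =>
        ∀ i, IsExternal σ i ∧ Inner i ∧ i ≠ z → (x i = true ↔ Lower σ i)) ×ˢ
      (Finset.univ.filter fun y : Fin N → Bool =>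
        ∀ j, IsExternal σ (σ.symm j) ∧ Inner j → (y j = true ↔ LeftLabel σ (σ.symm j))) ×ˢ
      ({z} : Finset (Fin N)) ×ˢ
      (Finset.univ.filter fun P : Fin k → Fin N × Fin N =>
        (Function.Injective fun t => (P t).1) ∧
        ∀ t, ¬ IsExternal σ (P t).1 ∧ σ (P t).1 = (P t).2) := by
    ext ⟨x, y, z', P⟩
    simp only [Finset.mem_filter, Finset.mem_univ, true_and, Finset.mem_product,
      Finset.mem_singleton]
    constructor
    · rintro ⟨h1, h2, h3, h4, h5⟩
      have hzz : z' = z := Fin.ext ((perm_eq_iff_val σ z' z).1 (h3.trans hz.symm))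
      subst hzz
      exact ⟨h1, h2, rfl, h4, h5⟩
    · rintro ⟨h1, h2, rfl, h4, h5⟩
      exact ⟨h1, h2, hz, h4, h5⟩
  -- The free column bits are those of the `k` internal columns, the two extreme columns and column
  -- `z`. If `z` is extreme one free bit is lost, which the weight 2 compensates.
  have hcol : (Finset.univ.filter fun i : Fin N => ¬ (IsExternal σ i ∧ Inner i ∧ i ≠ z)).card =
      if Inner z then k + 3 else k + 2 := by
    have h1 : (Finset.univ.filter fun i : Fin N => ¬ (IsExternal σ i ∧ Inner i ∧ i ≠ z)) =
        intCols σ ∪ ((Finset.univ.filter fun i : Fin N => ¬ Inner i) ∪ {z}) := by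
      ext i
      simp only [Finset.mem_filter, Finset.mem_univ, true_and, Finset.mem_union, mem_intCols,
        Finset.mem_singleton]
      tauto
    have hzext : IsExternal σ z := Lower.isExternal (Or.inl (lrMin_of_bottom hz))
    rw [h1, Finset.card_union_of_disjoint, h]
    · by_cases h2 : Inner z
      · rw [Finset.card_union_of_disjoint, card_not_inner hN]
        · simp [h2]
        · simp [h2]
      · rw [Finset.union_eq_left.2 (by simpa using h2), card_not_inner hN]
        simp [h2]
    · rw [Finset.disjoint_left]
      intro i hi hi2
      rw [mem_intCols] at hi
      simp only [Finset.mem_union, Finset.mem_filter, Finset.mem_univ, true_and,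
        Finset.mem_singleton] at hi2
      rcases hi2 with h2 | rfl
      · exact hi (lower_of_not_inner h2).isExternal
      · exact hi hzext
  -- The free row bits are those of the `k` internal rows and of the bottom and top rows.
  have hrow : (Finset.univ.filter fun j : Fin N =>
      ¬ (IsExternal σ (σ.symm j) ∧ Inner j)).card = k + 2 := by
    have h1 : (Finset.univ.filter fun j : Fin N => ¬ (IsExternal σ (σ.symm j) ∧ Inner j)) =
        (intCols σ).image σ ∪ (Finset.univ.filter fun i : Fin N => ¬ Inner i) := by
      ext j
      obtain ⟨i, rfl⟩ := σ.surjective j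
      simp only [Finset.mem_filter, Finset.mem_univ, true_and, Finset.mem_union,
        Finset.mem_image, mem_intCols, Equiv.symm_apply_apply, σ.injective.eq_iff,
        exists_eq_right]
      tauto
    rw [h1, Finset.card_union_of_disjoint, Finset.card_image_of_injective _ σ.injective, h,
      card_not_inner hN]
    rw [Finset.disjoint_left]
    intro j hi hi2
    obtain ⟨i, hi1, rfl⟩ := Finset.mem_image.1 hi
    rw [mem_intCols] at hi1
    simp only [Finset.mem_filter, Finset.mem_univ, true_and] at hi2
    exact hi1 (leftLabel_of_not_inner hi2).isExternal
  rw [hset, Finset.card_product, Finset.card_product, Finset.card_product, Finset.card_singleton,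
    card_labels, card_labels, card_enumerations σ h, hcol, hrow]
  by_cases h2 : Inner z
  · simp [h2]
  · simp only [h2, if_false]
    ring

theorem Compat.intCols_eq {w : Word N k} {σ : Equiv.Perm (Fin N)} (h : Compat w σ)
    (hk : (intCols σ).card = k) :
    intCols σ = Finset.univ.image fun t => (w.2.2.2 t).1 := by
  refine (Finset.eq_of_subset_of_card_le ?_ ?_).symm
  · intro i hi
    obtain ⟨t, -, rfl⟩ := Finset.mem_image.1 hi
    exact mem_intCols.2 (h.int t).1
  · rw [Finset.card_image_of_injective _ h.inj, hk]
    simp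

theorem Compat.not_isExternal_iff {w : Word N k} {σ : Equiv.Perm (Fin N)} (h : Compat w σ)
    (hk : (intCols σ).card = k) (i : Fin N) :
    ¬ IsExternal σ i ↔ ∃ t, (w.2.2.2 t).1 = i := by
  rw [← mem_intCols, h.intCols_eq hk]
  simp

theorem Compat.not_isExternal_symm_iff {w : Word N k} {σ : Equiv.Perm (Fin N)} (h : Compat w σ)
    (hk : (intCols σ).card = k) (j : Fin N) :
    ¬ IsExternal σ (σ.symm j) ↔ ∃ t, (w.2.2.2 t).2 = j := by
  rw [h.not_isExternal_iff hk]
  refine exists_congr fun t => ?_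
  rw [← (h.int t).2, Equiv.eq_symm_apply]

/-- The first column, the last one and that of the lowest point always carry minimum records, so
their bits bear no information. -/
theorem Compat.lower_iff {w : Word N k} {σ : Equiv.Perm (Fin N)} (h : Compat w σ)
    (i : Fin N) : Lower σ i ↔ IsExternal σ i ∧ (¬ Inner i ∨ i = w.2.2.1 ∨ w.1 i = true) := by
  by_cases h1 : IsExternal σ i
  · by_cases h2 : Inner i
    · by_cases h3 : i = w.2.2.1
      · have : Lower σ i := Or.inl (lrMin_of_bottom (by rw [h3]; exact h.z_row))
        exact iff_of_true this ⟨h1, Or.inr (Or.inl h3)⟩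
      · simp [h.col i ⟨h1, h2, h3⟩, h1, h2, h3]
    · simp [lower_of_not_inner (σ := σ) h2, h1, h2]
  · exact iff_of_false (fun h3 => h1 h3.isExternal) fun h3 => h1 h3.1

theorem Compat.leftLabel_iff {w : Word N k} {σ : Equiv.Perm (Fin N)} (h : Compat w σ)
    (j : Fin N) : LeftLabel σ (σ.symm j) ↔
      IsExternal σ (σ.symm j) ∧ (¬ Inner j ∨ w.2.1 j = true) := by
  by_cases h1 : IsExternal σ (σ.symm j)
  · by_cases h2 : Inner j
    · simp [h.row j ⟨h1, h2⟩, h1, h2]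
    · simp [leftLabel_of_not_inner (σ := σ) (i := σ.symm j) (by simpa using h2), h1, h2]
  · exact iff_of_false (fun h3 => h1 h3.isExternal) fun h3 => h1 h3.1

theorem Compat.unique {w : Word N k} {σ τ : Equiv.Perm (Fin N)} (hσ : Compat w σ)
    (hτ : Compat w τ) (kσ : (intCols σ).card = k) (kτ : (intCols τ).card = k) : σ = τ := by
  have h1 : ∀ i, IsExternal σ i ↔ IsExternal τ i := fun i =>
    not_iff_not.1 ((hσ.not_isExternal_iff kσ i).trans (hτ.not_isExternal_iff kτ i).symm)
  have h2 : ∀ j, IsExternal σ (σ.symm j) ↔ IsExternal τ (τ.symm j) := fun j =>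
    not_iff_not.1 ((hσ.not_isExternal_symm_iff kσ j).trans (hτ.not_isExternal_symm_iff kτ j).symm)
  refine eq_of_labels hσ.z_row hτ.z_row ?_ ?_ ?_ ?_ ?_
  · ext i
    simp [h1]
  · ext i
    rw [mem_lowerCols, mem_lowerCols, hσ.lower_iff, hτ.lower_iff, h1]
  · ext j
    simp [extRows, h2]
  · ext j
    simp only [leftRows, Finset.mem_filter, Finset.mem_univ, true_and]
    rw [hσ.leftLabel_iff, hτ.leftLabel_iff, h2]
  · intro i hi
    obtain ⟨t, rfl⟩ := (hσ.not_isExternal_iff kσ i).1 hi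
    rw [(hσ.int t).2, (hτ.int t).2]

/-- The set of indices with the label `true`. -/
def trueSet (x : Fin N → Bool) : Finset (Fin N) := Finset.univ.filter fun i => x i = true

@[simp] theorem mem_trueSet {x : Fin N → Bool} {i : Fin N} : i ∈ trueSet x ↔ x i = true := by
  simp [trueSet]

theorem cnt_le_of_subset_union {S T X : Finset (Fin N)} (h : S ⊆ T ∪ X) (t : ℕ) :
    cnt S t ≤ cnt T t + X.card := by
  unfold cnt
  refine (Finset.card_le_card (t := (T.filter fun i : Fin N => (i : ℕ) < t) ∪ X) ?_).trans
    (Finset.card_union_le _ _)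
  intro i hi
  have := @h i
  simp only [Finset.mem_filter, Finset.mem_union] at *
  tauto

theorem cnt_add_cnt_compl (S : Finset (Fin N)) {t : ℕ} (ht : t ≤ N) :
    cnt S t + cnt Sᶜ t = t := by
  have h1 : (Finset.univ.filter fun i : Fin N => (i : ℕ) < t).card = t := by
    rw [Fin.card_filter_val_lt]
    omega
  unfold cnt
  rw [← Finset.card_union_of_disjoint, ← Finset.filter_union, Finset.union_compl, h1]
  exact Finset.disjoint_filter_filter disjoint_compl_right

/-- Altering a set inside `X` changes each prefix count by at most the size of `X`. -/
theorem Balanced.of_subset {S T X : Finset (Fin N)} {E : ℤ} (hT : Balanced T E)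
    (h1 : S ⊆ T ∪ X) (h2 : T ⊆ S ∪ X) : Balanced S (E + 2 * X.card) := by
  intro t ht
  have h3 := cnt_le_of_subset_union h1 t
  have h4 := cnt_le_of_subset_union h2 t
  have h5 := abs_le.1 (hT t ht)
  rw [abs_le]
  omega

theorem Balanced.compl {T : Finset (Fin N)} {E : ℤ} (hT : Balanced T E) : Balanced Tᶜ E := by
  intro t ht
  have h3 := cnt_add_cnt_compl T ht
  have h5 := abs_le.1 (hT t ht)
  rw [abs_le]
  omega

theorem card_exceptional (hN : 2 ≤ N) (f : Fin k → Fin N) (z : Fin N) :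
    (Finset.univ.image f ∪ ((Finset.univ.filter fun i : Fin N => ¬ Inner i) ∪ {z})).card ≤
      k + 3 := by
  refine (Finset.card_union_le _ _).trans ?_
  have h1 : (Finset.univ.image f).card ≤ k := Finset.card_image_le.trans (by simp)
  have h2 := Finset.card_union_le (Finset.univ.filter fun i : Fin N => ¬ Inner i) {z}
  rw [card_not_inner hN, Finset.card_singleton] at h2
  omega

/-- Label sets read off from balanced words are regular. -/
theorem regular_of_word {w : Word N k} {E : ℤ} (hx : Balanced (trueSet w.1) E)
    (hy : Balanced (trueSet w.2.1) E) (hE : 0 ≤ E) (hN : 2 ≤ N)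
    (hlo : 100 * (E + 2 * (k + 3)) < w.2.2.1)
    (hhi : (w.2.2.1 : ℤ) + 100 * (E + 2 * (k + 3)) < N) {C D R L : Finset (Fin N)}
    (hC : ∀ i, i ∈ C ↔ ¬ ∃ t, (w.2.2.2 t).1 = i)
    (hD : ∀ i, i ∈ D ↔ i ∈ C ∧ (¬ Inner i ∨ i = w.2.2.1 ∨ w.1 i = true))
    (hR : ∀ i, i ∈ R ↔ ¬ ∃ t, (w.2.2.2 t).2 = i)
    (hL : ∀ i, i ∈ L ↔ i ∈ R ∧ (¬ Inner i ∨ w.2.1 i = true)) :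
    Regular C D R L w.2.2.1 (E + 2 * (k + 3)) := by
  -- The bits and the actual labels differ only at listed indices, at the two ends and at the corner
  -- column. These are at most `k + 3` indices, hence the extra error `2 * (k + 3)`. Rows do not
  -- need the corner; it is kept in `Y` so that the same count applies.
  set X := Finset.univ.image (fun t => (w.2.2.2 t).1) ∪
    ((Finset.univ.filter fun i : Fin N => ¬ Inner i) ∪ {w.2.2.1}) with hX
  set Y := Finset.univ.image (fun t => (w.2.2.2 t).2) ∪
    ((Finset.univ.filter fun i : Fin N => ¬ Inner i) ∪ {w.2.2.1}) with hY
  have hXc : (X.card : ℤ) ≤ k + 3 := by exact_mod_cast card_exceptional hN _ _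
  have hYc : (Y.card : ℤ) ≤ k + 3 := by exact_mod_cast card_exceptional hN _ _
  have mX : ∀ i, i ∈ X ↔ (∃ t, (w.2.2.2 t).1 = i) ∨ ¬ Inner i ∨ i = w.2.2.1 := fun i => by
    simp only [hX, Finset.mem_union, Finset.mem_image, Finset.mem_univ, true_and,
      Finset.mem_filter, Finset.mem_singleton]
  have mY : ∀ i, i ∈ Y ↔ (∃ t, (w.2.2.2 t).2 = i) ∨ ¬ Inner i ∨ i = w.2.2.1 := fun i => by
    simp only [hY, Finset.mem_union, Finset.mem_image, Finset.mem_univ, true_and,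
      Finset.mem_filter, Finset.mem_singleton]
  have nX : ∀ i, i ∉ X → i ∈ C ∧ (i ∈ D ↔ w.1 i = true) := by
    intro i hi
    rw [mX] at hi
    push Not at hi
    have h1 : i ∈ C := by
      rw [hC]
      push Not
      exact hi.1
    simp [hD, h1, hi]
  have nY : ∀ i, i ∉ Y → i ∈ R ∧ (i ∈ L ↔ w.2.1 i = true) := by
    intro i hi
    rw [mY] at hi
    push Not at hi
    have h1 : i ∈ R := by
      rw [hR]
      push Not
      exact hi.1
    simp [hL, h1, hi]
  clear_value X Y
  refine ⟨fun i hi => ((hD i).1 hi).1, fun i hi => ((hL i).1 hi).1,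
    (hx.of_subset (X := X) ?_ ?_).mono (by omega),
    (hx.compl.of_subset (X := X) ?_ ?_).mono (by omega),
    (hy.of_subset (X := Y) ?_ ?_).mono (by omega),
    (hy.compl.of_subset (X := Y) ?_ ?_).mono (by omega), by omega, hlo, hhi⟩
  all_goals
    intro i
    have h1 := nX i
    have h2 := nY i
    simp only [Finset.mem_union, mem_trueSet, Finset.mem_compl, Finset.mem_sdiff]
    by_cases hiX : i ∈ X <;> by_cases hiY : i ∈ Y <;> simp [hiX, hiY] at h1 h2 ⊢ <;> simp [h1, h2]

theorem Compat.regular {w : Word N k} {σ : Equiv.Perm (Fin N)} (h : Compat w σ)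
    (hk : (intCols σ).card = k) {E : ℤ} (hx : Balanced (trueSet w.1) E)
    (hy : Balanced (trueSet w.2.1) E) (hE : 0 ≤ E) (hN : 2 ≤ N)
    (hlo : 100 * (E + 2 * (k + 3)) < w.2.2.1)
    (hhi : (w.2.2.1 : ℤ) + 100 * (E + 2 * (k + 3)) < N) :
    Regular (extCols σ) (lowerCols σ) (extRows σ) (leftRows σ) w.2.2.1 (E + 2 * (k + 3)) := by
  refine regular_of_word hx hy hE hN hlo hhi (fun i => ?_) (fun i => ?_) (fun j => ?_)
    (fun j => ?_)
  · rw [mem_extCols, ← h.not_isExternal_iff hk, not_not]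
  · rw [mem_lowerCols, mem_extCols, h.lower_iff]
  · rw [← h.not_isExternal_symm_iff hk, not_not]
    simp [extRows]
  · simp only [leftRows, extRows, Finset.mem_filter, Finset.mem_univ, true_and]
    rw [h.leftLabel_iff]

/-- Balanced words whose listed points are well inside the rectangle come from permutations. -/
theorem exists_compat {w : Word N k} {E : ℤ} (hx : Balanced (trueSet w.1) E)
    (hy : Balanced (trueSet w.2.1) E) (hE : 0 ≤ E) (hN : 2 ≤ N)
    (hlo : 100 * (E + 2 * (k + 3)) < w.2.2.1)
    (hhi : (w.2.2.1 : ℤ) + 100 * (E + 2 * (k + 3)) < N)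
    (hinj1 : Function.Injective fun t => (w.2.2.2 t).1)
    (hinj2 : Function.Injective fun t => (w.2.2.2 t).2)
    (hz : ∀ t, (w.2.2.2 t).1 ≠ w.2.2.1)
    (hin : ∀ t, (w.2.2.1 : ℤ) + 60 * (E + 2 * (k + 3)) < (w.2.2.2 t).1 + (w.2.2.2 t).2 ∧
      ((w.2.2.2 t).1 : ℤ) + (w.2.2.2 t).2 < 2 * N - w.2.2.1 - 60 * (E + 2 * (k + 3)) ∧
      -(w.2.2.1 : ℤ) + 60 * (E + 2 * (k + 3)) < (w.2.2.2 t).2 - (w.2.2.2 t).1 ∧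
      ((w.2.2.2 t).2 : ℤ) - (w.2.2.2 t).1 < w.2.2.1 - 60 * (E + 2 * (k + 3))) :
    ∃ σ : Equiv.Perm (Fin N), Compat w σ ∧ (intCols σ).card = k := by
  set F : ℤ := E + 2 * (k + 3) with hF
  set z := w.2.2.1 with hzdef
  set C : Finset (Fin N) := (Finset.univ.image fun t => (w.2.2.2 t).1)ᶜ with hCdef
  set R : Finset (Fin N) := (Finset.univ.image fun t => (w.2.2.2 t).2)ᶜ with hRdef
  set D : Finset (Fin N) := C.filter fun i => ¬ Inner i ∨ i = z ∨ w.1 i = true with hDdef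
  set L : Finset (Fin N) := R.filter fun i => ¬ Inner i ∨ w.2.1 i = true with hLdef
  have hC : ∀ i, i ∈ C ↔ ¬ ∃ t, (w.2.2.2 t).1 = i := by simp [hCdef]
  have hR : ∀ i, i ∈ R ↔ ¬ ∃ t, (w.2.2.2 t).2 = i := by simp [hRdef]
  have hD : ∀ i, i ∈ D ↔ i ∈ C ∧ (¬ Inner i ∨ i = z ∨ w.1 i = true) := by simp [hDdef]
  have hL : ∀ i, i ∈ L ↔ i ∈ R ∧ (¬ Inner i ∨ w.2.1 i = true) := by simp [hLdef]
  have hreg : Regular C D R L z F := regular_of_word hx hy hE hN hlo hhi hC hD hR hL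
  have hCcard : C.card + k = N := by
    have := Finset.card_compl_add_card C
    rw [hCdef, compl_compl, Finset.card_image_of_injective _ hinj1, Finset.card_univ,
      Fintype.card_fin, Fintype.card_fin] at this
    rw [hCdef]
    omega
  have hRcard : R.card + k = N := by
    have := Finset.card_compl_add_card R
    rw [hRdef, compl_compl, Finset.card_image_of_injective _ hinj2, Finset.card_univ,
      Fintype.card_fin, Fintype.card_fin] at this
    rw [hRdef]
    omega
  -- The matching `τ` is prescribed on listed columns; the identity elsewhere is a dummy value.
  have hex : ∀ i, ∃ j, ∀ t, (w.2.2.2 t).1 = i → (w.2.2.2 t).2 = j := by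
    intro i
    by_cases h : ∃ t, (w.2.2.2 t).1 = i
    · obtain ⟨t, ht⟩ := h
      refine ⟨(w.2.2.2 t).2, fun s hs => ?_⟩
      rw [hinj1 (hs.trans ht.symm)]
    · exact ⟨i, fun t ht => absurd ⟨t, ht⟩ h⟩
  choose τ hτ using hex
  have hof : ∀ i, i ∉ C → ∃ t, (w.2.2.2 t).1 = i := fun i hi => by
    by_contra h
    exact hi ((hC i).2 h)
  obtain ⟨σ, hσ1, hσ2, hσ3⟩ := exists_keyMono (C := C) (D := D) (R := R) (L := L) (z := z)
    (by omega) τ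
    (fun i hi => by
      obtain ⟨t, ht⟩ := hof i hi
      rw [hR, not_not]
      exact ⟨t, hτ i t ht⟩)
    (fun i hi j hj hij => by
      obtain ⟨t, ht⟩ := hof i hi
      obtain ⟨s, hs⟩ := hof j hj
      rw [← hτ i t ht, ← hτ j s hs] at hij
      rw [← ht, ← hs, hinj2 hij])
  have hσint : ∀ t, σ (w.2.2.2 t).1 = (w.2.2.2 t).2 := by
    intro t
    have h1 : (w.2.2.2 t).1 ∉ C := by
      rw [hC, not_not]
      exact ⟨t, rfl⟩
    rw [hσ3 _ h1, hτ _ t rfl]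
  have hF1 := hreg.one_le
  -- The margin keeps the listed points off the extreme rows and columns, so the conventions there
  -- concern labelled points only.
  have hedge : ∀ t, Inner (w.2.2.2 t).1 ∧ Inner (w.2.2.2 t).2 := by
    intro t
    have h1 := hin t
    have b1 := (w.2.2.2 t).1.2
    have b2 := (w.2.2.2 t).2.2
    unfold Inner
    omega
  have hadm : Admissible σ C D R L z F := by
    refine ⟨hreg, hσ1, hσ2, ?_, ?_, ?_, ?_, ?_, ?_⟩
    · rw [hD, hC]
      refine ⟨?_, Or.inr (Or.inl rfl)⟩
      rintro ⟨t, ht⟩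
      exact hz t ht
    · intro i hi
      have h1 : ¬ Inner i := fun h => h.1 hi
      rw [hD, hC]
      refine ⟨?_, Or.inl h1⟩
      rintro ⟨t, rfl⟩
      exact h1 (hedge t).1
    · intro i hi
      have h1 : ¬ Inner i := fun h => h.2 hi
      rw [hD, hC]
      refine ⟨?_, Or.inl h1⟩
      rintro ⟨t, rfl⟩
      exact h1 (hedge t).1
    · intro i hi
      have h1 : ¬ Inner i := fun h => h.1 hi
      rw [hL, hR]
      refine ⟨?_, Or.inl h1⟩
      rintro ⟨t, rfl⟩
      exact h1 (hedge t).2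
    · intro i hi
      have h1 : ¬ Inner i := fun h => h.2 hi
      rw [hL, hR]
      refine ⟨?_, Or.inl h1⟩
      rintro ⟨t, rfl⟩
      exact h1 (hedge t).2
    · intro i hi
      obtain ⟨t, rfl⟩ := hof i hi
      rw [hσint]
      exact hin t
  have e1 := hadm.extCols_eq
  have e2 := hadm.lowerCols_eq
  have e3 := hadm.leftRows_eq
  have hext : ∀ i, IsExternal σ i ↔ i ∈ C := fun i => by rw [← e1, mem_extCols]
  refine ⟨σ, ⟨?_, ?_, hadm.z_row, hinj1, fun t => ⟨?_, hσint t⟩⟩, ?_⟩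
  · rintro i ⟨h1, h2, h3⟩
    rw [← mem_lowerCols, e2, hD, ← hext]
    tauto
  · rintro j ⟨h1, h2⟩
    rw [← mem_leftRows, e3, Equiv.apply_symm_apply, hL]
    rw [hext, ← hσ2, Equiv.apply_symm_apply] at h1
    tauto
  · rw [hext, hC, not_not]
    exact ⟨t, rfl⟩
  · have h1 : intCols σ = Cᶜ := by
      ext i
      rw [mem_intCols, hext]
      exact Finset.mem_compl.symm
    have := Finset.card_compl_add_card C
    rw [Fintype.card_fin] at this
    rw [h1]
    omega

theorem mem_ASq_iff {n k : ℕ} {σ : Equiv.Perm (Fin (n + k))} :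
    σ ∈ ASq n k ↔ (intCols σ).card = k := by
  have h1 : {i | ¬ IsExternal σ i}.ncard = (intCols σ).card := by
    rw [← Set.ncard_coe_finset]
    congr 1
    ext i
    simp
  have h2 : {i | IsExternal σ i}.ncard = (extCols σ).card := by
    rw [← Set.ncard_coe_finset]
    congr 1
    ext i
    simp
  have h3 : (extCols σ).card + (intCols σ).card = n + k := by
    rw [extCols, intCols, Finset.card_filter_add_card_filter_not]
    simp
  simp only [ASq, Set.mem_ofPred_eq, h1, h2]
  omega

end Words

/-! ### Integrals of Lipschitz functions against the two kinds of permuton. -/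

section WeakConvergence

/-- Extension of a function on the unit square to the plane. -/
noncomputable def planeExt (f : unitInterval × unitInterval → ℝ) (x y : ℝ) : ℝ :=
  f (projIcc (0 : ℝ) 1 zero_le_one x, projIcc (0 : ℝ) 1 zero_le_one y)

/-- The lower half of the boundary of the rectangle. -/
noncomputable def botFun (u x : ℝ) : ℝ := |u - x|

/-- The upper half of the boundary of the rectangle. -/
noncomputable def topFun (u x : ℝ) : ℝ := min (u + x) (2 - u - x)

theorem continuous_planeExt {f : unitInterval × unitInterval → ℝ} (hf : Continuous f) :
    Continuous fun p : ℝ × ℝ => planeExt f p.1 p.2 := by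
  unfold planeExt
  exact hf.comp ((continuous_projIcc.comp continuous_fst).prodMk
    (continuous_projIcc.comp continuous_snd))

theorem continuous_botFun : Continuous fun p : ℝ × ℝ => botFun p.1 p.2 := by
  unfold botFun
  fun_prop

theorem continuous_topFun : Continuous fun p : ℝ × ℝ => topFun p.1 p.2 := by
  unfold topFun
  fun_prop

theorem abs_planeExt_sub_le {f : unitInterval × unitInterval → ℝ} {K : NNReal}
    (hf : LipschitzWith K f) (x y x' y' : ℝ) :
    |planeExt f x y - planeExt f x' y'| ≤ K * (|x - x'| + |y - y'|) := by
  have h := hf.dist_le_mul (projIcc (0 : ℝ) 1 zero_le_one x, projIcc (0 : ℝ) 1 zero_le_one y)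
    (projIcc (0 : ℝ) 1 zero_le_one x', projIcc (0 : ℝ) 1 zero_le_one y')
  rw [Real.dist_eq, Prod.dist_eq] at h
  refine h.trans ?_
  have hx := (LipschitzWith.projIcc (zero_le_one' ℝ)).dist_le_mul x x'
  have hy := (LipschitzWith.projIcc (zero_le_one' ℝ)).dist_le_mul y y'
  rw [Real.dist_eq, NNReal.coe_one, one_mul] at hx hy
  gcongr
  refine max_le (hx.trans ?_) (hy.trans ?_)
  · linarith [abs_nonneg (y - y')]
  · linarith [abs_nonneg (x - x')]

theorem abs_botFun_sub_le (u x u' x' : ℝ) :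
    |botFun u x - botFun u' x'| ≤ |u - u'| + |x - x'| := by
  unfold botFun
  refine (abs_abs_sub_abs_le _ _).trans ?_
  have : u - x - (u' - x') = (u - u') - (x - x') := by ring
  rw [this]
  exact abs_sub _ _

theorem abs_topFun_sub_le (u x u' x' : ℝ) :
    |topFun u x - topFun u' x'| ≤ |u - u'| + |x - x'| := by
  unfold topFun
  refine (abs_min_sub_min_le_max _ _ _ _).trans (max_le ?_ ?_)
  · have : u + x - (u' + x') = (u - u') + (x - x') := by ring
    rw [this]
    exact abs_add_le _ _
  · have : 2 - u - x - (2 - u' - x') = -((u - u') + (x - x')) := by ring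
    rw [this, abs_neg]
    exact abs_add_le _ _

theorem volume_singleton_unitInterval (a : unitInterval) :
    (volume : Measure unitInterval) {a} = 0 := by
  rw [← Icc_self, volume_Icc_unitInterval]
  simp

theorem integral_segmentMeasure {f : unitInterval × unitInterval → ℝ} (hf : Continuous f)
    {g : ℝ → ℝ} (hg : Continuous g) (a b : ℝ) :
    ∫ p, f p ∂(segmentMeasure g a b) =
      2⁻¹ * ∫ x in {x : unitInterval | a ≤ (x : ℝ) ∧ (x : ℝ) ≤ b}, planeExt f x (g x) := by
  have hmeas : Continuous fun x : unitInterval => (x, projIcc (0 : ℝ) 1 zero_le_one (g x)) :=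
    continuous_id.prodMk (continuous_projIcc.comp (hg.comp continuous_subtype_val))
  rw [segmentMeasure, integral_smul_measure,
    integral_map hmeas.measurable.aemeasurable hf.aestronglyMeasurable]
  simp [planeExt]

theorem integrable_of_continuous_unitSquare {f : unitInterval × unitInterval → ℝ}
    (hf : Continuous f) (μ : Measure (unitInterval × unitInterval)) [IsFiniteMeasure μ] :
    Integrable f μ := by
  exact hf.integrable_of_hasCompactSupport (HasCompactSupport.of_compactSpace f)

theorem integrable_of_continuous_unitInterval {f : unitInterval → ℝ}
    (hf : Continuous f) (μ : Measure unitInterval) [IsFiniteMeasure μ] :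
    Integrable f μ := by
  exact hf.integrable_of_hasCompactSupport (HasCompactSupport.of_compactSpace f)

theorem setIntegral_split {f : unitInterval → ℝ} (hf : Continuous f) (c : unitInterval) :
    (∫ x in {x : unitInterval | (x : ℝ) ≤ c}, f x) +
      (∫ x in {x : unitInterval | (c : ℝ) ≤ x}, f x) =
      ∫ x, f x := by
  have h1 : ∫ x in {x : unitInterval | (c : ℝ) ≤ x}, f x =
      ∫ x in {x : unitInterval | (x : ℝ) ≤ c}ᶜ, f x := by
    refine setIntegral_congr_set ?_
    rw [ae_eq_set]
    constructor
    · refine measure_mono_null (t := {c}) ?_ (volume_singleton_unitInterval c)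
      rintro x ⟨h1, h2⟩
      rw [mem_compl_iff, not_not] at h2
      exact Subtype.ext (le_antisymm h2 h1)
    · convert measure_empty (μ := (volume : Measure unitInterval))
      rw [sdiff_eq_empty]
      intro x hx
      exact le_of_not_ge (show ¬ (x : ℝ) ≤ c from hx)
  rw [h1]
  have h2 : MeasurableSet {x : unitInterval | (x : ℝ) ≤ c} :=
    measurableSet_le measurable_subtype_coe measurable_const
  exact integral_add_compl h2 (integrable_of_continuous_unitInterval hf _)

instance isFiniteMeasure_segmentMeasure (g : ℝ → ℝ) (a b : ℝ) :
    IsFiniteMeasure (segmentMeasure g a b) := by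
  unfold segmentMeasure
  exact Measure.smul_finite _ (by simp)

/-- The four sides form the graphs of `botFun u` and `topFun u` over the unit interval, two sides
for each; the common abscissa of two such sides is a null set. -/
theorem integral_rectMeasure {f : unitInterval × unitInterval → ℝ} (hf : Continuous f)
    (u : unitInterval) :
    ∫ p, f p ∂(rectMeasure u) = 2⁻¹ * (∫ x : unitInterval, planeExt f x (botFun u x)) +
      2⁻¹ * ∫ x : unitInterval, planeExt f x (topFun u x) := by
  have hcb : Continuous fun x : unitInterval => planeExt f x (botFun u x) :=
    (continuous_planeExt hf).comp (continuous_subtype_val.prodMk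
      (continuous_botFun.comp (continuous_const.prodMk continuous_subtype_val)))
  have hct : Continuous fun x : unitInterval => planeExt f x (topFun u x) :=
    (continuous_planeExt hf).comp (continuous_subtype_val.prodMk
      (continuous_topFun.comp (continuous_const.prodMk continuous_subtype_val)))
  have hint := fun ν [IsFiniteMeasure ν] => integrable_of_continuous_unitSquare hf ν
  rw [rectMeasure, integral_add_measure (hint _) (hint _), integral_add_measure (hint _) (hint _),
    integral_add_measure (hint _) (hint _), integral_segmentMeasure hf (by fun_prop),
    integral_segmentMeasure hf (by fun_prop), integral_segmentMeasure hf (by fun_prop),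
    integral_segmentMeasure hf (by fun_prop), ← setIntegral_split hcb u,
    ← setIntegral_split hct (unitInterval.symm u)]
  have hu := u.2
  have e1 : ∫ x in {x : unitInterval | 0 ≤ (x : ℝ) ∧ (x : ℝ) ≤ u}, planeExt f x (u - x) =
      ∫ x in {x : unitInterval | (x : ℝ) ≤ u}, planeExt f x (botFun u x) := by
    have : {x : unitInterval | 0 ≤ (x : ℝ) ∧ (x : ℝ) ≤ u} = {x : unitInterval | (x : ℝ) ≤ u} := by
      ext x
      simp [x.2.1]
    rw [this]
    refine setIntegral_congr_fun (measurableSet_le measurable_subtype_coe measurable_const) ?_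
    intro x hx
    simp only [mem_ofPred_eq] at hx
    simp only [botFun]
    rw [abs_of_nonneg (by linarith)]
  have e2 : ∫ x in {x : unitInterval | (u : ℝ) ≤ (x : ℝ) ∧ (x : ℝ) ≤ 1}, planeExt f x (x - u) =
      ∫ x in {x : unitInterval | (u : ℝ) ≤ x}, planeExt f x (botFun u x) := by
    have : {x : unitInterval | (u : ℝ) ≤ (x : ℝ) ∧ (x : ℝ) ≤ 1} = {x : unitInterval | (u : ℝ) ≤ x} := by
      ext x
      simp [x.2.2]
    rw [this]
    refine setIntegral_congr_fun (measurableSet_le measurable_const measurable_subtype_coe) ?_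
    intro x hx
    simp only [mem_ofPred_eq] at hx
    simp only [botFun]
    rw [abs_of_nonpos (by linarith), neg_sub]
  have e3 : ∫ x in {x : unitInterval | 0 ≤ (x : ℝ) ∧ (x : ℝ) ≤ 1 - u}, planeExt f x (u + x) =
      ∫ x in {x : unitInterval | (x : ℝ) ≤ unitInterval.symm u}, planeExt f x (topFun u x) := by
    have : {x : unitInterval | 0 ≤ (x : ℝ) ∧ (x : ℝ) ≤ 1 - u} =
        {x : unitInterval | (x : ℝ) ≤ unitInterval.symm u} := by
      ext x
      simp [x.2.1]
    rw [this]
    refine setIntegral_congr_fun (measurableSet_le measurable_subtype_coe measurable_const) ?_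
    intro x hx
    simp only [mem_ofPred_eq, unitInterval.coe_symm_eq] at hx
    simp only [topFun]
    rw [min_eq_left (by linarith)]
  have e4 : ∫ x in {x : unitInterval | 1 - (u : ℝ) ≤ (x : ℝ) ∧ (x : ℝ) ≤ 1},
      planeExt f x (2 - u - x) =
      ∫ x in {x : unitInterval | (unitInterval.symm u : ℝ) ≤ x}, planeExt f x (topFun u x) := by
    have : {x : unitInterval | 1 - (u : ℝ) ≤ (x : ℝ) ∧ (x : ℝ) ≤ 1} =
        {x : unitInterval | (unitInterval.symm u : ℝ) ≤ x} := by
      ext x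
      simp only [mem_ofPred_eq, x.2.2, and_true, unitInterval.coe_symm_eq]
    rw [this]
    refine setIntegral_congr_fun (measurableSet_le measurable_const measurable_subtype_coe) ?_
    intro x hx
    simp only [mem_ofPred_eq, unitInterval.coe_symm_eq] at hx
    simp only [topFun]
    rw [min_eq_right (by linarith)]
  rw [e1, e2, e3, e4]
  ring

/-- Summation by parts, carried out by induction. -/
theorem abs_sum_mul_sub_le {A G : ℕ → ℝ} {B l : ℝ} (hA0 : A 0 = 0) (n : ℕ)
    (hA : ∀ t ≤ n, |A t| ≤ B) (hG : ∀ i, |G (i + 1) - G i| ≤ l) :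
    |∑ i ∈ Finset.range n, (A (i + 1) - A i) * G i - A n * G n| ≤ n * (B * l) := by
  induction n with
  | zero => simp [hA0]
  | succ n ih =>
    have h1 := ih fun t ht => hA t (by omega)
    have h2 : ∑ i ∈ Finset.range (n + 1), (A (i + 1) - A i) * G i - A (n + 1) * G (n + 1) =
        (∑ i ∈ Finset.range n, (A (i + 1) - A i) * G i - A n * G n) -
          A (n + 1) * (G (n + 1) - G n) := by
      rw [Finset.sum_range_succ]
      ring
    rw [h2]
    have h3 : |A (n + 1) * (G (n + 1) - G n)| ≤ B * l := by
      rw [abs_mul]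
      exact mul_le_mul (hA _ le_rfl) (hG n) (abs_nonneg _) ((abs_nonneg _).trans (hA _ le_rfl))
    refine (abs_sub _ _).trans ?_
    push_cast
    linarith

variable {N : ℕ}

theorem cnt_succ_sub (S : Finset (Fin N)) (i : Fin N) :
    (cnt S (i + 1) : ℝ) - cnt S i = if i ∈ S then 1 else 0 := by
  have h : cnt S (i + 1) = cnt S i + if i ∈ S then 1 else 0 := by
    have h1 : (if i ∈ S then 1 else 0) = ((S.filter fun j => j = i).card) := by
      by_cases hi : i ∈ S
      · rw [if_pos hi, Finset.filter_eq' S i, if_pos hi, Finset.card_singleton]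
      · rw [if_neg hi, Finset.filter_eq' S i, if_neg hi, Finset.card_empty]
    rw [h1]
    unfold cnt
    rw [← Finset.card_union_of_disjoint, ← Finset.filter_or]
    · congr 1
      refine Finset.filter_congr fun j _ => ?_
      rw [Fin.ext_iff]
      omega
    · refine Finset.disjoint_filter.2 fun j _ h2 h3 => ?_
      rw [h3] at h2
      exact lt_irrefl _ h2
  rw [h]
  push_cast
  split_ifs <;> ring

/-- Sums over a balanced set are close to half of the full sum. -/
theorem Balanced.abs_sum_sub_le {S : Finset (Fin N)} {E : ℤ} (hS : Balanced S E) {G : ℕ → ℝ}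
    {l M : ℝ} (hG : ∀ i, |G (i + 1) - G i| ≤ l) (hM : ∀ i, |G i| ≤ M) :
    |∑ i ∈ S, G i - 2⁻¹ * ∑ i : Fin N, G i| ≤ (E : ℝ) / 2 * (N * l + M) := by
  -- The discrepancy of the prefixes: its increments are the indicator of `S` minus one half, and it
  -- is bounded by `E / 2`.
  set A : ℕ → ℝ := fun t => (cnt S t : ℝ) - t / 2 with hA
  have hA0 : A 0 = 0 := by simp [hA, cnt]
  have hAE : ∀ t ≤ N, |A t| ≤ (E : ℝ) / 2 := by
    intro t ht
    have h := hS t ht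
    have h1 : ((|2 * (cnt S t : ℤ) - t| : ℤ) : ℝ) ≤ E := by exact_mod_cast h
    push_cast at h1
    have h2 : A t = (2 * (cnt S t : ℝ) - t) / 2 := by simp only [hA]; ring
    rw [h2, abs_div, abs_two]
    linarith
  have h1 := abs_sum_mul_sub_le hA0 N hAE hG
  have h2 : ∑ i ∈ Finset.range N, (A (i + 1) - A i) * G i =
      ∑ i ∈ S, G i - 2⁻¹ * ∑ i : Fin N, G i := by
    rw [Finset.sum_range, Finset.mul_sum, ← Finset.sum_filter_add_sum_filter_not Finset.univ
      (fun i => i ∈ S) (fun i : Fin N => 2⁻¹ * G i)]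
    rw [← Finset.sum_filter_add_sum_filter_not Finset.univ (fun i : Fin N => i ∈ S)]
    have e1 : Finset.univ.filter (fun i : Fin N => i ∈ S) = S := by simp
    have h3 : ∀ i : Fin N, A (i + 1) - A i = (if i ∈ S then 1 else 0) - 2⁻¹ := by
      intro i
      rw [← cnt_succ_sub S i]
      simp only [hA]
      push_cast
      ring
    rw [e1, ← sub_sub, ← Finset.sum_sub_distrib, sub_eq_add_neg, ← Finset.sum_neg_distrib]
    congr 1
    · refine Finset.sum_congr rfl fun i hi => ?_
      rw [h3, if_pos hi]
      ring
    · refine Finset.sum_congr rfl fun i hi => ?_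
      rw [h3, if_neg (by simpa using hi)]
      ring
  rw [h2] at h1
  have h3 : |A N * G N| ≤ (E : ℝ) / 2 * M := by
    rw [abs_mul]
    exact mul_le_mul (hAE N le_rfl) (hM N) (abs_nonneg _)
      ((abs_nonneg _).trans (hAE N le_rfl))
  calc _ = |(∑ i ∈ S, G i - 2⁻¹ * ∑ i : Fin N, G i - A N * G N) + A N * G N| := by
        rw [sub_add_cancel]
    _ ≤ N * ((E : ℝ) / 2 * l) + (E : ℝ) / 2 * M := (abs_add_le _ _).trans (add_le_add h1 h3)
    _ = _ := by ring

theorem real_volume_gridInterval (i : Fin N) :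
    (volume : Measure unitInterval).real (gridInterval N i) = 1 / N := by
  rw [Measure.real, volume_gridInterval, ENNReal.toReal_ofReal (by positivity)]

theorem abs_sub_le_of_mem_gridInterval {i : Fin N} {x : unitInterval} (hx : x ∈ gridInterval N i) :
    |(x : ℝ) - (i : ℝ) / N| ≤ 1 / N := by
  obtain ⟨h1, h2⟩ := hx
  rw [add_div] at h2
  rw [abs_le]
  have : (0 : ℝ) ≤ 1 / N := by positivity
  constructor <;> linarith

/-- Riemann sums of a Lipschitz function. -/
theorem abs_integral_sub_sum_le (hN : 0 < N) {g : ℝ → ℝ} {l : ℝ} (hgc : Continuous g)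
    (hl : ∀ x y, |g x - g y| ≤ l * |x - y|) (hl0 : 0 ≤ l) :
    |(∫ x : unitInterval, g x) - 1 / N * ∑ i : Fin N, g ((i : ℝ) / N)| ≤ l / N := by
  have hN' : (0 : ℝ) < N := by exact_mod_cast hN
  have hc : Continuous fun x : unitInterval => g x := hgc.comp continuous_subtype_val
  rw [← sum_restrict_gridInterval hN, integral_finsetSum_measure fun i _ =>
    integrable_of_continuous_unitInterval hc _, Finset.mul_sum, ← Finset.sum_sub_distrib]
  refine (Finset.abs_sum_le_sum_abs _ _).trans ?_
  have key : ∀ i : Fin N, |(∫ x in gridInterval N i, g x) - 1 / N * g ((i : ℝ) / N)| ≤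
      l * (1 / N) * (1 / N) := by
    intro i
    have h1 : (∫ x in gridInterval N i, g x) - 1 / N * g ((i : ℝ) / N) =
        ∫ x in gridInterval N i, (g x - g ((i : ℝ) / N)) := by
      rw [integral_sub (integrable_of_continuous_unitInterval hc _) (integrable_const _),
        setIntegral_const, real_volume_gridInterval, smul_eq_mul]
    rw [h1, ← Real.norm_eq_abs, ← real_volume_gridInterval i]
    refine norm_setIntegral_le_of_norm_le_const (measure_lt_top _ _) fun x hx => ?_
    rw [real_volume_gridInterval, Real.norm_eq_abs]
    exact (hl _ _).trans (mul_le_mul_of_nonneg_left (abs_sub_le_of_mem_gridInterval hx) hl0)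
  refine (Finset.sum_le_sum fun i _ => key i).trans (le_of_eq ?_)
  rw [Finset.sum_const, Finset.card_univ, Fintype.card_fin, nsmul_eq_mul]
  field_simp

theorem real_volume_grid_prod (i j : Fin N) :
    (volume : Measure (unitInterval × unitInterval)).real (gridInterval N i ×ˢ gridInterval N j) =
      1 / N * (1 / N) := by
  rw [Measure.volume_eq_prod, measureReal_prod_prod, real_volume_gridInterval,
    real_volume_gridInterval]

/-- Integrals against the permuton of a permutation are close to averages over its points. -/
theorem abs_integral_permMeasure_sub_le (hN : 0 < N) (σ : Equiv.Perm (Fin N))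
    {f : unitInterval × unitInterval → ℝ} {K : NNReal} (hf : LipschitzWith K f) :
    |(∫ p, f p ∂(permMeasure σ)) - 1 / N * ∑ i : Fin N, planeExt f ((i : ℝ) / N) ((σ i : ℝ) / N)| ≤
      2 * K / N := by
  have hN' : (0 : ℝ) < N := by exact_mod_cast hN
  have hint := fun ν [IsFiniteMeasure ν] => integrable_of_continuous_unitSquare hf.continuous ν
  rw [permMeasure, integral_smul_measure, integral_finsetSum_measure fun i _ => hint _,
    ENNReal.toReal_natCast, smul_eq_mul, Finset.mul_sum, Finset.mul_sum,
    ← Finset.sum_sub_distrib]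
  refine (Finset.abs_sum_le_sum_abs _ _).trans ?_
  have key : ∀ i : Fin N, |(N : ℝ) * (∫ p in gridInterval N i ×ˢ gridInterval N (σ i), f p) -
      1 / N * planeExt f ((i : ℝ) / N) ((σ i : ℝ) / N)| ≤ 2 * K / N * (1 / N) := by
    intro i
    set c := planeExt f ((i : ℝ) / N) ((σ i : ℝ) / N) with hc
    have h1 : (N : ℝ) * (∫ p in gridInterval N i ×ˢ gridInterval N (σ i), f p) - 1 / N * c =
        N * ∫ p in gridInterval N i ×ˢ gridInterval N (σ i), (f p - c) := by
      rw [integral_sub (hint _) (integrable_const _),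
        setIntegral_const, real_volume_grid_prod, smul_eq_mul]
      field_simp
    have h2 : ‖∫ p in gridInterval N i ×ˢ gridInterval N (σ i), (f p - c)‖ ≤
        2 * K / N * (volume : Measure (unitInterval × unitInterval)).real
          (gridInterval N i ×ˢ gridInterval N (σ i)) := by
      refine norm_setIntegral_le_of_norm_le_const (measure_lt_top _ _) ?_
      rintro ⟨x, y⟩ ⟨hx, hy⟩
      have h3 : f (x, y) = planeExt f x y := by simp [planeExt]
      rw [h3, Real.norm_eq_abs]
      refine (abs_planeExt_sub_le hf _ _ _ _).trans ?_
      have hx' := abs_sub_le_of_mem_gridInterval hx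
      have hy' := abs_sub_le_of_mem_gridInterval hy
      calc (K : ℝ) * (|(x : ℝ) - (i : ℝ) / N| + |(y : ℝ) - (σ i : ℝ) / N|)
          ≤ K * (1 / N + 1 / N) := by gcongr
        _ = _ := by ring
    rw [h1, abs_mul, abs_of_pos hN']
    rw [Real.norm_eq_abs, real_volume_grid_prod] at h2
    calc _ ≤ (N : ℝ) * (2 * K / N * (1 / N * (1 / N))) := by gcongr
      _ = _ := by field_simp
  refine (Finset.sum_le_sum fun i _ => key i).trans (le_of_eq ?_)
  rw [Finset.sum_const, Finset.card_univ, Fintype.card_fin, nsmul_eq_mul]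
  field_simp

end WeakConvergence

open scoped Topology

open Filter

/-! ### Convergence to the rectangle permuton from closeness to the rectangle. -/

section Limit

variable {N : ℕ}

theorem abs_planeExt_botFun_sub_le {f : unitInterval × unitInterval → ℝ} {K : NNReal}
    (hf : LipschitzWith K f) (u x y : ℝ) :
    |planeExt f x (botFun u x) - planeExt f y (botFun u y)| ≤ 2 * K * |x - y| := by
  refine (abs_planeExt_sub_le hf _ _ _ _).trans ?_
  have := abs_botFun_sub_le u x u y
  rw [sub_self, abs_zero, zero_add] at this
  calc (K : ℝ) * (|x - y| + |botFun u x - botFun u y|) ≤ K * (|x - y| + |x - y|) := by gcongr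
    _ = _ := by ring

theorem abs_planeExt_topFun_sub_le {f : unitInterval × unitInterval → ℝ} {K : NNReal}
    (hf : LipschitzWith K f) (u x y : ℝ) :
    |planeExt f x (topFun u x) - planeExt f y (topFun u y)| ≤ 2 * K * |x - y| := by
  refine (abs_planeExt_sub_le hf _ _ _ _).trans ?_
  have := abs_topFun_sub_le u x u y
  rw [sub_self, abs_zero, zero_add] at this
  calc (K : ℝ) * (|x - y| + |topFun u x - topFun u y|) ≤ K * (|x - y| + |x - y|) := by gcongr
    _ = _ := by ring

/-- The average of a Lipschitz function over points close to a curve, above a balanced set of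
columns, is close to half of the integral along the curve. -/
theorem Balanced.abs_avg_sub_integral_le (hN : 0 < N) {S : Finset (Fin N)} {E : ℤ}
    (hS : Balanced S E) {f : unitInterval × unitInterval → ℝ} {K : NNReal}
    (hf : LipschitzWith K f) {M : ℝ} (hM : ∀ p, |f p| ≤ M) {h : ℝ → ℝ} (hc : Continuous h)
    (hh : ∀ x y, |planeExt f x (h x) - planeExt f y (h y)| ≤ 2 * K * |x - y|)
    (s : Fin N → ℝ) {δ : ℝ} (hs : ∀ i ∈ S, |s i - h ((i : ℝ) / N)| ≤ δ) (hδ : 0 ≤ δ) :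
    |1 / N * ∑ i ∈ S, planeExt f ((i : ℝ) / N) (s i) -
        2⁻¹ * ∫ x : unitInterval, planeExt f x (h x)| ≤
      K * δ + E * (2 * K + M) / (2 * N) + K / N := by
  have hN' : (0 : ℝ) < N := by exact_mod_cast hN
  have h1 : |∑ i ∈ S, planeExt f ((i : ℝ) / N) (s i) -
      ∑ i ∈ S, planeExt f ((i : ℝ) / N) (h ((i : ℝ) / N))| ≤ N * (K * δ) := by
    rw [← Finset.sum_sub_distrib]
    refine (Finset.abs_sum_le_sum_abs _ _).trans ?_
    have : ∀ i ∈ S, |planeExt f ((i : ℝ) / N) (s i) -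
        planeExt f ((i : ℝ) / N) (h ((i : ℝ) / N))| ≤ K * δ := by
      intro i hi
      refine (abs_planeExt_sub_le hf _ _ _ _).trans ?_
      rw [sub_self, abs_zero, zero_add]
      exact mul_le_mul_of_nonneg_left (hs i hi) K.2
    refine (Finset.sum_le_sum this).trans ?_
    rw [Finset.sum_const, nsmul_eq_mul]
    have hcard : (S.card : ℝ) ≤ N := by
      exact_mod_cast (Finset.card_le_univ S).trans (by simp)
    have hK := K.2
    gcongr
  have h2 := hS.abs_sum_sub_le (G := fun i => planeExt f ((i : ℝ) / N) (h ((i : ℝ) / N)))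
    (l := 2 * K / N) (M := M)
    (fun i => by
      refine (hh _ _).trans ?_
      have : (((i + 1 : ℕ) : ℝ) / N - (i : ℝ) / N) = 1 / N := by
        push_cast
        ring
      rw [this, abs_of_nonneg (by positivity)]
      exact le_of_eq (by ring))
    (fun i => hM _)
  have h3 := abs_integral_sub_sum_le hN (g := fun x => planeExt f x (h x)) (l := 2 * K)
    ((continuous_planeExt hf.continuous).comp (continuous_id.prodMk hc)) hh (by positivity)
  set I := ∫ x : unitInterval, planeExt f x (h x)
  set a := ∑ i ∈ S, planeExt f ((i : ℝ) / N) (s i)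
  set b := ∑ i ∈ S, planeExt f ((i : ℝ) / N) (h ((i : ℝ) / N))
  set c := ∑ i : Fin N, planeExt f ((i : ℝ) / N) (h ((i : ℝ) / N))
  -- Three errors: moving the points onto the curve, replacing `S` by half of all columns, and the
  -- Riemann sum.
  have e : 1 / N * a - 2⁻¹ * I =
      1 / N * (a - b) + 1 / N * (b - 2⁻¹ * c) - 2⁻¹ * (I - 1 / N * c) := by ring
  rw [e]
  have hNN : (N : ℝ) * (2 * K / N) = 2 * K := by field_simp
  rw [hNN] at h2
  have a1 : |1 / N * (a - b)| ≤ K * δ := by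
    rw [abs_mul, abs_of_pos (by positivity : (0 : ℝ) < 1 / N)]
    calc _ ≤ 1 / (N : ℝ) * (N * (K * δ)) := by gcongr
      _ = _ := by field_simp
  have a2 : |1 / N * (b - 2⁻¹ * c)| ≤ E * (2 * K + M) / (2 * N) := by
    rw [abs_mul, abs_of_pos (by positivity : (0 : ℝ) < 1 / N)]
    calc _ ≤ 1 / (N : ℝ) * ((E : ℝ) / 2 * (2 * K + M)) := by gcongr
      _ = _ := by field_simp
  have a3 : |2⁻¹ * (I - 1 / N * c)| ≤ K / N := by
    rw [abs_mul, abs_of_pos (by norm_num : (0 : ℝ) < 2⁻¹)]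
    calc _ ≤ 2⁻¹ * (2 * (K : ℝ) / N) := by gcongr
      _ = _ := by ring
  refine (abs_sub _ _).trans ?_
  have := abs_add_le (1 / N * (a - b)) (1 / N * (b - 2⁻¹ * c))
  linarith

/-- Permutations close to a rectangle have a permuton close to the rectangle permuton. -/
theorem abs_integral_permMeasure_sub_rectMeasure_le (hN : 0 < N) (σ : Equiv.Perm (Fin N))
    {C D : Finset (Fin N)} {E : ℤ} (hDC : D ⊆ C) (hD : Balanced D E) (hU : Balanced (C \ D) E)
    {f : unitInterval × unitInterval → ℝ} {K : NNReal} (hf : LipschitzWith K f) {M : ℝ}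
    (hM : ∀ p, |f p| ≤ M) (u : unitInterval) {δ : ℝ} (hδ : 0 ≤ δ)
    (hDs : ∀ i ∈ D, |(σ i : ℝ) / N - botFun u ((i : ℝ) / N)| ≤ δ)
    (hUs : ∀ i ∈ C \ D, |(σ i : ℝ) / N - topFun u ((i : ℝ) / N)| ≤ δ) :
    |(∫ p, f p ∂(permMeasure σ)) - ∫ p, f p ∂(rectMeasure u)| ≤
      2 * K * δ + (4 * K + Cᶜ.card * M + E * (2 * K + M)) * (1 / N) := by
  have hN' : (0 : ℝ) < N := by exact_mod_cast hN
  have h1 := abs_integral_permMeasure_sub_le hN σ hf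
  have h2 := hD.abs_avg_sub_integral_le hN hf hM (h := botFun u)
    (continuous_botFun.comp (continuous_const.prodMk continuous_id))
    (abs_planeExt_botFun_sub_le hf u) (fun i => (σ i : ℝ) / N) hDs hδ
  have h3 := hU.abs_avg_sub_integral_le hN hf hM (h := topFun u)
    (continuous_topFun.comp (continuous_const.prodMk continuous_id))
    (abs_planeExt_topFun_sub_le hf u) (fun i => (σ i : ℝ) / N) hUs hδ
  have h4 : |∑ i ∈ Cᶜ, planeExt f ((i : ℝ) / N) ((σ i : ℝ) / N)| ≤ Cᶜ.card * M := by
    refine (Finset.abs_sum_le_sum_abs _ _).trans ?_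
    refine (Finset.sum_le_sum fun i _ => hM _).trans ?_
    rw [Finset.sum_const, nsmul_eq_mul]
  rw [integral_rectMeasure hf.continuous]
  have hsum : ∑ i : Fin N, planeExt f ((i : ℝ) / N) ((σ i : ℝ) / N) =
      ∑ i ∈ D, planeExt f ((i : ℝ) / N) ((σ i : ℝ) / N) +
      ∑ i ∈ C \ D, planeExt f ((i : ℝ) / N) ((σ i : ℝ) / N) +
      ∑ i ∈ Cᶜ, planeExt f ((i : ℝ) / N) ((σ i : ℝ) / N) := by
    rw [add_comm (∑ i ∈ D, _), Finset.sum_sdiff hDC, Finset.sum_add_sum_compl]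
  rw [hsum] at h1
  set A := ∑ i ∈ D, planeExt f ((i : ℝ) / N) ((σ i : ℝ) / N)
  set B := ∑ i ∈ C \ D, planeExt f ((i : ℝ) / N) ((σ i : ℝ) / N)
  set G := ∑ i ∈ Cᶜ, planeExt f ((i : ℝ) / N) ((σ i : ℝ) / N)
  set I := ∫ p, f p ∂(permMeasure σ)
  set I1 := ∫ x : unitInterval, planeExt f x (botFun u x)
  set I2 := ∫ x : unitInterval, planeExt f x (topFun u x)
  have h5 : |1 / N * G| ≤ Cᶜ.card * M * (1 / N) := by
    rw [abs_mul, abs_of_pos (by positivity : (0 : ℝ) < 1 / N), mul_comm]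
    gcongr
  have e : I - (2⁻¹ * I1 + 2⁻¹ * I2) = (I - 1 / N * (A + B + G)) + (1 / N * A - 2⁻¹ * I1) +
      (1 / N * B - 2⁻¹ * I2) + 1 / N * G := by ring
  rw [e]
  have t1 := abs_add_le (I - 1 / N * (A + B + G) + (1 / N * A - 2⁻¹ * I1) +
    (1 / N * B - 2⁻¹ * I2)) (1 / N * G)
  have t2 := abs_add_le (I - 1 / N * (A + B + G) + (1 / N * A - 2⁻¹ * I1))
    (1 / N * B - 2⁻¹ * I2)
  have t3 := abs_add_le (I - 1 / N * (A + B + G)) (1 / N * A - 2⁻¹ * I1)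
  have r1 : 2 * (K : ℝ) / N = 2 * K * (1 / N) := by ring
  have r2 : (E : ℝ) * (2 * K + M) / (2 * N) = E * (2 * K + M) / 2 * (1 / N) := by
    field_simp
  have r3 : (K : ℝ) / N = K * (1 / N) := by ring
  rw [r1] at h1
  rw [r2, r3] at h2 h3
  linarith

/-- Permutons carry the subspace topology, and weak convergence is tested on bounded Lipschitz
functions. -/
theorem tendsto_permuton_iff {ι : Type*} {F : Filter ι} [F.IsCountablyGenerated]
    {μs : ι → Permuton} {μ : Permuton} :
    Tendsto μs F (𝓝 μ) ↔ ∀ f : unitInterval × unitInterval → ℝ,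
      (∃ C : ℝ, ∀ x y, dist (f x) (f y) ≤ C) → (∃ L, LipschitzWith L f) →
        Tendsto (fun i => ∫ p, f p ∂((μs i).1 : Measure (unitInterval × unitInterval))) F
          (𝓝 (∫ p, f p ∂(μ.1 : Measure (unitInterval × unitInterval)))) := by
  rw [← tendsto_iff_forall_lipschitz_integral_tendsto]
  exact tendsto_subtype_rng

theorem exists_abs_le_of_dist_le {f : unitInterval × unitInterval → ℝ}
    (h : ∃ C : ℝ, ∀ x y, dist (f x) (f y) ≤ C) : ∃ M, ∀ p, |f p| ≤ M := by
  obtain ⟨C, hC⟩ := h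
  refine ⟨C + |f (0, 0)|, fun p => ?_⟩
  have h1 := hC p (0, 0)
  rw [Real.dist_eq] at h1
  have h2 := abs_add_le (f p - f (0, 0)) (f (0, 0))
  rw [sub_add_cancel] at h2
  linarith

theorem continuous_rectPermuton : Continuous rectPermuton := by
  rw [continuous_iff_continuousAt]
  intro z
  refine tendsto_permuton_iff.2 fun f hb hL => ?_
  obtain ⟨K, hf⟩ := hL
  obtain ⟨M, hM⟩ := exists_abs_le_of_dist_le hb
  have h1 : ∀ w : unitInterval,
      ∫ p, f p ∂((rectPermuton w).1 : Measure (unitInterval × unitInterval)) =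
      2⁻¹ * (∫ x : unitInterval, planeExt f x (botFun w x)) +
      2⁻¹ * ∫ x : unitInterval, planeExt f x (topFun w x) :=
    fun w => integral_rectMeasure hf.continuous w
  simp_rw [h1]
  have key : ∀ h : ℝ × ℝ → ℝ, Continuous h →
      Continuous fun w : unitInterval => ∫ x : unitInterval, planeExt f x (h (w, x)) := by
    intro h hh
    refine continuous_of_dominated (bound := fun _ => M) (fun w => ?_) (fun w => ?_)
      (integrable_const _) ?_
    · refine Continuous.aestronglyMeasurable ?_
      exact (continuous_planeExt hf.continuous).comp (continuous_subtype_val.prodMk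
        (hh.comp (continuous_const.prodMk continuous_subtype_val)))
    · exact Eventually.of_forall fun x => hM _
    · refine Eventually.of_forall fun x => ?_
      exact (continuous_planeExt hf.continuous).comp (continuous_const.prodMk
        (hh.comp (continuous_subtype_val.prodMk continuous_const)))
  exact (((key _ continuous_botFun).const_mul _).add
    ((key _ continuous_topFun).const_mul _)).tendsto z

/-- Convergence of permutons of permutations that are close to a rectangle. -/
theorem tendsto_permPermuton {N : ℕ → ℕ} (hN : ∀ n, 0 < N n) (hNtop : Tendsto N atTop atTop)
    (σ : ∀ n, Equiv.Perm (Fin (N n))) (u : unitInterval) {E : ℕ → ℤ} {δ : ℕ → ℝ} {k : ℕ}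
    (hE : Tendsto (fun n => (E n : ℝ) / N n) atTop (𝓝 0)) (hδ : Tendsto δ atTop (𝓝 0))
    (h : ∀ᶠ n in atTop, 0 ≤ δ n ∧ ∃ C D : Finset (Fin (N n)), D ⊆ C ∧ Balanced D (E n) ∧
      Balanced (C \ D) (E n) ∧ Cᶜ.card ≤ k ∧
      (∀ i ∈ D, |(σ n i : ℝ) / N n - botFun u ((i : ℝ) / N n)| ≤ δ n) ∧
      (∀ i ∈ C \ D, |(σ n i : ℝ) / N n - topFun u ((i : ℝ) / N n)| ≤ δ n)) :
    Tendsto (fun n => permPermuton (hN n) (σ n)) atTop (𝓝 (rectPermuton u)) := by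
  refine tendsto_permuton_iff.2 fun f hb hL => ?_
  obtain ⟨K, hf⟩ := hL
  obtain ⟨M, hM⟩ := exists_abs_le_of_dist_le hb
  have hM0 : 0 ≤ M := (abs_nonneg _).trans (hM (0, 0))
  have hinv : Tendsto (fun n => 1 / (N n : ℝ)) atTop (𝓝 0) :=
    tendsto_one_div_atTop_nhds_zero_nat.comp hNtop
  have hlim : Tendsto (fun n => 2 * K * δ n + ((4 * K + k * M) * (1 / (N n : ℝ)) +
      (E n : ℝ) / N n * (2 * K + M))) atTop (𝓝 0) := by
    have := (hδ.const_mul (2 * (K : ℝ))).add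
      ((hinv.const_mul (4 * (K : ℝ) + k * M)).add (hE.mul_const (2 * (K : ℝ) + M)))
    simpa using this
  rw [tendsto_iff_dist_tendsto_zero]
  refine squeeze_zero' (Eventually.of_forall fun n => dist_nonneg) ?_ hlim
  filter_upwards [h] with n hn
  obtain ⟨hδ0, C, D, hDC, hD, hU, hc, hDs, hUs⟩ := hn
  rw [Real.dist_eq]
  refine (abs_integral_permMeasure_sub_rectMeasure_le (hN n) (σ n) hDC hD hU hf hM u hδ0 hDs
    hUs).trans ?_
  have hc' : (Cᶜ.card : ℝ) ≤ k := by exact_mod_cast hc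
  have hN' : (0 : ℝ) < N n := by exact_mod_cast hN n
  calc _ ≤ 2 * K * δ n + (4 * K + k * M + E n * (2 * K + M)) * (1 / N n) := by gcongr
    _ = _ := by ring

end Limit

/-! ### Asymptotics of the words of one typical sample point. -/

section Deterministic

/-- The index of the cell of the grid of mesh `1 / N` that contains `t`. -/
noncomputable def cell {N : ℕ} (hN : 0 < N) (t : ℝ) : Fin N :=
  ⟨min ⌊t * N⌋₊ (N - 1), by omega⟩

theorem cell_val {N : ℕ} (hN : 0 < N) {t : ℝ} (ht : t ∈ Ioo (0 : ℝ) 1) :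
    (cell hN t : ℕ) = ⌊t * N⌋₊ := by
  have hN' : (0 : ℝ) < N := by exact_mod_cast hN
  have h : ⌊t * N⌋₊ < N := by
    rw [Nat.floor_lt (mul_nonneg ht.1.le hN'.le)]
    nlinarith [ht.2]
  simp only [cell]
  omega

theorem tendsto_cast_add (k : ℕ) : Tendsto (fun n : ℕ => ((n + k : ℕ) : ℝ)) atTop atTop :=
  tendsto_natCast_atTop_atTop.comp (tendsto_add_atTop_nat k)

theorem tendsto_cell {k : ℕ} (hN : ∀ n, 0 < n + k) {t : ℝ} (ht : t ∈ Ioo (0 : ℝ) 1) :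
    Tendsto (fun n => ((cell (hN n) t : ℕ) : ℝ) / (n + k : ℕ)) atTop (𝓝 t) := by
  have h := (tendsto_nat_floor_mul_div_atTop ht.1.le).comp (tendsto_cast_add k)
  refine h.congr fun n => ?_
  rw [cell_val (hN n) ht]
  rfl

theorem eventually_lt_of_tendsto_div {k : ℕ} (hN : ∀ n, 0 < n + k) {a b : ℕ → ℤ} {α β : ℝ}
    (ha : Tendsto (fun n => (a n : ℝ) / (n + k : ℕ)) atTop (𝓝 α))
    (hb : Tendsto (fun n => (b n : ℝ) / (n + k : ℕ)) atTop (𝓝 β)) (h : α < β) :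
    ∀ᶠ n in atTop, a n < b n := by
  filter_upwards [ha.eventually_lt hb h] with n hn
  have : (0 : ℝ) < (n + k : ℕ) := by exact_mod_cast hN n
  rw [div_lt_div_iff_of_pos_right this] at hn
  exact_mod_cast hn

/-- Number of labels `true` among the first `t` ones. -/
noncomputable def trueCount (x : ℕ → Bool) (t : ℕ) : ℕ :=
  ((Finset.range t).filter fun i => x i = true).card

/-- Largest imbalance of the prefixes of length at most `N`. -/
noncomputable def imbalance (x : ℕ → Bool) (N : ℕ) : ℕ :=
  (Finset.range (N + 1)).sup fun t => (2 * (trueCount x t : ℤ) - t).natAbs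

theorem cnt_trueSet {N : ℕ} (x : ℕ → Bool) {t : ℕ} (ht : t ≤ N) :
    cnt (trueSet fun i : Fin N => x i) t = trueCount x t := by
  unfold cnt trueCount
  refine Finset.card_bij (fun i _ => (i : ℕ)) ?_ (fun a _ b _ h => Fin.ext h) ?_
  · intro i hi
    rw [Finset.mem_filter, mem_trueSet] at hi
    rw [Finset.mem_filter, Finset.mem_range]
    exact ⟨hi.2, hi.1⟩
  · intro j hj
    rw [Finset.mem_filter, Finset.mem_range] at hj
    refine ⟨⟨j, by omega⟩, ?_, rfl⟩
    rw [Finset.mem_filter, mem_trueSet]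
    exact ⟨hj.2, hj.1⟩

theorem balanced_trueSet {N : ℕ} (x : ℕ → Bool) :
    Balanced (trueSet fun i : Fin N => x i) (imbalance x N) := by
  intro t ht
  rw [cnt_trueSet x ht]
  have := Finset.le_sup (f := fun t => (2 * (trueCount x t : ℤ) - t).natAbs)
    (Finset.mem_range.2 (by omega : t < N + 1))
  rw [Int.abs_eq_natAbs]
  exact Int.ofNat_le.2 this

/-- A maximum attained early is bounded by a constant; one attained late at `t` is at most `ε / 2 *
t`, hence at most `ε / 2 * N`. -/
theorem tendsto_sup_div {b : ℕ → ℕ} (hb : Tendsto (fun t => (b t : ℝ) / t) atTop (𝓝 0)) :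
    Tendsto (fun N => (((Finset.range (N + 1)).sup b : ℕ) : ℝ) / N) atTop (𝓝 0) := by
  rw [Metric.tendsto_atTop] at hb ⊢
  intro ε hε
  obtain ⟨T, hT⟩ := hb (ε / 2) (by positivity)
  set C := (Finset.range (T + 1)).sup b with hC
  obtain ⟨M, hM⟩ := exists_nat_gt (2 * (C : ℝ) / ε)
  refine ⟨max M 1, fun N hN => ?_⟩
  have hN1 : 1 ≤ N := le_trans (le_max_right _ _) hN
  have hNM : (M : ℝ) ≤ N := by exact_mod_cast le_trans (le_max_left _ _) hN
  have hN' : (0 : ℝ) < N := by exact_mod_cast hN1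
  have hlt : 2 * (C : ℝ) / ε < N := lt_of_lt_of_le hM hNM
  rw [div_lt_iff₀ hε] at hlt
  have key : (((Finset.range (N + 1)).sup b : ℕ) : ℝ) ≤ ε / 2 * N := by
    obtain ⟨t, ht, hmax⟩ := Finset.exists_mem_eq_sup (Finset.range (N + 1)) ⟨0, by simp⟩ b
    rw [hmax]
    rcases lt_or_ge t T with h1 | h1
    · have h2 : b t ≤ C := Finset.le_sup (f := b) (Finset.mem_range.2 (by omega))
      have h3 : (b t : ℝ) ≤ C := by exact_mod_cast h2
      linarith
    -- The hypothesis says nothing about `b 0`, as division by zero gives zero; this value is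
    -- covered by `C`.
    · rcases Nat.eq_zero_or_pos t with h0 | h0
      · have h2 : b t ≤ C := Finset.le_sup (f := b) (Finset.mem_range.2 (by omega))
        have h3 : (b t : ℝ) ≤ C := by exact_mod_cast h2
        linarith
      · have h2 := hT t h1
        have ht' : (0 : ℝ) < t := by exact_mod_cast h0
        rw [Real.dist_eq, sub_zero, abs_of_nonneg (by positivity), div_lt_iff₀ ht'] at h2
        have h3 : (t : ℝ) ≤ N := by
          have := Finset.mem_range.1 ht
          exact_mod_cast (by omega : t ≤ N)
        have h4 : ε / 2 * t ≤ ε / 2 * N := by gcongr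
        linarith
  rw [Real.dist_eq, sub_zero, abs_of_nonneg (by positivity), div_lt_iff₀ hN']
  nlinarith

/-- A frequency tending to one half makes the imbalance of the prefixes sublinear, uniformly over
prefixes. -/
theorem tendsto_imbalance_div {x : ℕ → Bool}
    (hx : Tendsto (fun n => (trueCount x n : ℝ) / n) atTop (𝓝 2⁻¹)) :
    Tendsto (fun N => (imbalance x N : ℝ) / N) atTop (𝓝 0) := by
  refine tendsto_sup_div ?_
  have h1 : Tendsto (fun n : ℕ => |2 * ((trueCount x n : ℝ) / n) - 1|) atTop (𝓝 0) := by
    have := ((hx.const_mul 2).sub_const 1).abs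
    simpa using this
  refine h1.congr' ?_
  filter_upwards [eventually_gt_atTop 0] with n hn
  have hn' : (0 : ℝ) < n := by exact_mod_cast hn
  have h2 : (((2 * (trueCount x n : ℤ) - n).natAbs : ℕ) : ℝ) = |2 * (trueCount x n : ℝ) - n| := by
    rw [Nat.cast_natAbs]
    push_cast
    rfl
  rw [h2, eq_div_iff hn'.ne', ← abs_of_pos hn', ← abs_mul, abs_of_pos hn']
  congr 1
  field_simp

/-- Sample points: two sequences of labels, a corner position and `k` points of the plane. -/
abbrev Sample (k : ℕ) : Type := (ℕ → Bool) × (ℕ → Bool) × ℝ × (Fin k → ℝ × ℝ)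

/-- The word of size `N` read off from a sample point. -/
noncomputable def wordOf {N k : ℕ} (hN : 0 < N) (s : Sample k) : Word N k :=
  (fun i => s.1 i, fun i => s.2.1 i, cell hN s.2.2.1,
    fun t => (cell hN (s.2.2.2 t).1, cell hN (s.2.2.2 t).2))

/-- The open rectangle with corners `(u,0)`, `(0,u)`, `(1-u,1)`, `(1,1-u)`. -/
def openRect (u : ℝ) : Set (ℝ × ℝ) :=
  {p | u < p.1 + p.2 ∧ p.1 + p.2 < 2 - u ∧ -u < p.2 - p.1 ∧ p.2 - p.1 < u}

/-- The almost sure properties of sample points that are used. -/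
structure Typical {k : ℕ} (s : Sample k) : Prop where
  col : Tendsto (fun n => (trueCount s.1 n : ℝ) / n) atTop (𝓝 2⁻¹)
  row : Tendsto (fun n => (trueCount s.2.1 n : ℝ) / n) atTop (𝓝 2⁻¹)
  u_mem : s.2.2.1 ∈ Ioo (0 : ℝ) 1
  p_mem : ∀ t, (s.2.2.2 t).1 ∈ Ioo (0 : ℝ) 1 ∧ (s.2.2.2 t).2 ∈ Ioo (0 : ℝ) 1
  ne_u : ∀ t, (s.2.2.2 t).1 ≠ s.2.2.1
  ne_fst : ∀ t t', t ≠ t' → (s.2.2.2 t).1 ≠ (s.2.2.2 t').1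
  ne_snd : ∀ t t', t ≠ t' → (s.2.2.2 t).2 ≠ (s.2.2.2 t').2
  off_sides : ∀ t, (s.2.2.2 t).1 + (s.2.2.2 t).2 ≠ s.2.2.1 ∧
    (s.2.2.2 t).1 + (s.2.2.2 t).2 ≠ 2 - s.2.2.1 ∧
    (s.2.2.2 t).2 - (s.2.2.2 t).1 ≠ -s.2.2.1 ∧ (s.2.2.2 t).2 - (s.2.2.2 t).1 ≠ s.2.2.1

/-- Bound for the imbalance of all the label sets. -/
noncomputable def errorBound {k : ℕ} (s : Sample k) (N : ℕ) : ℤ :=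
  ((imbalance s.1 N : ℤ) + imbalance s.2.1 N) + 2 * (k + 3)

theorem Typical.tendsto_errorBound {k : ℕ} {s : Sample k} (hs : Typical s) :
    Tendsto (fun n => (errorBound s (n + k) : ℝ) / (n + k : ℕ)) atTop (𝓝 0) := by
  have h1 := (tendsto_imbalance_div hs.col).comp (tendsto_add_atTop_nat k)
  have h2 := (tendsto_imbalance_div hs.row).comp (tendsto_add_atTop_nat k)
  have h3 : Tendsto (fun n : ℕ => (2 * ((k : ℝ) + 3)) / (n + k : ℕ)) atTop (𝓝 0) :=
    tendsto_const_nhds.div_atTop (tendsto_cast_add k)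
  have h4 := (h1.add h2).add h3
  simp only [add_zero] at h4
  refine h4.congr fun n => ?_
  simp only [Function.comp, errorBound]
  push_cast
  ring

theorem Typical.eventually_size {k : ℕ} {s : Sample k} (hs : Typical s)
    (hN : ∀ n, 0 < n + k) :
    ∀ᶠ n in atTop, 2 ≤ n + k ∧ 100 * errorBound s (n + k) < (cell (hN n) s.2.2.1 : ℕ) ∧
      ((cell (hN n) s.2.2.1 : ℕ) : ℤ) + 100 * errorBound s (n + k) < (n + k : ℕ) := by
  have hz := tendsto_cell hN hs.u_mem
  have hE := hs.tendsto_errorBound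
  have hE' : Tendsto (fun n => ((100 * errorBound s (n + k) : ℤ) : ℝ) / (n + k : ℕ)) atTop
      (𝓝 0) := by
    have := hE.const_mul 100
    rw [mul_zero] at this
    refine this.congr fun n => ?_
    push_cast
    ring
  have h1 : Tendsto (fun n : ℕ => (((n + k : ℕ) : ℤ) : ℝ) / (n + k : ℕ)) atTop (𝓝 1) := by
    refine tendsto_const_nhds.congr fun n => ?_
    have : ((n + k : ℕ) : ℝ) ≠ 0 := by exact_mod_cast (hN n).ne'
    rw [Int.cast_natCast, div_self this]
  have hzE : Tendsto (fun n => ((((cell (hN n) s.2.2.1 : ℕ) : ℤ) + 100 * errorBound s (n + k) :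
      ℤ) : ℝ) / (n + k : ℕ)) atTop (𝓝 s.2.2.1) := by
    have := hz.add hE'
    rw [add_zero] at this
    refine this.congr fun n => ?_
    push_cast
    ring
  filter_upwards [eventually_ge_atTop 2,
    eventually_lt_of_tendsto_div hN (b := fun n => ((cell (hN n) s.2.2.1 : ℕ) : ℤ)) hE'
      (by simpa using hz) hs.u_mem.1,
    eventually_lt_of_tendsto_div hN hzE h1 hs.u_mem.2] with n a1 a2 a3
  exact ⟨by omega, a2, a3⟩

theorem Compat.regular_of_sample {N k : ℕ} (hN : 0 < N) {s : Sample k} {σ : Equiv.Perm (Fin N)}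
    (h : Compat (wordOf hN s) σ) (hk : (intCols σ).card = k) (h2 : 2 ≤ N)
    (hlo : 100 * errorBound s N < (cell hN s.2.2.1 : ℕ))
    (hhi : ((cell hN s.2.2.1 : ℕ) : ℤ) + 100 * errorBound s N < N) :
    Regular (extCols σ) (lowerCols σ) (extRows σ) (leftRows σ) (cell hN s.2.2.1)
      (errorBound s N) := by
  refine h.regular hk (E := (imbalance s.1 N : ℤ) + imbalance s.2.1 N) ?_ ?_ ?_ h2 hlo hhi
  · exact (balanced_trueSet s.1).mono (by omega)
  · exact (balanced_trueSet s.2.1).mono (by omega)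
  · positivity

/-- The inequalities defining the open rectangle are strict, so after scaling by the size they
absorb the sublinear margins; distinct coordinates eventually lie in distinct cells. -/
theorem Typical.eventually_exists_compat {k : ℕ} {s : Sample k} (hs : Typical s)
    (hN : ∀ n, 0 < n + k) (hin : ∀ t, s.2.2.2 t ∈ openRect s.2.2.1) :
    ∀ᶠ n in atTop, ∃ σ : Equiv.Perm (Fin (n + k)),
      Compat (wordOf (hN n) s) σ ∧ (intCols σ).card = k := by
  have hz := tendsto_cell hN hs.u_mem
  have hp1 := fun t => tendsto_cell hN (hs.p_mem t).1
  have hp2 := fun t => tendsto_cell hN (hs.p_mem t).2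
  have hE := hs.tendsto_errorBound
  have cast_eq : ∀ (n : ℕ) (i : Fin (n + k)), (((i : ℕ) : ℤ) : ℝ) / (n + k : ℕ) =
      ((i : ℕ) : ℝ) / (n + k : ℕ) := fun n i => by rw [Int.cast_natCast]
  have hne : ∀ a b : ℝ, a ∈ Ioo (0 : ℝ) 1 → b ∈ Ioo (0 : ℝ) 1 → a ≠ b →
      ∀ᶠ n in atTop, cell (hN n) a ≠ cell (hN n) b := by
    intro a b ha hb hab
    rcases lt_or_gt_of_ne hab with h | h
    · filter_upwards [(tendsto_cell hN ha).eventually_lt (tendsto_cell hN hb) h] with n hn heq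
      rw [heq] at hn
      exact lt_irrefl _ hn
    · filter_upwards [(tendsto_cell hN hb).eventually_lt (tendsto_cell hN ha) h] with n hn heq
      rw [heq] at hn
      exact lt_irrefl _ hn
  have e1 : ∀ᶠ n in atTop, ∀ t, cell (hN n) (s.2.2.2 t).1 ≠ cell (hN n) s.2.2.1 :=
    eventually_all.2 fun t => hne _ _ (hs.p_mem t).1 hs.u_mem (hs.ne_u t)
  have e2 : ∀ᶠ n in atTop, ∀ t t', t ≠ t' →
      cell (hN n) (s.2.2.2 t).1 ≠ cell (hN n) (s.2.2.2 t').1 := by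
    refine eventually_all.2 fun t => eventually_all.2 fun t' => ?_
    by_cases h : t = t'
    · simp [h]
    · filter_upwards [hne _ _ (hs.p_mem t).1 (hs.p_mem t').1 (hs.ne_fst t t' h)] with n hn _
      exact hn
  have e3 : ∀ᶠ n in atTop, ∀ t t', t ≠ t' →
      cell (hN n) (s.2.2.2 t).2 ≠ cell (hN n) (s.2.2.2 t').2 := by
    refine eventually_all.2 fun t => eventually_all.2 fun t' => ?_
    by_cases h : t = t'
    · simp [h]
    · filter_upwards [hne _ _ (hs.p_mem t).2 (hs.p_mem t').2 (hs.ne_snd t t' h)] with n hn _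
      exact hn
  have e4 : ∀ᶠ n in atTop, ∀ t,
      ((cell (hN n) s.2.2.1 : ℕ) : ℤ) + 60 * errorBound s (n + k) <
        (cell (hN n) (s.2.2.2 t).1 : ℕ) + (cell (hN n) (s.2.2.2 t).2 : ℕ) ∧
      ((cell (hN n) (s.2.2.2 t).1 : ℕ) : ℤ) + (cell (hN n) (s.2.2.2 t).2 : ℕ) <
        2 * (n + k : ℕ) - (cell (hN n) s.2.2.1 : ℕ) - 60 * errorBound s (n + k) ∧
      -((cell (hN n) s.2.2.1 : ℕ) : ℤ) + 60 * errorBound s (n + k) <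
        (cell (hN n) (s.2.2.2 t).2 : ℕ) - (cell (hN n) (s.2.2.2 t).1 : ℕ) ∧
      ((cell (hN n) (s.2.2.2 t).2 : ℕ) : ℤ) - (cell (hN n) (s.2.2.2 t).1 : ℕ) <
        (cell (hN n) s.2.2.1 : ℕ) - 60 * errorBound s (n + k) := by
    refine eventually_all.2 fun t => ?_
    obtain ⟨r1, r2, r3, r4⟩ := hin t
    have hone : ∀ n : ℕ, ((n + k : ℕ) : ℝ) / (n + k : ℕ) = 1 := fun n =>
      div_self (by exact_mod_cast (hN n).ne')
    refine Eventually.and ?_ (Eventually.and ?_ (Eventually.and ?_ ?_))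
    · refine eventually_lt_of_tendsto_div hN (α := s.2.2.1 + 60 * 0)
        (β := (s.2.2.2 t).1 + (s.2.2.2 t).2) ?_ ?_ (by linarith)
      · refine (hz.add (hE.const_mul 60)).congr fun n => ?_
        push_cast
        ring
      · refine ((hp1 t).add (hp2 t)).congr fun n => ?_
        push_cast
        ring
    · refine eventually_lt_of_tendsto_div hN (α := (s.2.2.2 t).1 + (s.2.2.2 t).2)
        (β := 2 - s.2.2.1 - 60 * 0) ?_ ?_ (by linarith)
      · refine ((hp1 t).add (hp2 t)).congr fun n => ?_
        push_cast
        ring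
      · refine ((hz.const_sub 2).sub (hE.const_mul 60)).congr fun n => ?_
        have := hone n
        have h0 : ((n + k : ℕ) : ℝ) ≠ 0 := by exact_mod_cast (hN n).ne'
        push_cast at h0 ⊢
        field_simp
    · refine eventually_lt_of_tendsto_div hN (α := -s.2.2.1 + 60 * 0)
        (β := (s.2.2.2 t).2 - (s.2.2.2 t).1) ?_ ?_ (by linarith)
      · refine (hz.neg.add (hE.const_mul 60)).congr fun n => ?_
        push_cast
        ring
      · refine ((hp2 t).sub (hp1 t)).congr fun n => ?_
        push_cast
        ring
    · refine eventually_lt_of_tendsto_div hN (α := (s.2.2.2 t).2 - (s.2.2.2 t).1)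
        (β := s.2.2.1 - 60 * 0) ?_ ?_ (by linarith)
      · refine ((hp2 t).sub (hp1 t)).congr fun n => ?_
        push_cast
        ring
      · refine (hz.sub (hE.const_mul 60)).congr fun n => ?_
        push_cast
        ring
  filter_upwards [hs.eventually_size hN, e1, e2, e3, e4] with n ⟨b0, b1, b2⟩ b3 b4 b5 b6
  refine exists_compat (w := wordOf (hN n) s)
    (E := (imbalance s.1 (n + k) : ℤ) + imbalance s.2.1 (n + k)) ?_ ?_ ?_ b0 b1 b2 ?_ ?_ b3 b6
  · exact (balanced_trueSet s.1).mono (by omega)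
  · exact (balanced_trueSet s.2.1).mono (by omega)
  · positivity
  · intro t t' h
    by_contra hne
    exact b4 t t' hne h
  · intro t t' h
    by_contra hne
    exact b5 t t' hne h

/-- A typical point outside the open rectangle is off the side lines, so it violates one inequality
strictly. For large sizes this contradicts `Regular.near_rect`, by which all points of a compatible
permutation stay near the rectangle. -/
theorem Typical.eventually_not_compat {k : ℕ} {s : Sample k} (hs : Typical s)
    (hN : ∀ n, 0 < n + k) (hin : ¬ ∀ t, s.2.2.2 t ∈ openRect s.2.2.1) :
    ∀ᶠ n in atTop, ∀ σ : Equiv.Perm (Fin (n + k)),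
      Compat (wordOf (hN n) s) σ → (intCols σ).card ≠ k := by
  push Not at hin
  obtain ⟨t, ht⟩ := hin
  have hz := tendsto_cell hN hs.u_mem
  have hp1 := tendsto_cell hN (hs.p_mem t).1
  have hp2 := tendsto_cell hN (hs.p_mem t).2
  have hE := hs.tendsto_errorBound
  obtain ⟨n1, n2, n3, n4⟩ := hs.off_sides t
  have key : ∀ᶠ n in atTop,
      ¬ (((cell (hN n) s.2.2.1 : ℕ) : ℤ) - 30 * errorBound s (n + k) ≤
        (cell (hN n) (s.2.2.2 t).1 : ℕ) + (cell (hN n) (s.2.2.2 t).2 : ℕ) ∧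
      ((cell (hN n) (s.2.2.2 t).1 : ℕ) : ℤ) + (cell (hN n) (s.2.2.2 t).2 : ℕ) ≤
        2 * (n + k : ℕ) - (cell (hN n) s.2.2.1 : ℕ) + 30 * errorBound s (n + k) ∧
      -((cell (hN n) s.2.2.1 : ℕ) : ℤ) - 30 * errorBound s (n + k) ≤
        (cell (hN n) (s.2.2.2 t).2 : ℕ) - (cell (hN n) (s.2.2.2 t).1 : ℕ) ∧
      ((cell (hN n) (s.2.2.2 t).2 : ℕ) : ℤ) - (cell (hN n) (s.2.2.2 t).1 : ℕ) ≤
        (cell (hN n) s.2.2.1 : ℕ) + 30 * errorBound s (n + k)) := by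
    simp only [openRect, Set.mem_ofPred_eq] at ht
    rcases lt_or_gt_of_ne n1 with h1 | h1
    · have : ∀ᶠ n in atTop, ((cell (hN n) (s.2.2.2 t).1 : ℕ) : ℤ) +
          (cell (hN n) (s.2.2.2 t).2 : ℕ) <
          (cell (hN n) s.2.2.1 : ℕ) - 30 * errorBound s (n + k) := by
        refine eventually_lt_of_tendsto_div hN (α := (s.2.2.2 t).1 + (s.2.2.2 t).2)
          (β := s.2.2.1 - 30 * 0) ?_ ?_ (by linarith)
        · refine (hp1.add hp2).congr fun n => ?_
          push_cast
          ring
        · refine (hz.sub (hE.const_mul 30)).congr fun n => ?_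
          push_cast
          ring
      filter_upwards [this] with n hn h
      omega
    rcases lt_or_gt_of_ne n2 with h2 | h2
    swap
    · have : ∀ᶠ n in atTop, 2 * ((n + k : ℕ) : ℤ) - (cell (hN n) s.2.2.1 : ℕ) +
          30 * errorBound s (n + k) <
          ((cell (hN n) (s.2.2.2 t).1 : ℕ) : ℤ) + (cell (hN n) (s.2.2.2 t).2 : ℕ) := by
        refine eventually_lt_of_tendsto_div hN (α := 2 - s.2.2.1 + 30 * 0)
          (β := (s.2.2.2 t).1 + (s.2.2.2 t).2) ?_ ?_ (by linarith)
        · refine ((hz.const_sub 2).add (hE.const_mul 30)).congr fun n => ?_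
          have h0 : ((n + k : ℕ) : ℝ) ≠ 0 := by exact_mod_cast (hN n).ne'
          push_cast at h0 ⊢
          field_simp
        · refine (hp1.add hp2).congr fun n => ?_
          push_cast
          ring
      filter_upwards [this] with n hn h
      omega
    rcases lt_or_gt_of_ne n3 with h3 | h3
    · have : ∀ᶠ n in atTop, ((cell (hN n) (s.2.2.2 t).2 : ℕ) : ℤ) -
          (cell (hN n) (s.2.2.2 t).1 : ℕ) <
          -((cell (hN n) s.2.2.1 : ℕ) : ℤ) - 30 * errorBound s (n + k) := by
        refine eventually_lt_of_tendsto_div hN (α := (s.2.2.2 t).2 - (s.2.2.2 t).1)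
          (β := -s.2.2.1 - 30 * 0) ?_ ?_ (by linarith)
        · refine (hp2.sub hp1).congr fun n => ?_
          push_cast
          ring
        · refine (hz.neg.sub (hE.const_mul 30)).congr fun n => ?_
          push_cast
          ring
      filter_upwards [this] with n hn h
      omega
    rcases lt_or_gt_of_ne n4 with h4 | h4
    · exact absurd ⟨h1, h2, h3, h4⟩ ht
    · have : ∀ᶠ n in atTop, ((cell (hN n) s.2.2.1 : ℕ) : ℤ) + 30 * errorBound s (n + k) <
          ((cell (hN n) (s.2.2.2 t).2 : ℕ) : ℤ) - (cell (hN n) (s.2.2.2 t).1 : ℕ) := by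
        refine eventually_lt_of_tendsto_div hN (α := s.2.2.1 + 30 * 0)
          (β := (s.2.2.2 t).2 - (s.2.2.2 t).1) ?_ ?_ (by linarith)
        · refine (hz.add (hE.const_mul 30)).congr fun n => ?_
          push_cast
          ring
        · refine (hp2.sub hp1).congr fun n => ?_
          push_cast
          ring
      filter_upwards [this] with n hn h
      omega
  filter_upwards [hs.eventually_size hN, key] with n ⟨b0, b1, b2⟩ b3 σ hσ hk
  have hreg := hσ.regular_of_sample (hN n) hk b0 b1 b2
  have h := hreg.near_rect hσ.z_row (fun i => by simp) (cell (hN n) (s.2.2.2 t).1)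
  have h2 : σ (cell (hN n) (s.2.2.2 t).1) = cell (hN n) (s.2.2.2 t).2 := (hσ.int t).2
  rw [h2] at h
  exact b3 h

theorem botFun_div {c : ℝ} (hc : 0 < c) (z i : ℝ) : botFun (z / c) (i / c) = botFun z i / c := by
  unfold botFun
  rw [← sub_div, abs_div, abs_of_pos hc]

theorem topFun_div {c : ℝ} (hc : 0 < c) (z i : ℝ) :
    topFun (z / c) (i / c) = min (z + i) (2 * c - z - i) / c := by
  unfold topFun
  rw [← min_div_div_right hc.le]
  congr 1
  · ring
  · field_simp

/-- Permutations compatible with the words of a typical sample point converge to the rectangle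
permuton. -/
theorem Typical.tendsto_permPermuton {k : ℕ} {s : Sample k} (hs : Typical s)
    (hN : ∀ n, 0 < n + k) (σ : ∀ n, Equiv.Perm (Fin (n + k)))
    (hσ : ∀ᶠ n in atTop, Compat (wordOf (hN n) s) (σ n) ∧ (intCols (σ n)).card = k) :
    Tendsto (fun n => permPermuton (hN n) (σ n)) atTop
      (𝓝 (rectPermuton (projIcc (0 : ℝ) 1 zero_le_one s.2.2.1))) := by
  set u := s.2.2.1 with hu
  have hproj : ((projIcc (0 : ℝ) 1 zero_le_one u : unitInterval) : ℝ) = u := by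
    rw [projIcc_of_mem zero_le_one (Ioo_subset_Icc_self hs.u_mem)]
  have hz := tendsto_cell hN hs.u_mem
  have hE := hs.tendsto_errorBound
  refine AlmostSquare.tendsto_permPermuton (N := fun n => n + k) hN (tendsto_add_atTop_nat k) σ _
    (k := k) (E := fun n => errorBound s (n + k))
    -- The first term is the discretisation error of the corner, the second the rescaled shape
    -- estimate.
    (δ := fun n => |((cell (hN n) u : ℕ) : ℝ) / (n + k : ℕ) - u| +
      10 * ((errorBound s (n + k) : ℝ) / (n + k : ℕ))) hE ?_ ?_
  · have := ((hz.sub_const u).abs).add (hE.const_mul 10)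
    rwa [← hu, sub_self, abs_zero, mul_zero, add_zero] at this
  · filter_upwards [hs.eventually_size hN, hσ] with n ⟨b0, b1, b2⟩ ⟨b3, b4⟩
    have hreg := b3.regular_of_sample (hN n) b4 b0 b1 b2
    have hc : (0 : ℝ) < (n + k : ℕ) := by exact_mod_cast hN n
    have hE1 := hreg.one_le
    have hE1' : (1 : ℝ) ≤ errorBound s (n + k) := by exact_mod_cast hE1
    set z := cell (hN n) u with hzdef
    have hsh := fun i (hi : i ∈ extCols (σ n)) =>
      hreg.shape (canonical_keyMono (σ n) z b3.z_row) (fun i => by simp) hi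
    have hlow : ∀ i ∈ lowerCols (σ n),
        |((σ n i : ℕ) : ℤ) - abs (((z : ℕ) : ℤ) - (i : ℕ))| ≤ 10 * errorBound s (n + k) := by
      intro i hi
      have := hsh i (hreg.subC hi)
      simp only [abs_le, Fin.le_def, Fin.lt_def, hi, not_true, false_and, false_or, true_and]
        at this ⊢
      rcases abs_cases (((z : ℕ) : ℤ) - (i : ℕ)) with h | h <;> omega
    have hup : ∀ i ∈ extCols (σ n) \ lowerCols (σ n),
        |((σ n i : ℕ) : ℤ) - min (((z : ℕ) : ℤ) + (i : ℕ))
          (2 * (n + k : ℕ) - ((z : ℕ) : ℤ) - (i : ℕ))| ≤ 10 * errorBound s (n + k) := by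
      intro i hi
      rw [Finset.mem_sdiff] at hi
      have := hsh i hi.1
      have hb := (σ n i).2
      simp only [abs_le, hi.2, not_false_iff, false_and, false_or, or_false, true_and]
        at this ⊢
      rcases min_cases (((z : ℕ) : ℤ) + (i : ℕ)) (2 * (n + k : ℕ) - ((z : ℕ) : ℤ) - (i : ℕ))
        with h | h <;> omega
    refine ⟨by positivity, extCols (σ n), lowerCols (σ n), hreg.subC, hreg.balD, hreg.balU, ?_,
      ?_, ?_⟩
    · have : (extCols (σ n))ᶜ = intCols (σ n) := by
        ext i
        simp
      rw [this, b4]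
    · intro i hi
      have h1 : |((σ n i : ℕ) : ℝ) - botFun (z : ℕ) (i : ℕ)| ≤ 10 * errorBound s (n + k) := by
        unfold botFun
        exact_mod_cast hlow i hi
      have h2 := abs_botFun_sub_le (((z : ℕ) : ℝ) / (n + k : ℕ)) (((i : ℕ) : ℝ) / (n + k : ℕ)) u
        (((i : ℕ) : ℝ) / (n + k : ℕ))
      rw [sub_self, abs_zero, add_zero, botFun_div hc] at h2
      have h3 : |((σ n i : ℕ) : ℝ) / (n + k : ℕ) - botFun (z : ℕ) (i : ℕ) / (n + k : ℕ)| ≤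
          10 * ((errorBound s (n + k) : ℝ) / (n + k : ℕ)) := by
        rw [← sub_div, abs_div, abs_of_pos hc, ← mul_div_assoc]
        gcongr
      rw [hproj]
      have h4 := abs_sub_le (((σ n i : ℕ) : ℝ) / (n + k : ℕ))
        (botFun (z : ℕ) (i : ℕ) / (n + k : ℕ)) (botFun u (((i : ℕ) : ℝ) / (n + k : ℕ)))
      linarith
    · intro i hi
      have h1 : |((σ n i : ℕ) : ℝ) - min (((z : ℕ) : ℝ) + (i : ℕ))
          (2 * (n + k : ℕ) - ((z : ℕ) : ℝ) - (i : ℕ))| ≤ 10 * errorBound s (n + k) := by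
        exact_mod_cast hup i hi
      have h2 := abs_topFun_sub_le (((z : ℕ) : ℝ) / (n + k : ℕ)) (((i : ℕ) : ℝ) / (n + k : ℕ)) u
        (((i : ℕ) : ℝ) / (n + k : ℕ))
      rw [sub_self, abs_zero, add_zero, topFun_div hc] at h2
      set m := min (((z : ℕ) : ℝ) + (i : ℕ)) (2 * (n + k : ℕ) - ((z : ℕ) : ℝ) - (i : ℕ))
      have h3 : |((σ n i : ℕ) : ℝ) / (n + k : ℕ) - m / (n + k : ℕ)| ≤
          10 * ((errorBound s (n + k) : ℝ) / (n + k : ℕ)) := by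
        rw [← sub_div, abs_div, abs_of_pos hc, ← mul_div_assoc]
        gcongr
      rw [hproj]
      have h4 := abs_sub_le (((σ n i : ℕ) : ℝ) / (n + k : ℕ))
        (m / (n + k : ℕ)) (topFun u (((i : ℕ) : ℝ) / (n + k : ℕ)))
      linarith

end Deterministic

open ProbabilityTheory

/-! ### The random sample: almost sure properties and uniformity of its words. -/

section SampleSpace

/-- The law of a fair label. -/
noncomputable def coin : Measure Bool := uniformOn univ

instance isProbabilityMeasure_coin : IsProbabilityMeasure coin :=
  isProbabilityMeasure_uniformOn finite_univ univ_nonempty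

theorem coin_singleton (b : Bool) : coin {b} = 2⁻¹ := by
  rw [coin, uniformOn_univ]
  simp

/-- Independent fair labels. -/
noncomputable def labelMeasure : Measure (ℕ → Bool) := Measure.infinitePi fun _ => coin

instance isProbabilityMeasure_labelMeasure : IsProbabilityMeasure labelMeasure := by
  unfold labelMeasure
  infer_instance

/-- The uniform law on the unit interval. -/
noncomputable def unif : Measure ℝ := volume.restrict (Ioo (0 : ℝ) 1)

instance isProbabilityMeasure_unif : IsProbabilityMeasure unif := ⟨by simp [unif]⟩

/-- The law of the corner position and the `k` points. -/
noncomputable def pointMeasure (k : ℕ) : Measure (ℝ × (Fin k → ℝ × ℝ)) :=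
  unif.prod (Measure.pi fun _ => unif.prod unif)

instance isProbabilityMeasure_pointMeasure (k : ℕ) : IsProbabilityMeasure (pointMeasure k) := by
  unfold pointMeasure
  infer_instance

/-- The law of a sample point. -/
noncomputable def sampleMeasure (k : ℕ) : Measure (Sample k) :=
  labelMeasure.prod (labelMeasure.prod (pointMeasure k))

instance isProbabilityMeasure_sampleMeasure (k : ℕ) :
    IsProbabilityMeasure (sampleMeasure k) := by
  unfold sampleMeasure
  infer_instance

/-- The strong law of large numbers for labels. -/
theorem ae_tendsto_trueCount :
    ∀ᵐ x ∂labelMeasure, Tendsto (fun n => (trueCount x n : ℝ) / n) atTop (𝓝 2⁻¹) := by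
  set g : Bool → ℝ := fun b => if b = true then 1 else 0 with hg
  have hgm : Measurable g := measurable_of_finite g
  have hmeas : ∀ i : ℕ, Measurable fun x : ℕ → Bool => g (x i) :=
    fun i => hgm.comp (measurable_pi_apply i)
  have hlaw : ∀ i : ℕ, labelMeasure.map (fun x => g (x i)) = coin.map g := by
    intro i
    have h := (measurePreserving_eval_infinitePi (fun _ : ℕ => coin) i).map_eq
    rw [← h, Measure.map_map hgm (measurable_pi_apply i)]
    rfl
  have hind : iIndepFun (fun i (x : ℕ → Bool) => g (x i)) labelMeasure :=
    iIndepFun_infinitePi (P := fun _ : ℕ => coin) fun _ => hgm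
  have hbound : ∀ b, ‖g b‖ ≤ 1 := by
    intro b
    cases b <;> simp [hg]
  have hint : Integrable (fun x : ℕ → Bool => g (x 0)) labelMeasure :=
    Integrable.of_bound (hmeas 0).aestronglyMeasurable 1 (Eventually.of_forall fun x => hbound _)
  have hmean : ∫ x, g (x 0) ∂labelMeasure = 2⁻¹ := by
    have h1 : ∫ x, g (x 0) ∂labelMeasure = ∫ y, y ∂(labelMeasure.map fun x => g (x 0)) :=
      (integral_map (hmeas 0).aemeasurable aestronglyMeasurable_id).symm
    have h2 : ∫ y, y ∂(coin.map g) = ∫ b, g b ∂coin :=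
      integral_map hgm.aemeasurable aestronglyMeasurable_id
    rw [h1, hlaw 0, h2,
      integral_fintype (Integrable.of_bound hgm.aestronglyMeasurable 1
        (Eventually.of_forall hbound))]
    simp [hg, Measure.real, coin_singleton]
  have h := strong_law_ae_real (μ := labelMeasure) (fun i x => g (x i)) hint
    (fun i j hij => hind.indepFun hij)
    (fun i => ⟨(hmeas i).aemeasurable, (hmeas 0).aemeasurable, by rw [hlaw, hlaw]⟩)
  rw [hmean] at h
  filter_upwards [h] with x hx
  refine hx.congr fun n => ?_
  congr 1
  simp only [hg, trueCount, Finset.sum_boole]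

/-- A level set is an affine subspace; if it were the whole space it would contain both `0` and `v`,
on which `l` differs. -/
theorem volume_level_eq_zero {V : Type*} [NormedAddCommGroup V] [NormedSpace ℝ V]
    [MeasurableSpace V] [BorelSpace V] [FiniteDimensional ℝ V] (μ : Measure V)
    [μ.IsAddHaarMeasure] (l : V →ₗ[ℝ] ℝ) (c : ℝ) (v : V) (hv : l v ≠ 0) :
    μ {w | l w = c} = 0 := by
  set A : AffineSubspace ℝ V :=
    { carrier := {w | l w = c}
      smul_vsub_vadd_mem' := by
        intro r p q w hp hq hw
        simp only [Set.mem_ofPred_eq] at hp hq hw ⊢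
        simp [hp, hq, hw] } with hA
  refine Measure.addHaar_affineSubspace μ A fun htop => ?_
  have h1 : (0 : V) ∈ A := htop ▸ AffineSubspace.mem_top ℝ V 0
  have h2 : v ∈ A := htop ▸ AffineSubspace.mem_top ℝ V v
  have h1' : l 0 = c := h1
  have h2' : l v = c := h2
  rw [map_zero] at h1'
  exact hv (h2'.trans h1'.symm)

/-- The open cube in which sample points live. -/
def sampleCube (k : ℕ) : Set (ℝ × (Fin k → ℝ × ℝ)) :=
  Ioo (0 : ℝ) 1 ×ˢ (univ.pi fun _ => Ioo (0 : ℝ) 1 ×ˢ Ioo (0 : ℝ) 1)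

theorem unif_prod_unif :
    unif.prod unif = (volume : Measure (ℝ × ℝ)).restrict (Ioo (0 : ℝ) 1 ×ˢ Ioo (0 : ℝ) 1) := by
  rw [unif, Measure.prod_restrict, Measure.volume_eq_prod]

theorem pointMeasure_eq_restrict (k : ℕ) :
    pointMeasure k = volume.restrict (sampleCube k) := by
  rw [pointMeasure, unif_prod_unif, sampleCube, ← Measure.restrict_pi_pi, unif,
    Measure.prod_restrict]
  rfl

theorem ae_pointMeasure_of_level {k : ℕ} (l : (ℝ × (Fin k → ℝ × ℝ)) →ₗ[ℝ] ℝ) (c : ℝ)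
    (v : ℝ × (Fin k → ℝ × ℝ)) (hv : l v ≠ 0) : ∀ᵐ w ∂(pointMeasure k), l w ≠ c := by
  rw [pointMeasure_eq_restrict]
  refine ae_restrict_of_ae ?_
  rw [ae_iff]
  simp only [ne_eq, not_not]
  have h1 : (volume : Measure (ℝ × ℝ)).IsAddHaarMeasure :=
    Measure.prod.instIsAddHaarMeasure _ _
  have h2 : (volume : Measure (Fin k → ℝ × ℝ)).IsAddHaarMeasure :=
    Measure.pi.isAddHaarMeasure _
  have h3 : (volume : Measure (ℝ × (Fin k → ℝ × ℝ))).IsAddHaarMeasure :=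
    Measure.prod.instIsAddHaarMeasure _ _
  exact volume_level_eq_zero volume l c v hv

/-- Each coincidence to be avoided is a level set of a nonzero linear form, hence a null set. -/
theorem ae_typical_points (k : ℕ) : ∀ᵐ w ∂(pointMeasure k), w.1 ∈ Ioo (0 : ℝ) 1 ∧
    (∀ t, (w.2 t).1 ∈ Ioo (0 : ℝ) 1 ∧ (w.2 t).2 ∈ Ioo (0 : ℝ) 1) ∧
    (∀ t, (w.2 t).1 ≠ w.1) ∧ (∀ t t', t ≠ t' → (w.2 t).1 ≠ (w.2 t').1) ∧
    (∀ t t', t ≠ t' → (w.2 t).2 ≠ (w.2 t').2) ∧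
    ∀ t, (w.2 t).1 + (w.2 t).2 ≠ w.1 ∧ (w.2 t).1 + (w.2 t).2 ≠ 2 - w.1 ∧
      (w.2 t).2 - (w.2 t).1 ≠ -w.1 ∧ (w.2 t).2 - (w.2 t).1 ≠ w.1 := by
  set U : (ℝ × (Fin k → ℝ × ℝ)) →ₗ[ℝ] ℝ := LinearMap.fst ℝ ℝ (Fin k → ℝ × ℝ) with hU
  set X : Fin k → (ℝ × (Fin k → ℝ × ℝ)) →ₗ[ℝ] ℝ := fun t =>
    (LinearMap.fst ℝ ℝ ℝ).comp ((LinearMap.proj t).comp (LinearMap.snd ℝ ℝ (Fin k → ℝ × ℝ)))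
    with hX
  set Y : Fin k → (ℝ × (Fin k → ℝ × ℝ)) →ₗ[ℝ] ℝ := fun t =>
    (LinearMap.snd ℝ ℝ ℝ).comp ((LinearMap.proj t).comp (LinearMap.snd ℝ ℝ (Fin k → ℝ × ℝ)))
    with hY
  have h0 : ∀ᵐ w ∂(pointMeasure k), w ∈ sampleCube k := by
    rw [pointMeasure_eq_restrict]
    refine ae_restrict_mem ?_
    exact measurableSet_Ioo.prod (MeasurableSet.univ_pi fun _ =>
      measurableSet_Ioo.prod measurableSet_Ioo)
  have h1 : ∀ᵐ w ∂(pointMeasure k), ∀ t, (X t - U) w ≠ 0 :=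
    ae_all_iff.2 fun t => ae_pointMeasure_of_level _ _ (1, 0) (by simp [hX, hU])
  have h2 : ∀ᵐ w ∂(pointMeasure k), ∀ t t', t ≠ t' → (X t - X t') w ≠ 0 := by
    refine ae_all_iff.2 fun t => ae_all_iff.2 fun t' => ?_
    by_cases h : t = t'
    · simp [h]
    · filter_upwards [ae_pointMeasure_of_level (X t - X t') 0 (0, Pi.single t (1, 0))
        (by simp [hX, Ne.symm h])] with w hw _
      exact hw
  have h3 : ∀ᵐ w ∂(pointMeasure k), ∀ t t', t ≠ t' → (Y t - Y t') w ≠ 0 := by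
    refine ae_all_iff.2 fun t => ae_all_iff.2 fun t' => ?_
    by_cases h : t = t'
    · simp [h]
    · filter_upwards [ae_pointMeasure_of_level (Y t - Y t') 0 (0, Pi.single t (0, 1))
        (by simp [hY, Ne.symm h])] with w hw _
      exact hw
  have h4 : ∀ᵐ w ∂(pointMeasure k), ∀ t, (X t + Y t - U) w ≠ 0 :=
    ae_all_iff.2 fun t => ae_pointMeasure_of_level _ _ (1, 0) (by simp [hX, hY, hU])
  have h5 : ∀ᵐ w ∂(pointMeasure k), ∀ t, (X t + Y t + U) w ≠ 2 :=
    ae_all_iff.2 fun t => ae_pointMeasure_of_level _ _ (1, 0) (by simp [hX, hY, hU])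
  have h6 : ∀ᵐ w ∂(pointMeasure k), ∀ t, (Y t - X t + U) w ≠ 0 :=
    ae_all_iff.2 fun t => ae_pointMeasure_of_level _ _ (1, 0) (by simp [hX, hY, hU])
  have h7 : ∀ᵐ w ∂(pointMeasure k), ∀ t, (Y t - X t - U) w ≠ 0 :=
    ae_all_iff.2 fun t => ae_pointMeasure_of_level _ _ (1, 0) (by simp [hX, hY, hU])
  filter_upwards [h0, h1, h2, h3, h4, h5, h6, h7] with w a0 a1 a2 a3 a4 a5 a6 a7
  refine ⟨a0.1, fun t => a0.2 t (mem_univ t), fun t h => a1 t ?_, fun t t' ht h => a2 t t' ht ?_,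
    fun t t' ht h => a3 t t' ht ?_, fun t => ⟨fun h => a4 t ?_, fun h => a5 t ?_,
    fun h => a6 t ?_, fun h => a7 t ?_⟩⟩
  all_goals
    simp only [hX, hY, hU, LinearMap.sub_apply, LinearMap.add_apply, LinearMap.comp_apply,
      LinearMap.fst_apply, LinearMap.snd_apply, LinearMap.proj_apply]
    linarith

theorem ae_typical (k : ℕ) : ∀ᵐ s ∂(sampleMeasure k), Typical s := by
  have h1 : ∀ᵐ s ∂(sampleMeasure k),
      Tendsto (fun n => (trueCount s.1 n : ℝ) / n) atTop (𝓝 2⁻¹) :=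
    Measure.quasiMeasurePreserving_fst.ae ae_tendsto_trueCount
  have h2 : ∀ᵐ s ∂(sampleMeasure k),
      Tendsto (fun n => (trueCount s.2.1 n : ℝ) / n) atTop (𝓝 2⁻¹) :=
    Measure.quasiMeasurePreserving_snd.ae
      (Measure.quasiMeasurePreserving_fst.ae ae_tendsto_trueCount)
  have h3 := (Measure.quasiMeasurePreserving_snd (μ := labelMeasure)
    (ν := labelMeasure.prod (pointMeasure k))).ae
      (Measure.quasiMeasurePreserving_snd.ae (ae_typical_points k))
  filter_upwards [h1, h2, h3] with s a1 a2 a3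
  obtain ⟨b1, b2, b3, b4, b5, b6⟩ := a3
  exact ⟨a1, a2, b1, b2, b3, b4, b5, b6⟩

theorem measurable_cell {N : ℕ} (hN : 0 < N) : Measurable (cell hN) := by
  have h : cell hN = (fun m : ℕ => (⟨min m (N - 1), by omega⟩ : Fin N)) ∘
      fun t : ℝ => ⌊t * N⌋₊ := rfl
  rw [h]
  exact measurable_from_top.comp (Nat.measurable_floor.comp (measurable_id.mul_const _))

theorem measurable_wordOf {N k : ℕ} (hN : 0 < N) :
    Measurable (wordOf (k := k) hN) := by
  have hc := measurable_cell hN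
  unfold wordOf
  fun_prop

theorem unif_cell {N : ℕ} (hN : 0 < N) (a : Fin N) :
    unif (cell hN ⁻¹' {a}) = ENNReal.ofReal (1 / N) := by
  have hN' : (0 : ℝ) < N := by exact_mod_cast hN
  have ha : (a : ℝ) + 1 ≤ N := by exact_mod_cast a.2
  have hvol : ENNReal.ofReal (((a : ℝ) + 1) / N - (a : ℝ) / N) = ENNReal.ofReal (1 / N) := by
    congr 1
    ring
  have hiff : ∀ t ∈ Ioo (0 : ℝ) 1, cell hN t = a ↔ (a : ℝ) / N ≤ t ∧ t < ((a : ℝ) + 1) / N := by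
    intro t ht
    rw [Fin.ext_iff, cell_val hN ht, Nat.floor_eq_iff (mul_nonneg ht.1.le hN'.le),
      div_le_iff₀ hN', lt_div_iff₀ hN']
  rw [unif, Measure.restrict_apply ((measurable_cell hN) (measurableSet_singleton a))]
  refine le_antisymm ?_ ?_
  · rw [← hvol, ← Real.volume_Ico]
    refine measure_mono ?_
    rintro t ⟨h1, h2⟩
    exact (hiff t h2).1 h1
  · rw [← hvol, ← Real.volume_Ioo]
    refine measure_mono ?_
    rintro t ⟨h1, h2⟩
    have h3 : t ∈ Ioo (0 : ℝ) 1 := by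
      refine ⟨lt_of_le_of_lt (by positivity) h1, lt_of_lt_of_le h2 ?_⟩
      rwa [div_le_one hN']
    exact ⟨(hiff t h3).2 ⟨h1.le, h2⟩, h3⟩

theorem labelMeasure_prefix {N : ℕ} (w : Fin N → Bool) :
    labelMeasure {x | (fun i : Fin N => x i) = w} = 2⁻¹ ^ N := by
  have h : {x : ℕ → Bool | (fun i : Fin N => x i) = w} =
      Set.pi (Finset.range N) fun i => if h : i < N then {w ⟨i, h⟩} else univ := by
    ext x
    simp only [Set.mem_ofPred_eq, funext_iff, Set.mem_pi, Finset.coe_range, Set.mem_Iio]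
    constructor
    · intro h i hi
      rw [dif_pos hi]
      exact h ⟨i, hi⟩
    · intro h i
      have := h i i.2
      rw [dif_pos i.2] at this
      exact this
  rw [h, labelMeasure, Measure.infinitePi_pi _ fun i _ => MeasurableSet.of_discrete]
  rw [Finset.prod_congr rfl (g := fun _ => (2⁻¹ : ENNReal)) fun i hi => ?_]
  · simp
  · rw [dif_pos (Finset.mem_range.1 hi), coin_singleton]

/-- The word of a random sample point is uniformly distributed. -/
theorem sampleMeasure_wordOf {N k : ℕ} (hN : 0 < N) (w : Word N k) :
    sampleMeasure k (wordOf hN ⁻¹' {w}) =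
      2⁻¹ ^ N * (2⁻¹ ^ N * (ENNReal.ofReal (1 / N) *
        (ENNReal.ofReal (1 / N) * ENNReal.ofReal (1 / N)) ^ k)) := by
  have h : wordOf hN ⁻¹' {w} = {x | (fun i : Fin N => x i) = w.1} ×ˢ
      ({x | (fun i : Fin N => x i) = w.2.1} ×ˢ ((cell hN ⁻¹' {w.2.2.1}) ×ˢ
        (univ.pi fun t => (cell hN ⁻¹' {(w.2.2.2 t).1}) ×ˢ
          (cell hN ⁻¹' {(w.2.2.2 t).2})))) := by
    ext ⟨x, y, u, p⟩
    obtain ⟨w1, w2, w3, w4⟩ := w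
    simp only [wordOf, Set.mem_preimage, Set.mem_singleton_iff, Prod.mk.injEq, Set.mem_prod,
      Set.mem_ofPred_eq, Set.mem_pi, Set.mem_univ, true_implies]
    rw [funext_iff (f := fun t => (cell hN (p t).1, cell hN (p t).2))]
    simp only [Prod.ext_iff]
  rw [h, sampleMeasure, Measure.prod_prod, Measure.prod_prod, pointMeasure, Measure.prod_prod,
    Measure.pi_pi, labelMeasure_prefix, labelMeasure_prefix, unif_cell]
  simp only [Measure.prod_prod, unif_cell, Finset.prod_const, Finset.card_univ, Fintype.card_fin]

theorem integral_wordOf {N k : ℕ} (hN : 0 < N) (H : Word N k → ℝ) :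
    ∫ s, H (wordOf hN s) ∂(sampleMeasure k) =
      (2⁻¹ ^ N * (2⁻¹ ^ N * (ENNReal.ofReal (1 / N) *
        (ENNReal.ofReal (1 / N) * ENNReal.ofReal (1 / N)) ^ k)) : ENNReal).toReal *
        ∑ w, H w := by
  have hm := measurable_wordOf (k := k) hN
  have : IsProbabilityMeasure ((sampleMeasure k).map (wordOf hN)) :=
    Measure.isProbabilityMeasure_map hm.aemeasurable
  have hH : Measurable H := measurable_of_finite H
  rw [← integral_map hm.aemeasurable (f := H) hH.aestronglyMeasurable,
    integral_fintype (Integrable.of_finite), Finset.mul_sum]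
  refine Finset.sum_congr rfl fun w _ => ?_
  rw [Measure.real, Measure.map_apply hm (measurableSet_singleton w), sampleMeasure_wordOf,
    smul_eq_mul]

theorem integral_botFun {u : ℝ} (hu : u ∈ Ioo (0 : ℝ) 1) :
    ∫ x in (0 : ℝ)..1, botFun u x = u ^ 2 / 2 + (1 - u) ^ 2 / 2 := by
  have hc : Continuous (botFun u) := continuous_botFun.comp (continuous_const.prodMk continuous_id)
  rw [← intervalIntegral.integral_add_adjacent_intervals (hc.intervalIntegrable 0 u)
    (hc.intervalIntegrable u 1)]
  have h1 : ∫ x in (0 : ℝ)..u, botFun u x = ∫ x in (0 : ℝ)..u, (u - x) := by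
    refine intervalIntegral.integral_congr fun x hx => ?_
    rw [uIcc_of_le hu.1.le] at hx
    simp only [botFun]
    rw [abs_of_nonneg (by linarith [hx.2])]
  have h2 : ∫ x in u..1, botFun u x = ∫ x in u..1, (x - u) := by
    refine intervalIntegral.integral_congr fun x hx => ?_
    rw [uIcc_of_le hu.2.le] at hx
    simp only [botFun]
    rw [abs_of_nonpos (by linarith [hx.1])]
    ring
  rw [h1, h2, intervalIntegral.integral_sub (by simp) (by simp),
    intervalIntegral.integral_sub (by simp) (by simp)]
  simp only [intervalIntegral.integral_const, integral_id, smul_eq_mul]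
  ring

theorem integral_topFun {u : ℝ} (hu : u ∈ Ioo (0 : ℝ) 1) :
    ∫ x in (0 : ℝ)..1, topFun u x = 1 / 2 + u - u ^ 2 := by
  have hc : Continuous (topFun u) := continuous_topFun.comp (continuous_const.prodMk continuous_id)
  rw [← intervalIntegral.integral_add_adjacent_intervals (hc.intervalIntegrable 0 (1 - u))
    (hc.intervalIntegrable (1 - u) 1)]
  have h1 : ∫ x in (0 : ℝ)..(1 - u), topFun u x = ∫ x in (0 : ℝ)..(1 - u), (u + x) := by
    refine intervalIntegral.integral_congr fun x hx => ?_
    rw [uIcc_of_le (by linarith [hu.2])] at hx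
    simp only [topFun]
    rw [min_eq_left (by linarith [hx.2])]
  have h2 : ∫ x in (1 - u)..1, topFun u x = ∫ x in (1 - u)..1, (2 - u - x) := by
    refine intervalIntegral.integral_congr fun x hx => ?_
    rw [uIcc_of_le (by linarith [hu.1])] at hx
    simp only [topFun]
    rw [min_eq_right (by linarith [hx.1])]
  rw [h1, h2, intervalIntegral.integral_add (by simp) (by simp),
    intervalIntegral.integral_sub (by simp) (by simp)]
  simp only [intervalIntegral.integral_const, integral_id, smul_eq_mul]
  ring

/-- The area of the rectangle. -/
theorem unif_prod_openRect {u : ℝ} (hu : u ∈ Ioo (0 : ℝ) 1) :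
    (unif.prod unif) (openRect u) = ENNReal.ofReal (2 * (u * (1 - u))) := by
  obtain ⟨hu0, hu1⟩ := hu
  have hcb : Continuous (botFun u) :=
    continuous_botFun.comp (continuous_const.prodMk continuous_id)
  have hct : Continuous (topFun u) :=
    continuous_topFun.comp (continuous_const.prodMk continuous_id)
  -- Inside the open square the rectangle is the region between its lower and upper boundary graphs.
  have h1 : openRect u ∩ Ioo (0 : ℝ) 1 ×ˢ Ioo (0 : ℝ) 1 =
      regionBetween (botFun u) (topFun u) (Ioo 0 1) := by
    ext ⟨x, y⟩
    simp only [openRect, regionBetween, Set.mem_inter_iff, Set.mem_ofPred_eq, Set.mem_prod,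
      Set.mem_Ioo, botFun, topFun, abs_lt, lt_min_iff]
    constructor
    · rintro ⟨⟨h1, h2, h3, h4⟩, ⟨h5, h6⟩, h7, h8⟩
      exact ⟨⟨h5, h6⟩, ⟨by linarith, by linarith⟩, by linarith, by linarith⟩
    · rintro ⟨⟨h5, h6⟩, ⟨h1, h2⟩, h3, h4⟩
      exact ⟨⟨by linarith, by linarith, by linarith, by linarith⟩, ⟨h5, h6⟩, by linarith,
        by linarith⟩
  have hle : ∀ x ∈ Ioo (0 : ℝ) 1, botFun u x ≤ topFun u x := by
    rintro x ⟨h1, h2⟩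
    simp only [botFun, topFun]
    refine abs_le.2 ⟨?_, ?_⟩
    · rcases min_cases (u + x) (2 - u - x) with h | h <;> linarith
    · exact le_min (by linarith) (by linarith)
  have hib : IntegrableOn (botFun u) (Ioo 0 1) :=
    (hcb.integrableOn_Icc (a := 0) (b := 1)).mono_set Ioo_subset_Icc_self
  have hit : IntegrableOn (topFun u) (Ioo 0 1) :=
    (hct.integrableOn_Icc (a := 0) (b := 1)).mono_set Ioo_subset_Icc_self
  rw [unif_prod_unif, Measure.restrict_apply' (measurableSet_Ioo.prod measurableSet_Ioo), h1,
    Measure.volume_eq_prod,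
    volume_regionBetween_eq_integral hib hit measurableSet_Ioo hle]
  congr 1
  simp only [Pi.sub_apply]
  rw [integral_sub hit hib, ← integral_Ioc_eq_integral_Ioo, ← integral_Ioc_eq_integral_Ioo,
    ← intervalIntegral.integral_of_le zero_le_one, ← intervalIntegral.integral_of_le zero_le_one,
    integral_botFun ⟨hu0, hu1⟩, integral_topFun ⟨hu0, hu1⟩]
  ring

end SampleSpace

/-! ### From words to averages over permutations, and the Beta law. -/

section Limit

variable {N k : ℕ}

/-- The sum of `G` over the (at most one) almost square permutation described by a word, weighted
by `2` if the marked column is extreme. -/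
noncomputable def wordSum (G : Equiv.Perm (Fin N) → ℝ) (w : Word N k) : ℝ :=
  (if Inner w.2.2.1 then 1 else 2) *
    ∑ σ ∈ Finset.univ.filter (fun σ : Equiv.Perm (Fin N) =>
      Compat w σ ∧ (intCols σ).card = k), G σ

/-- The inner sum has at most one term, by `Compat.unique`. The bound provides the domination for
the limit. -/
theorem abs_wordSum_le {G : Equiv.Perm (Fin N) → ℝ} {C : ℝ} (hC : 0 ≤ C) (hG : ∀ σ, |G σ| ≤ C)
    (w : Word N k) : |wordSum G w| ≤ 2 * C := by
  set S := Finset.univ.filter (fun σ : Equiv.Perm (Fin N) =>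
      Compat w σ ∧ (intCols σ).card = k) with hS
  have hcard : S.card ≤ 1 := by
    refine Finset.card_le_one.2 fun σ hσ τ hτ => ?_
    simp only [hS, Finset.mem_filter, Finset.mem_univ, true_and] at hσ hτ
    exact hσ.1.unique hτ.1 hσ.2 hτ.2
  have hsum : |∑ σ ∈ S, G σ| ≤ C := by
    refine (Finset.abs_sum_le_sum_abs _ _).trans ((Finset.sum_le_card_nsmul S _ C
      fun σ _ => hG σ).trans ?_)
    rw [nsmul_eq_mul]
    have : (S.card : ℝ) ≤ 1 := by exact_mod_cast hcard
    nlinarith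
  rw [wordSum, abs_mul]
  refine mul_le_mul ?_ hsum (abs_nonneg _) zero_le_two
  split_ifs <;> norm_num

/-- Summation over words amounts to summation over almost square permutations. -/
theorem sum_wordSum (hN : 2 ≤ N) (G : Equiv.Perm (Fin N) → ℝ) :
    ∑ w : Word N k, wordSum G w = (2 ^ (k + 3) * (2 ^ (k + 2) * k.factorial) : ℕ) *
      ∑ σ ∈ Finset.univ.filter (fun σ : Equiv.Perm (Fin N) => (intCols σ).card = k), G σ := by
  have h1 : ∀ w : Word N k, wordSum G w =
      ∑ σ ∈ Finset.univ.filter (fun σ : Equiv.Perm (Fin N) => (intCols σ).card = k),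
        if Compat w σ then (if Inner w.2.2.1 then 1 else 2) * G σ else 0 := by
    intro w
    rw [wordSum, Finset.mul_sum, ← Finset.sum_filter, Finset.filter_filter]
    refine Finset.sum_congr ?_ fun _ _ => rfl
    ext σ
    simp [and_comm]
  simp only [h1]
  rw [Finset.sum_comm, Finset.mul_sum]
  refine Finset.sum_congr rfl fun σ hσ => ?_
  -- After exchanging the sums, all words compatible with `σ` mark the column of its lowest point,
  -- so their weight is constant and `card_compat` applies.
  obtain ⟨z, hz⟩ := exists_bottom hN σ
  rw [← card_compat hN σ (Finset.mem_filter.1 hσ).2 z hz, ← Finset.sum_filter,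
    Finset.sum_congr rfl (g := fun _ => (if Inner z then 1 else 2) * G σ) fun w hw => ?_,
    Finset.sum_const, nsmul_eq_mul]
  · push_cast
    ring
  · have hw' : w.2.2.1 = z := by
      refine σ.injective (Fin.ext ?_)
      rw [(Finset.mem_filter.1 hw).2.z_row, hz]
    rw [hw']

/-- The pointwise limit of the weighted sums of a functional of permutons. -/
noncomputable def limitFun (F : Permuton → ℝ) (w : ℝ × (Fin k → ℝ × ℝ)) : ℝ :=
  if ∀ t, w.2 t ∈ openRect w.1 then F (rectPermuton (projIcc (0 : ℝ) 1 zero_le_one w.1)) else 0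

/-- Eventually the sum reduces to its single term, with weight 1 since the corner column is no
longer extreme, or is empty, according to whether all points lie in the open rectangle. -/
theorem Typical.tendsto_wordSum {s : Sample k} (hs : Typical s) (hN : ∀ n, 0 < n + k)
    {F : Permuton → ℝ} (hF : Continuous F) :
    Tendsto (fun n => wordSum (fun σ => F (permPermuton (hN n) σ)) (wordOf (hN n) s)) atTop
      (𝓝 (limitFun F s.2.2)) := by
  by_cases hin : ∀ t, s.2.2.2 t ∈ openRect s.2.2.1
  · have hex := hs.eventually_exists_compat hN hin
    set σ : ∀ n, Equiv.Perm (Fin (n + k)) := fun n =>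
      if h : ∃ σ : Equiv.Perm (Fin (n + k)), Compat (wordOf (hN n) s) σ ∧ (intCols σ).card = k
      then h.choose else 1 with hσdef
    have hσ : ∀ᶠ n in atTop, Compat (wordOf (hN n) s) (σ n) ∧ (intCols (σ n)).card = k := by
      filter_upwards [hex] with n hn
      simp only [hσdef, dif_pos hn]
      exact hn.choose_spec
    have hlim := (hF.tendsto _).comp (hs.tendsto_permPermuton hN σ hσ)
    rw [limitFun, if_pos hin]
    refine hlim.congr' ?_
    filter_upwards [hσ, hs.eventually_size hN] with n hn hsize
    have hE : 0 < errorBound s (n + k) := by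
      unfold errorBound
      positivity
    have hinner : Inner (wordOf (hN n) s).2.2.1 := by
      change Inner (cell (hN n) s.2.2.1)
      unfold Inner
      omega
    have hfilter : Finset.univ.filter (fun τ : Equiv.Perm (Fin (n + k)) =>
        Compat (wordOf (hN n) s) τ ∧ (intCols τ).card = k) = {σ n} := by
      ext τ
      simp only [Finset.mem_filter, Finset.mem_univ, true_and, Finset.mem_singleton]
      constructor
      · rintro ⟨h1, h2⟩
        exact h1.unique hn.1 h2 hn.2
      · rintro rfl
        exact hn
    rw [wordSum, if_pos hinner, hfilter, Finset.sum_singleton, one_mul]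
    rfl
  · rw [limitFun, if_neg hin]
    refine tendsto_const_nhds.congr' ?_
    filter_upwards [hs.eventually_not_compat hN hin] with n hn
    rw [wordSum, Finset.sum_eq_zero, mul_zero]
    intro σ hσ
    obtain ⟨h1, h2⟩ := (Finset.mem_filter.1 hσ).2
    exact absurd h2 (hn σ h1)

theorem tendsto_integral_wordSum (hN : ∀ n, 0 < n + k) {F : Permuton → ℝ} (hF : Continuous F)
    {C : ℝ} (hC : ∀ μ, |F μ| ≤ C) :
    Tendsto (fun n => ∫ s, wordSum (fun σ => F (permPermuton (hN n) σ)) (wordOf (hN n) s)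
      ∂(sampleMeasure k)) atTop (𝓝 (∫ s, limitFun F s.2.2 ∂(sampleMeasure k))) := by
  have hC0 : 0 ≤ C := (abs_nonneg _).trans (hC (rectPermuton 0))
  refine tendsto_integral_of_dominated_convergence (fun _ => 2 * C) (fun n => ?_)
    (integrable_const _) (fun n => Eventually.of_forall fun s => ?_) ?_
  · exact ((measurable_of_finite (wordSum fun σ => F (permPermuton (hN n) σ))).comp
      (measurable_wordOf (hN n))).aestronglyMeasurable
  · exact abs_wordSum_le hC0 (fun σ => hC _) _
  · filter_upwards [ae_typical k] with s hs
    exact hs.tendsto_wordSum hN hF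

theorem measurableSet_forall_mem_openRect :
    MeasurableSet {w : ℝ × (Fin k → ℝ × ℝ) | ∀ t, w.2 t ∈ openRect w.1} := by
  refine IsOpen.measurableSet ?_
  simp only [Set.ofPred_forall, openRect, Set.ofPred_and]
  refine isOpen_iInter_of_finite fun t => IsOpen.inter ?_ (IsOpen.inter ?_ (IsOpen.inter ?_ ?_))
  all_goals exact isOpen_lt (by fun_prop) (by fun_prop)

theorem continuous_comp_rectPermuton {F : Permuton → ℝ} (hF : Continuous F) :
    Continuous fun u : ℝ => F (rectPermuton (projIcc (0 : ℝ) 1 zero_le_one u)) :=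
  hF.comp (continuous_rectPermuton.comp continuous_projIcc)

/-- The labels integrate out. Given the corner `u`, the `k` points fall independently into the
rectangle, each with probability its area `2 * (u * (1 - u))`. -/
theorem integral_limitFun {F : Permuton → ℝ} (hF : Continuous F) {C : ℝ}
    (hC : ∀ μ, |F μ| ≤ C) :
    ∫ s, limitFun F s.2.2 ∂(sampleMeasure k) =
      ∫ u in Ioo (0 : ℝ) 1, (2 * (u * (1 - u))) ^ k *
        F (rectPermuton (projIcc (0 : ℝ) 1 zero_le_one u)) := by
  have hmeas : Measurable (limitFun (k := k) F) :=
    Measurable.ite measurableSet_forall_mem_openRect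
      ((continuous_comp_rectPermuton hF).measurable.comp measurable_fst) measurable_const
  have hint : Integrable (limitFun (k := k) F) (pointMeasure k) := by
    refine Integrable.of_bound hmeas.aestronglyMeasurable C (Eventually.of_forall fun w => ?_)
    rw [limitFun]
    split_ifs
    · exact hC _
    · rw [norm_zero]
      exact (abs_nonneg _).trans (hC (rectPermuton 0))
  rw [sampleMeasure, integral_fun_snd (fun x : (ℕ → Bool) × ℝ × (Fin k → ℝ × ℝ) =>
    limitFun F x.2), integral_fun_snd (limitFun F)]
  simp only [probReal_univ, one_smul]
  rw [pointMeasure] at hint ⊢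
  rw [integral_prod _ hint, unif]
  refine setIntegral_congr_fun measurableSet_Ioo fun u hu => ?_
  have hset : ∀ p : Fin k → ℝ × ℝ, limitFun F (u, p) =
      (univ.pi fun _ : Fin k => openRect u).indicator
        (fun _ => F (rectPermuton (projIcc (0 : ℝ) 1 zero_le_one u))) p := by
    intro p
    simp [limitFun, Set.indicator, Set.mem_pi]
  have hopen : MeasurableSet (openRect u) := by
    refine IsOpen.measurableSet ?_
    simp only [openRect, Set.ofPred_and]
    refine IsOpen.inter ?_ (IsOpen.inter ?_ (IsOpen.inter ?_ ?_))
    all_goals exact isOpen_lt (by fun_prop) (by fun_prop)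
  simp only [hset]
  rw [integral_indicator_const _ (MeasurableSet.univ_pi fun _ => hopen), Measure.real,
    Measure.pi_pi, smul_eq_mul]
  congr 1
  have h0 : 0 ≤ 2 * (u * (1 - u)) := by nlinarith [hu.1, hu.2]
  have := unif_prod_openRect hu
  rw [unif] at this
  simp only [this, Finset.prod_const, Finset.card_univ, Fintype.card_fin, ENNReal.toReal_pow,
    ENNReal.toReal_ofReal h0]

/-- At integer parameters the Beta constant is `(k!)² / (2k+1)!`, by the values of the Gamma
function. -/
theorem zLaw_eq_betaMeasure (k : ℕ) : zLaw k = betaMeasure (k + 1) (k + 1) := by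
  have hbeta : 1 / beta ((k : ℝ) + 1) (k + 1) = (2 * k + 1) * (Nat.choose (2 * k) k) := by
    have h1 : (k : ℝ) + 1 + (k + 1) = ((2 * k + 1 : ℕ) : ℝ) + 1 := by
      push_cast
      ring
    have h2 : ((Nat.choose (2 * k) k : ℕ) : ℝ) * (k.factorial * k.factorial) =
        (2 * k).factorial := by
      have := Nat.choose_mul_factorial_mul_factorial (n := 2 * k) (k := k) (by omega)
      rw [show 2 * k - k = k by omega, mul_assoc] at this
      exact_mod_cast this
    have h3 : (k.factorial : ℝ) ≠ 0 := by exact_mod_cast k.factorial_ne_zero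
    have h4 : ((2 * k + 1).factorial : ℝ) = (2 * k + 1) * (2 * k).factorial := by
      rw [Nat.factorial_succ]
      push_cast
      ring
    rw [beta, h1, Real.Gamma_nat_eq_factorial, Real.Gamma_nat_eq_factorial, h4, ← h2]
    field_simp
  rw [zLaw, betaMeasure, ← withDensity_indicator measurableSet_Ioo]
  congr 1
  funext t
  rw [betaPDF_eq]
  by_cases ht : t ∈ Ioo (0 : ℝ) 1
  · rw [Set.indicator_of_mem ht, if_pos (Set.mem_Ioo.1 ht), hbeta]
    simp only [add_sub_cancel_right, Real.rpow_natCast]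
    rw [mul_assoc _ (t ^ k), ← mul_pow]
  · rw [Set.indicator_of_notMem ht, if_neg (mt Set.mem_Ioo.2 ht), ENNReal.ofReal_zero]

theorem integral_zLaw (k : ℕ) (g : ℝ → ℝ) :
    ∫ t, g t ∂(zLaw k) =
      ∫ t in Ioo (0 : ℝ) 1, ((2 * k + 1) * (Nat.choose (2 * k) k) * (t * (1 - t)) ^ k) * g t := by
  rw [zLaw, integral_withDensity_eq_integral_toReal_smul (by fun_prop)
    (Eventually.of_forall fun _ => ENNReal.ofReal_lt_top)]
  refine setIntegral_congr_fun measurableSet_Ioo fun t ht => ?_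
  have h0 : 0 ≤ t * (1 - t) := mul_nonneg ht.1.le (by linarith [ht.2])
  simp only [smul_eq_mul]
  rw [ENNReal.toReal_ofReal (by positivity)]

theorem integral_limitFun_eq_zLaw {F : Permuton → ℝ} (hF : Continuous F) {C : ℝ}
    (hC : ∀ μ, |F μ| ≤ C) :
    ∫ s, limitFun F s.2.2 ∂(sampleMeasure k) =
      2 ^ k / ((2 * k + 1) * (Nat.choose (2 * k) k)) *
        ∫ t, F (rectPermuton (projIcc (0 : ℝ) 1 zero_le_one t)) ∂(zLaw k) := by
  have h : ((Nat.choose (2 * k) k : ℕ) : ℝ) ≠ 0 := by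
    exact_mod_cast (Nat.choose_pos (by omega : k ≤ 2 * k)).ne'
  rw [integral_limitFun hF hC, integral_zLaw, ← integral_const_mul]
  congr 1
  funext t
  rw [mul_pow]
  field_simp

instance isProbabilityMeasure_zLaw (k : ℕ) : IsProbabilityMeasure (zLaw k) := by
  rw [zLaw_eq_betaMeasure]
  exact isProbabilityMeasureBeta (by positivity) (by positivity)

/-- Convergence of the averages over almost square permutations. -/
theorem tendsto_average (hN : ∀ n, 0 < n + k) {F : Permuton → ℝ} (hF : Continuous F) {C : ℝ}
    (hC : ∀ μ, |F μ| ≤ C) :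
    (∀ᶠ n in atTop, (ASq n k).Nonempty) ∧
    Tendsto (fun n => (∑ σ ∈ Finset.univ.filter (fun σ => σ ∈ ASq n k),
      F (permPermuton (hN n) σ)) / (Finset.univ.filter (fun σ => σ ∈ ASq n k)).card) atTop
      (𝓝 (∫ t, F (rectPermuton (projIcc (0 : ℝ) 1 zero_le_one t)) ∂(zLaw k))) := by
  set A : ℝ := 2 ^ k / ((2 * k + 1) * (Nat.choose (2 * k) k)) with hA
  have hA0 : A ≠ 0 := by
    have : 0 < Nat.choose (2 * k) k := Nat.choose_pos (by omega)
    positivity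
  -- The factor `a n` collects the probability of a word and the weighted number of words per
  -- permutation. Only its independence of `F` matters, since it cancels in the quotient.
  have hconv : ∃ a : ℕ → ℝ, ∀ (F : Permuton → ℝ), Continuous F → (∃ C, ∀ μ, |F μ| ≤ C) →
      Tendsto (fun n => a n * ∑ σ ∈ Finset.univ.filter (fun σ => σ ∈ ASq n k),
        F (permPermuton (hN n) σ)) atTop
        (𝓝 (A * ∫ t, F (rectPermuton (projIcc (0 : ℝ) 1 zero_le_one t)) ∂(zLaw k))) := by
    refine ⟨fun n => (2⁻¹ ^ (n + k) * (2⁻¹ ^ (n + k) * (ENNReal.ofReal (1 / (n + k : ℕ)) *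
      (ENNReal.ofReal (1 / (n + k : ℕ)) * ENNReal.ofReal (1 / (n + k : ℕ))) ^ k)) :
        ENNReal).toReal * (2 ^ (k + 3) * (2 ^ (k + 2) * k.factorial) : ℕ), ?_⟩
    rintro F hF ⟨C, hC⟩
    have h := tendsto_integral_wordSum hN hF hC
    rw [integral_limitFun_eq_zLaw hF hC] at h
    refine h.congr' ?_
    filter_upwards [eventually_ge_atTop 2] with n hn
    rw [integral_wordOf, sum_wordSum (by omega), mul_assoc]
    simp only [mem_ASq_iff]
  obtain ⟨a, ha⟩ := hconv
  -- The constant function yields the asymptotic count; as its limit `A` is nonzero, the sets are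
  -- eventually nonempty.
  have hone := ha (fun _ => 1) continuous_const ⟨1, fun _ => by simp⟩
  simp only [Finset.sum_const, nsmul_eq_mul, mul_one, integral_const, probReal_univ,
    one_smul] at hone
  have hne := hone.eventually_ne hA0
  refine ⟨?_, ?_⟩
  · filter_upwards [hne] with n hn
    have : (Finset.univ.filter (fun σ => σ ∈ ASq n k)).card ≠ 0 := by
      intro h0
      exact hn (by rw [h0]; simp)
    obtain ⟨σ, hσ⟩ := Finset.card_pos.1 (Nat.pos_of_ne_zero this)
    exact ⟨σ, (Finset.mem_filter.1 hσ).2⟩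
  · have h := (ha F hF ⟨C, hC⟩).div hone hA0
    rw [mul_div_cancel_left₀ _ hA0] at h
    refine h.congr' ?_
    filter_upwards [hne] with n hn
    exact mul_div_mul_left _ _ (left_ne_zero_of_mul hn)

theorem integral_uniformOn {α : Type*} [Fintype α] [MeasurableSpace α]
    [MeasurableSingletonClass α] (S : Set α) (hS : S.Nonempty) (g : α → ℝ) :
    ∫ x, g x ∂(uniformOn S) = (∑ x ∈ Finset.univ.filter (fun x => x ∈ S), g x) /
      (Finset.univ.filter (fun x => x ∈ S)).card := by
  have := isProbabilityMeasure_uniformOn S.toFinite hS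
  have hSe : S = ((Finset.univ.filter fun x => x ∈ S : Finset α) : Set α) := by
    ext
    simp
  rw [integral_fintype Integrable.of_finite, Finset.sum_div, Finset.sum_filter]
  refine Finset.sum_congr rfl fun x _ => ?_
  have h1 : ({x} : Set α) = (({x} : Finset α) : Set α) := by simp
  rw [Measure.real, h1]
  conv_lhs => rw [hSe]
  rw [uniformOn_apply_finset]
  split_ifs with hx
  · rw [Finset.inter_singleton_of_mem (by simpa using hx)]
    simp [div_eq_inv_mul]
  · rw [Finset.inter_singleton_of_notMem (by simpa using hx)]
    simp

end Limit

end AlmostSquare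

theorem theorem1p3 (k : ℕ) (hk : 0 < k)
    {Ω : ℕ → Type*} [∀ n, MeasurableSpace (Ω n)] (P : ∀ n, MeasureTheory.Measure (Ω n))
    [∀ n, MeasureTheory.IsProbabilityMeasure (P n)]
    (σ : ∀ n, Ω n → Equiv.Perm (Fin (n + k))) (hσ : ∀ n, AEMeasurable (σ n) (P n))
    (hunif : ∀ n, (AlmostSquare.ASq n k).Nonempty →
      ProbabilityTheory.HasLaw (σ n)
        (ProbabilityTheory.uniformOn (AlmostSquare.ASq n k)) (P n))
    {Ω' : Type*} [MeasurableSpace Ω'] (Q : MeasureTheory.Measure Ω')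
    [MeasureTheory.IsProbabilityMeasure Q] (z : Ω' → unitInterval)
    (hz : ProbabilityTheory.HasLaw (fun ω => (z ω : ℝ)) (AlmostSquare.zLaw k) Q) :
    ProbabilityTheory.HasLaw (fun ω => (z ω : ℝ))
        (ProbabilityTheory.betaMeasure (k + 1) (k + 1)) Q ∧
      MeasureTheory.TendstoInDistribution
        (fun n ω => AlmostSquare.permPermuton (Nat.add_pos_right n hk) (σ n ω))
        Filter.atTop (fun ω => AlmostSquare.rectPermuton (z ω)) P Q := by
  classical
  -- The hypothesis concerns the real-valued variable; projecting back to the interval returns `z`.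
  have hzm : AEMeasurable z Q := by
    have h : AEMeasurable (fun ω => projIcc (0 : ℝ) 1 zero_le_one (z ω : ℝ)) Q :=
      continuous_projIcc.measurable.comp_aemeasurable hz.aemeasurable
    simpa only [projIcc_val] using h
  have hperm : ∀ n, Measurable (AlmostSquare.permPermuton (Nat.add_pos_right n hk)) :=
    fun n => measurable_from_top
  have hX : ∀ n, AEMeasurable
      (fun ω => AlmostSquare.permPermuton (Nat.add_pos_right n hk) (σ n ω)) (P n) :=
    fun n => (hperm n).comp_aemeasurable (hσ n)
  have hZ : AEMeasurable (fun ω => AlmostSquare.rectPermuton (z ω)) Q :=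
    AlmostSquare.continuous_rectPermuton.measurable.comp_aemeasurable hzm
  refine ⟨AlmostSquare.zLaw_eq_betaMeasure k ▸ hz, hX, hZ, ?_⟩
  refine ProbabilityMeasure.tendsto_iff_forall_integral_tendsto.2 fun F => ?_
  have hFc : Continuous fun μ => F μ := F.continuous
  obtain ⟨hne, hlim⟩ := AlmostSquare.tendsto_average (fun n => Nat.add_pos_right n hk) hFc
    (C := ‖F‖) fun μ => F.norm_coe_le_norm μ
  have hright : ∫ μ, F μ ∂(Q.map fun ω => AlmostSquare.rectPermuton (z ω)) =
      ∫ t, F (AlmostSquare.rectPermuton (projIcc (0 : ℝ) 1 zero_le_one t))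
        ∂(AlmostSquare.zLaw k) := by
    rw [integral_map hZ hFc.measurable.aestronglyMeasurable, ← hz.map_eq,
      integral_map hz.aemeasurable
        (AlmostSquare.continuous_comp_rectPermuton hFc).measurable.aestronglyMeasurable]
    simp only [projIcc_val]
  have hleft : ∀ n, (AlmostSquare.ASq n k).Nonempty →
      ∫ μ, F μ ∂((P n).map fun ω =>
        AlmostSquare.permPermuton (Nat.add_pos_right n hk) (σ n ω)) =
      (∑ τ ∈ Finset.univ.filter (fun τ => τ ∈ AlmostSquare.ASq n k),
        F (AlmostSquare.permPermuton (Nat.add_pos_right n hk) τ)) /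
          (Finset.univ.filter (fun τ => τ ∈ AlmostSquare.ASq n k)).card := by
    intro n hn
    have hG : Measurable fun τ => F (AlmostSquare.permPermuton (Nat.add_pos_right n hk) τ) :=
      measurable_from_top
    rw [integral_map (hX n) hFc.measurable.aestronglyMeasurable,
      ← AlmostSquare.integral_uniformOn _ hn, ← (hunif n hn).map_eq,
      integral_map (hσ n) hG.aestronglyMeasurable]
  simp only [ProbabilityMeasure.coe_mk]
  rw [hright]
  refine hlim.congr' ?_
  -- The law of `σ n` is prescribed only when the set is nonempty, which holds for all large `n`.
  filter_upwards [hne] with n hn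
  rw [hleft n hn]
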